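/- Let $\Omega\subset\mathbb R^3$ be a bounded domain with smooth boundary, let $\Gamma\subset\partial\Omega$ be non-empty and relatively open in $\partial\Omega$, and let $d\in C^2(\overline\Omega)$ (the restriction of a $C^2$ function on $\mathbb R^3$) satisfy $$d>0\ \text{in }\Omega,\qquad |\nabla d|>0\ \text{on }\overline\Omega,\qquad d=0\ \text{on }\partial\Omega\setminus\Gamma .$$ Let $A=(A_{kj})$ be a $3\times3$ matrix field with entries in $W^{1,\infty}(\Omega)$ and $b=(b_1,b_2,b_3)^T$ a vector field with components in $W^{2,\infty}(\Omega)$, all real-valued and identified with their representatives that are continuous on $\overline\Omega$. Consider the first-order operators $$Pf:=\operatorname{div}(fA),\quad [\operatorname{div}M]_k=\sum_{j=1}^3\partial_jM_{kj},\qquad\qquad Qg:=\operatorname{rot}(gb),$$ where derivatives are weak derivatives in $\Omega$ (so $Pf=A\nabla f+f\operatorname{div}A$ and $Qg=\nabla g\times b+g\operatorname{rot}b$). Let $O\subset\Omega$ be open and assume that $$\det A(x)\neq0\quad\text{and}\quad|\nabla d(x)\times b(x)|\neq0\qquad\text{for all }x\in\overline O .$$ For $\lambda>0$ put $\varphi_0:=e^{\lambda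 d}$. Then there are constants $\lambda_0\ge1$, $s_0\ge1$ and $C>0$ (depending on $\Omega,\Gamma,d,A,b,O$, but not on $s,\lambda,f,g$) such that for all $\lambda\ge\lambda_0$ and $s\ge s_0$, all real-valued $f\in H^1(\Omega)$ and $g\in H^2(\Omega)$, $$\int_O\big(|\nabla f|^2+s^2\lambda^2\varphi_0^2|f|^2\big)e^{2s\varphi_0}\,dx\le C\int_O|Pf|^2e^{2s\varphi_0}\,dx+C\int_{\partial O}s\lambda\varphi_0|f|^2e^{2s\varphi_0}\,d\sigma$$ and $$\int_O\big(|\nabla g|^2+s^2\lambda^2\varphi_0^2|g|^2\big)e^{2s\varphi_0}\,dx\le C\int_O\Big(\frac1{s^2\lambda^2\varphi_0^2}|\nabla(Qg)|^2+|Qg|^2\Big)e^{2s\varphi_0}\,dx+C\int_{\partial O}\Big(\frac1{s\lambda\varphi_0}|\nabla g|^2+s\lambda\varphi_0|g|^2\Big)e^{2s\varphi_0}\,d\sigma .$$ Here $\sigma$ is the surface measure (the two-dimensional Hausdorff measure, normalized to agree with area), the boundary integrals take values in $[0,\infty]$, and the values of $f$, $g$ and $\nabla g$ on $\partial O$ are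 traces: $\tau$ is a trace on $\partial O$ of $u\in H^1(\Omega)$ if there are $u_n\in C^1(\mathbb R^3)$ with $u_n\to u$ in $H^1(\Omega)$ and $u_n\to\tau$ $\sigma$-almost everywhere on $\partial O$. The inequalities hold for all such traces. -/

import Mathlib

open MeasureTheory Filter Topology
open scoped ENNReal

namespace Carleman

/-- Three-dimensional Euclidean space. -/
abbrev E3 : Type := EuclideanSpace ℝ (Fin 3)

/-- The classical partial derivative `∂ᵢ u (x)`. -/
noncomputable def pderiv (i : Fin 3) (u : E3 → ℝ) (x : E3) : ℝ :=
  fderiv ℝ u x (EuclideanSpace.single i 1)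

/-- The classical gradient of `u` at `x`, as a coordinate vector. -/
noncomputable def grad (u : E3 → ℝ) (x : E3) : Fin 3 → ℝ := fun i => pderiv i u x

/-- The squared Euclidean length of a coordinate vector. -/
def sqNorm (v : Fin 3 → ℝ) : ℝ := ∑ i, v i ^ 2

/-- A bounded domain (non-empty, open, connected) with smooth boundary: near each boundary point
the domain is the sublevel set `{ρ < 0}` of a smooth function whose differential does not vanish
at that point. -/
structure IsSmoothBoundedDomain (Ω : Set E3) : Prop where
  isOpen : IsOpen Ω
  isConnected : IsConnected Ω
  isBounded : Bornology.IsBounded Ω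
  smooth_frontier : ∀ x ∈ frontier Ω, ∃ (U : Set E3) (ρ : E3 → ℝ), IsOpen U ∧ x ∈ U ∧
    ContDiff ℝ (⊤ : ℕ∞) ρ ∧ fderiv ℝ ρ x ≠ 0 ∧ Ω ∩ U = {y | ρ y < 0} ∩ U

/-- `v` is a weak partial derivative `∂ᵢ u` in `Ω`, tested against `C_c^∞(Ω)`. -/
def HasWeakPartial (Ω : Set E3) (i : Fin 3) (u v : E3 → ℝ) : Prop :=
  LocallyIntegrableOn u Ω volume ∧ LocallyIntegrableOn v Ω volume ∧
  ∀ φ : E3 → ℝ, ContDiff ℝ (⊤ : ℕ∞) φ → HasCompactSupport φ → tsupport φ ⊆ Ω →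
    ∫ x in Ω, u x * pderiv i φ x = - ∫ x in Ω, v x * φ x

/-- The Sobolev space `W^{k,p}(Ω)`: membership of a function all of whose weak derivatives of
order at most `k` exist and lie in `L^p(Ω)`. -/
def MemW (Ω : Set E3) (p : ℝ≥0∞) : ℕ → (E3 → ℝ) → Prop
  | 0, u => MemLp u p (volume.restrict Ω)
  | k + 1, u => MemLp u p (volume.restrict Ω) ∧
      ∀ i, ∃ v, HasWeakPartial Ω i u v ∧ MemW Ω p k v

open Classical in
/-- The weak partial derivative `∂ᵢ u` in `Ω` (unique up to a null set; `0` if there is none). -/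
noncomputable def weakPartial (Ω : Set E3) (i : Fin 3) (u : E3 → ℝ) : E3 → ℝ :=
  if h : ∃ v, HasWeakPartial Ω i u v then h.choose else 0

/-- The weak gradient `∇u` in `Ω`. -/
noncomputable def weakGrad (Ω : Set E3) (u : E3 → ℝ) (x : E3) : Fin 3 → ℝ :=
  fun i => weakPartial Ω i u x

/-- The divergence of a matrix field, `[div M]ₖ = ∑ⱼ ∂ⱼ Mₖⱼ`, with weak derivatives. -/
noncomputable def matDiv (Ω : Set E3) (M : E3 → Matrix (Fin 3) (Fin 3) ℝ) (x : E3) :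
    Fin 3 → ℝ :=
  fun k => ∑ j, weakPartial Ω j (fun y => M y k j) x

/-- The rotation (curl) of a vector field, with weak derivatives. -/
noncomputable def rot (Ω : Set E3) (v : E3 → Fin 3 → ℝ) (x : E3) : Fin 3 → ℝ :=
  ![weakPartial Ω 1 (fun y => v y 2) x - weakPartial Ω 2 (fun y => v y 1) x,
    weakPartial Ω 2 (fun y => v y 0) x - weakPartial Ω 0 (fun y => v y 2) x,
    weakPartial Ω 0 (fun y => v y 1) x - weakPartial Ω 1 (fun y => v y 0) x]

/-- The first-order operator `P f = div (f A)`. -/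
noncomputable def opP (Ω : Set E3) (A : E3 → Matrix (Fin 3) (Fin 3) ℝ) (f : E3 → ℝ) :
    E3 → Fin 3 → ℝ :=
  matDiv Ω (fun y => f y • A y)

/-- The first-order operator `Q g = rot (g b)`. -/
noncomputable def opQ (Ω : Set E3) (b : E3 → Fin 3 → ℝ) (g : E3 → ℝ) : E3 → Fin 3 → ℝ :=
  rot Ω (fun y => g y • b y)

/-- `τ` is the trace on `S ⊆ closure Ω` of the function `f ∈ H¹(Ω)`: the restrictions to `S` of
some functions in `C¹(closure Ω)` that converge to `f` in `H¹(Ω)` converge to `τ` at almost every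
point of `S` for the surface measure. The trace is unique up to a null set of the surface measure
`μHE[2]` on `S`; a limit of the restrictions in `L²(S)` is a trace in this sense, since it is an
almost everywhere limit along a subsequence. -/
def IsTraceOn (Ω S : Set E3) (f τ : E3 → ℝ) : Prop :=
  ∃ F : ℕ → E3 → ℝ, (∀ n, ContDiff ℝ 1 (F n)) ∧
    Tendsto (fun n => eLpNorm (fun x => F n x - f x) 2 (volume.restrict Ω)) atTop (𝓝 0) ∧
    (∀ i, Tendsto (fun n => eLpNorm (fun x => pderiv i (F n) x - weakPartial Ω i f x) 2
      (volume.restrict Ω)) atTop (𝓝 0)) ∧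
    ∀ᵐ x ∂((μHE[2] : Measure E3).restrict S), Tendsto (fun n => F n x) atTop (𝓝 (τ x))

end Carleman

/-!
# Carleman estimates for `f ↦ div (f A)` and `g ↦ rot (g b)`

Both estimates come from one identity. For a vector field `Y` with `∇d · Y ≥ c > 0` on the closure
of `O` and the weight `q = (sλφ)^p e^{2sφ}` with `φ = e^{λd}`, the divergence of `h² q Y` is
`q (2 h ∂_Y h + h² ((pλ + 2sλφ) ∇d · Y + div Y))`. Its integral over `O` is a boundary term, and for
`p ≥ -1` and large `λ` the term `2sλφ q h² ∇d · Y` dominates the other zeroth order terms. Young's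
inequality then bounds `∫ q sλφ h²` by `∫ q (sλφ)⁻¹ |∂_Y h|²` and the boundary integral of `q h²`
(`exists_weighted_estimate`).

For `P`, take `h = f`, `p = 1` and `Y = ∇d`. Since `A` is invertible, `P f = A ∇f + f div A`
controls the gradient of `f` up to a multiple of `f` (`exists_ae_sq_grad_le_opP`), which is absorbed
for large `λ`. For `Q`, take `Y = b × (∇d × b)`. It is orthogonal to `b`, hence `|∂_Y h|` is at most
a multiple of `|∇h × b|`, and `∇d · Y = |∇d × b|² > 0`. Since `Q g = ∇g × b + g rot b`, the field
`∇g × b` is controlled by `Q g` and `g`, and `∇∂ₖg × b` by `∂ₖ Q g`, `∇g` and `g`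
(`exists_ae_sq_cross_le_opQ`). The weighted estimate for `h = g`, `p = 1` bounds `g`, that for
`h = ∂ₖg`, `p = -1` bounds the gradient of `g`, and the lower order terms are again absorbed.

The boundary of the open set `O` is arbitrary, so there is no normal vector and no divergence
theorem. Instead `∫_O ∂ᵢ(h² w)` is computed on the lines parallel to the `i`-th axis: on each
component of a line intersected with `O` the fundamental theorem of calculus leaves two boundary
values. Orthogonal projections do not increase area (`volume_image_proj_le`), so almost every line
misses the exceptional null set of the trace, and integrating the boundary values over all lines
costs at most twice the surface integral of `h² |w|` (`enorm_integral_partial_sq_mul_le`). The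
coefficients are only weakly differentiable, but a continuous function with bounded weak derivatives
is absolutely continuous on almost every line (`HasWeakPartial.sliceDeriv`).
-/

namespace Carleman

/-! ### Mollification -/

/-- A bump function supported in the closed ball of radius `1 / (n + 1)` about the origin. -/
noncomputable def mollifier (n : ℕ) : ContDiffBump (0 : E3) :=
  ⟨1 / (2 * ((n : ℝ) + 1)), 1 / ((n : ℝ) + 1), by positivity, by
    apply one_div_lt_one_div_of_lt <;> linarith [(n.cast_nonneg : (0 : ℝ) ≤ n)]⟩

open scoped Convolution in
/-- The convolution of `u` with the normalized bump function `mollifier n`. -/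
noncomputable def mollify (n : ℕ) (u : E3 → ℝ) : E3 → ℝ :=
  (mollifier n).normed volume ⋆[ContinuousLinearMap.lsmul ℝ ℝ, volume] u

lemma mollifier_rOut (n : ℕ) : (mollifier n).rOut = 1 / ((n : ℝ) + 1) := rfl

lemma tendsto_mollifier_rOut : Tendsto (fun n => (mollifier n).rOut) atTop (𝓝 0) := by
  simp only [mollifier_rOut]
  exact tendsto_one_div_add_atTop_nhds_zero_nat

lemma mollify_apply (n : ℕ) (u : E3 → ℝ) (x : E3) :
    mollify n u x = ∫ y, (mollifier n).normed volume (x - y) * u y := by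
  rw [mollify, convolution_lsmul_swap]
  rfl

lemma tendsto_mollify_of_continuousAt {u : E3 → ℝ} (hu : AEStronglyMeasurable u volume) {x : E3}
    (hx : ContinuousAt u x) : Tendsto (fun n => mollify n u x) atTop (𝓝 (u x)) :=
  ContDiffBump.convolution_tendsto_right (φ := mollifier) (g := fun _ => u) (k := fun _ => x)
    tendsto_mollifier_rOut
    (Eventually.of_forall fun _ => hu) (hx.tendsto.comp tendsto_snd) tendsto_const_nhds

lemma ae_tendsto_mollify {u : E3 → ℝ} (hu : LocallyIntegrable u volume) :
    ∀ᵐ x, Tendsto (fun n => mollify n u x) atTop (𝓝 (u x)) := by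
  refine ContDiffBump.ae_convolution_tendsto_right_of_locallyIntegrable (φ := mollifier) (K := 2)
    tendsto_mollifier_rOut (Eventually.of_forall fun n => le_of_eq ?_) hu
  change 1 / ((n : ℝ) + 1) = 2 * (1 / (2 * ((n : ℝ) + 1)))
  field_simp

lemma integrable_normed_mollifier (n : ℕ) :
    Integrable ((mollifier n).normed (volume : Measure E3)) :=
  (mollifier n).continuous_normed.integrable_of_hasCompactSupport
    (mollifier n).hasCompactSupport_normed

lemma abs_mollify_le {u : E3 → ℝ} {M : ℝ} (hu : ∀ᵐ x, |u x| ≤ M) (n : ℕ) (x : E3) :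
    |mollify n u x| ≤ M := by
  rw [mollify_apply]
  have hint : Integrable (fun y => (mollifier n).normed (volume : Measure E3) (x - y)) :=
    (integrable_normed_mollifier n).comp_sub_left x
  calc |∫ y, (mollifier n).normed volume (x - y) * u y|
      ≤ ∫ y, (mollifier n).normed volume (x - y) * M := by
        rw [← Real.norm_eq_abs]
        refine norm_integral_le_of_norm_le (hint.mul_const M) ?_
        filter_upwards [hu] with y hy
        rw [norm_mul, Real.norm_of_nonneg ((mollifier n).nonneg_normed _), Real.norm_eq_abs]
        gcongr
        exact (mollifier n).nonneg_normed _
    _ = M := by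
        rw [integral_mul_const, integral_sub_left_eq_self, (mollifier n).integral_normed, one_mul]

lemma contDiff_mollify {u : E3 → ℝ} (hu : LocallyIntegrable u volume) (n : ℕ) :
    ContDiff ℝ (⊤ : ℕ∞) (mollify n u) :=
  (mollifier n).hasCompactSupport_normed.contDiff_convolution_left _
    (mollifier n).contDiff_normed hu

lemma pderiv_mollify_of_contDiff {φ : E3 → ℝ} (hφ : ContDiff ℝ 1 φ) (hc : HasCompactSupport φ)
    (i : Fin 3) (n : ℕ) (x : E3) : pderiv i (mollify n φ) x = mollify n (pderiv i φ) x := by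
  have hρ : LocallyIntegrable ((mollifier n).normed (volume : Measure E3)) volume :=
    (integrable_normed_mollifier n).locallyIntegrable
  have h := hc.hasFDerivAt_convolution_right (ContinuousLinearMap.lsmul ℝ ℝ) hρ hφ x
  rw [pderiv, mollify, h.fderiv, convolution_precompR_apply _ hρ (hc.fderiv ℝ)
    (hφ.continuous_fderiv one_ne_zero)]
  rfl

lemma pderiv_mollify {u : E3 → ℝ} (hu : LocallyIntegrable u volume) (i : Fin 3) (n : ℕ) (x : E3) :
    pderiv i (mollify n u) x = ∫ y, pderiv i ((mollifier n).normed volume) (x - y) * u y := by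
  have hc := (mollifier n).hasCompactSupport_normed (μ := volume)
  have hs : ContDiff ℝ 1 ((mollifier n).normed (volume : Measure E3)) :=
    (mollifier n).contDiff_normed
  have h := hc.hasFDerivAt_convolution_right (ContinuousLinearMap.lsmul ℝ ℝ).flip hu hs x
  rw [convolution_flip] at h
  rw [pderiv, mollify, h.fderiv, convolution_precompR_apply _ hu (hc.fderiv ℝ)
    (hs.continuous_fderiv one_ne_zero), ← convolution_flip, convolution_eq_swap]
  simp only [ContinuousLinearMap.flip_flip]
  rfl

/-! ### Calculus of weak derivatives -/

lemma continuous_pderiv {φ : E3 → ℝ} (hφ : ContDiff ℝ 1 φ) (i : Fin 3) :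
    Continuous (pderiv i φ) :=
  (hφ.continuous_fderiv one_ne_zero).clm_apply continuous_const

lemma tsupport_pderiv_subset (φ : E3 → ℝ) (i : Fin 3) : tsupport (pderiv i φ) ⊆ tsupport φ := by
  refine closure_minimal (fun x hx => ?_) (isClosed_tsupport φ)
  have : fderiv ℝ φ x ≠ 0 := fun h => hx (by simp [pderiv, h])
  exact support_fderiv_subset ℝ this

lemma hasCompactSupport_pderiv {φ : E3 → ℝ} (hφ : HasCompactSupport φ) (i : Fin 3) :
    HasCompactSupport (pderiv i φ) :=
  hφ.of_isClosed_subset (isClosed_tsupport _) (tsupport_pderiv_subset φ i)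

lemma pderiv_mul {u v : E3 → ℝ} {x : E3} (hu : DifferentiableAt ℝ u x)
    (hv : DifferentiableAt ℝ v x) (i : Fin 3) :
    pderiv i (fun y => u y * v y) x = u x * pderiv i v x + v x * pderiv i u x := by
  simp [pderiv, fderiv_fun_mul hu hv]

lemma integrable_mul_of_tsupport_subset {Ω : Set E3} {u φ : E3 → ℝ}
    (hu : LocallyIntegrableOn u Ω volume) (hφ : Continuous φ) (hc : HasCompactSupport φ)
    (hs : tsupport φ ⊆ Ω) : Integrable (fun x => u x * φ x) := by
  have h1 : IntegrableOn (fun x => u x * φ x) (tsupport φ) :=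
    (hu.integrableOn_compact_subset hs hc).mul_continuousOn hφ.continuousOn hc
  refine h1.integrable_of_forall_notMem_eq_zero fun x hx => ?_
  rw [image_eq_zero_of_notMem_tsupport hx, mul_zero]

/-- A weak derivative may be tested against `C¹` functions of compact support: mollify the test
function. -/
lemma HasWeakPartial.integral_eq {Ω : Set E3} (hΩ : IsOpen Ω) {i : Fin 3} {u v : E3 → ℝ}
    (h : HasWeakPartial Ω i u v) {φ : E3 → ℝ} (hφ : ContDiff ℝ 1 φ) (hc : HasCompactSupport φ)
    (hs : tsupport φ ⊆ Ω) : ∫ x in Ω, u x * pderiv i φ x = - ∫ x in Ω, v x * φ x := by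
  obtain ⟨hu, hv, htest⟩ := h
  obtain ⟨δ, hδ, hδΩ⟩ := hc.isCompact.exists_cthickening_subset_open hΩ hs
  set K := Metric.cthickening δ (tsupport φ) with hK
  have hKc : IsCompact K := hc.isCompact.cthickening
  have hsmall : ∀ᶠ n in atTop, (mollifier n).rOut < δ :=
    tendsto_mollifier_rOut.eventually (gt_mem_nhds hδ)
  -- outside `K` the mollified functions vanish
  have hzero : ∀ ψ : E3 → ℝ, tsupport ψ ⊆ tsupport φ → ∀ n, (mollifier n).rOut < δ →
      ∀ x, x ∉ K → mollify n ψ x = 0 := by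
    intro ψ hψ n hn x hx
    rw [mollify_apply]
    refine integral_eq_zero_of_ae (Eventually.of_forall fun y => ?_)
    by_cases hy : y ∈ tsupport φ
    · have : (mollifier n).normed volume (x - y) = 0 := by
        rw [← Function.notMem_support, (mollifier n).support_normed_eq]
        intro hxy
        rw [mem_ball_zero_iff, ← dist_eq_norm] at hxy
        exact hx (Metric.mem_cthickening_of_dist_le x y δ _ hy (hxy.trans hn).le)
      simp [this]
    · simp [image_eq_zero_of_notMem_tsupport (fun h => hy (hψ h))]
  -- dominated convergence for the integrals against a continuous function supported in `tsupport φ`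
  have hconv : ∀ w : E3 → ℝ, LocallyIntegrableOn w Ω volume → ∀ ψ : E3 → ℝ, Continuous ψ →
      tsupport ψ ⊆ tsupport φ →
      Tendsto (fun n => ∫ x in Ω, w x * mollify n ψ x) atTop (𝓝 (∫ x in Ω, w x * ψ x)) := by
    intro w hw ψ hψ hsψ
    have hcψ : HasCompactSupport ψ := hc.of_isClosed_subset (isClosed_tsupport _) hsψ
    obtain ⟨M, hM⟩ := hcψ.exists_bound_of_continuous hψ
    have hwK : IntegrableOn w K := hw.integrableOn_compact_subset hδΩ hKc
    have hwm : AEStronglyMeasurable w (volume.restrict Ω) := hw.aestronglyMeasurable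
    refine tendsto_integral_filter_of_dominated_convergence
      (fun x => K.indicator (fun x => ‖w x‖ * M) x) ?_ ?_ ?_ ?_
    · exact Eventually.of_forall fun n => hwm.mul
        (contDiff_mollify (hψ.locallyIntegrable) n).continuous.aestronglyMeasurable
    · filter_upwards [hsmall] with n hn
      refine Eventually.of_forall fun x => ?_
      by_cases hx : x ∈ K
      · rw [Set.indicator_of_mem hx, norm_mul]
        gcongr
        exact abs_mollify_le (Eventually.of_forall hM) n x
      · rw [Set.indicator_of_notMem hx, hzero ψ hsψ n hn x hx]
        simp
    · refine Integrable.mono_measure ?_ Measure.restrict_le_self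
      rw [integrable_indicator_iff hKc.measurableSet]
      exact hwK.norm.mul_const M
    · exact Eventually.of_forall fun x => (tendsto_mollify_of_continuousAt
        hψ.aestronglyMeasurable hψ.continuousAt).const_mul (w x)
  have h1 := hconv u hu _ (continuous_pderiv hφ i) (tsupport_pderiv_subset φ i)
  have h2 := (hconv v hv φ hφ.continuous subset_rfl).neg
  refine tendsto_nhds_unique_of_eventuallyEq h1 h2 ?_
  filter_upwards [hsmall] with n hn
  have hts : tsupport (mollify n φ) ⊆ K := by
    refine closure_minimal (fun x hx => ?_) hKc.isClosed
    by_contra hxK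
    exact hx (hzero φ subset_rfl n hn x hxK)
  rw [← htest (mollify n φ) (contDiff_mollify hφ.continuous.locallyIntegrable n)
    (hKc.of_isClosed_subset (isClosed_tsupport _) hts) (hts.trans hδΩ)]
  simp only [pderiv_mollify_of_contDiff hφ hc]

lemma HasWeakPartial.ae_eq {Ω : Set E3} (hΩ : IsOpen Ω) {i : Fin 3} {u v v' : E3 → ℝ}
    (h : HasWeakPartial Ω i u v) (h' : HasWeakPartial Ω i u v') :
    v =ᵐ[volume.restrict Ω] v' := by
  have h0 : ∀ᵐ x, x ∈ Ω → v x - v' x = 0 := by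
    refine hΩ.ae_eq_zero_of_integral_contDiff_smul_eq_zero (h.2.1.sub h'.2.1) fun g hg hc hs => ?_
    have e1 := h.2.2 g hg hc hs
    have e2 := h'.2.2 g hg hc hs
    have i1 := integrable_mul_of_tsupport_subset h.2.1 hg.continuous hc hs
    have i2 := integrable_mul_of_tsupport_subset h'.2.1 hg.continuous hc hs
    have e3 : ∫ x in Ω, v x * g x = ∫ x in Ω, v' x * g x := by linarith
    have hsub : ∀ w : E3 → ℝ, ∀ x ∉ Ω, w x * g x = 0 := fun w x hx => by
      rw [image_eq_zero_of_notMem_tsupport (fun h => hx (hs h)), mul_zero]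
    rw [setIntegral_eq_integral_of_forall_compl_eq_zero (hsub v),
      setIntegral_eq_integral_of_forall_compl_eq_zero (hsub v')] at e3
    have : ∀ x, g x • (v x - v' x) = v x * g x - v' x * g x := fun x => by
      simp only [smul_eq_mul]; ring
    simp only [this]
    rw [integral_sub i1 i2, e3, sub_self]
  rw [Filter.EventuallyEq, ae_restrict_iff' hΩ.measurableSet]
  filter_upwards [h0] with x hx hxΩ
  exact sub_eq_zero.1 (hx hxΩ)

lemma HasWeakPartial.hasWeakPartial_weakPartial {Ω : Set E3} {i : Fin 3} {u v : E3 → ℝ}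
    (h : HasWeakPartial Ω i u v) : HasWeakPartial Ω i u (weakPartial Ω i u) := by
  have h' : ∃ v, HasWeakPartial Ω i u v := ⟨v, h⟩
  rw [weakPartial, dif_pos h']
  exact h'.choose_spec

lemma HasWeakPartial.weakPartial_ae_eq {Ω : Set E3} (hΩ : IsOpen Ω) {i : Fin 3} {u v : E3 → ℝ}
    (h : HasWeakPartial Ω i u v) : weakPartial Ω i u =ᵐ[volume.restrict Ω] v :=
  h.hasWeakPartial_weakPartial.ae_eq hΩ h

lemma HasWeakPartial.congr {Ω : Set E3} (hΩ : IsOpen Ω) {i : Fin 3} {u u' v v' : E3 → ℝ}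
    (h : HasWeakPartial Ω i u v) (hu : u =ᵐ[volume.restrict Ω] u')
    (hv : v =ᵐ[volume.restrict Ω] v') : HasWeakPartial Ω i u' v' := by
  have loc : ∀ w w' : E3 → ℝ, LocallyIntegrableOn w Ω volume → w =ᵐ[volume.restrict Ω] w' →
      LocallyIntegrableOn w' Ω volume := by
    intro w w' hw hww
    rw [locallyIntegrableOn_iff hΩ.isLocallyClosed] at hw ⊢
    exact fun K hK hKc => (hw K hK hKc).congr_fun_ae (ae_restrict_of_ae_restrict_of_subset hK hww)
  refine ⟨loc u u' h.1 hu, loc v v' h.2.1 hv, fun φ hφ hc hs => ?_⟩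
  have e1 : ∫ x in Ω, u x * pderiv i φ x = ∫ x in Ω, u' x * pderiv i φ x :=
    integral_congr_ae (by filter_upwards [hu] with x hx; simp only [hx])
  have e2 : ∫ x in Ω, v x * φ x = ∫ x in Ω, v' x * φ x :=
    integral_congr_ae (by filter_upwards [hv] with x hx; simp only [hx])
  rw [← e1, ← e2, h.2.2 φ hφ hc hs]

lemma HasWeakPartial.sub {Ω : Set E3} {i : Fin 3} {u u' v v' : E3 → ℝ}
    (h : HasWeakPartial Ω i u v) (h' : HasWeakPartial Ω i u' v') :
    HasWeakPartial Ω i (fun x => u x - u' x) (fun x => v x - v' x) := by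
  refine ⟨h.1.sub h'.1, h.2.1.sub h'.2.1, fun φ hφ hc hs => ?_⟩
  have hφ1 : ContDiff ℝ 1 φ := hφ.of_le (by exact_mod_cast le_top)
  have hp := continuous_pderiv hφ1 i
  have hpc := hasCompactSupport_pderiv hc i
  have hps := (tsupport_pderiv_subset φ i).trans hs
  have I := fun (w ψ : E3 → ℝ) hw hψ hcψ hsψ =>
    (integrable_mul_of_tsupport_subset (Ω := Ω) (u := w) (φ := ψ) hw hψ hcψ hsψ).restrict (s := Ω)
  simp only [sub_mul]
  rw [integral_sub (I _ _ h.1 hp hpc hps) (I _ _ h'.1 hp hpc hps),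
    integral_sub (I _ _ h.2.1 hφ.continuous hc hs) (I _ _ h'.2.1 hφ.continuous hc hs),
    h.2.2 φ hφ hc hs, h'.2.2 φ hφ hc hs]
  ring

lemma HasWeakPartial.add {Ω : Set E3} {i : Fin 3} {u u' v v' : E3 → ℝ}
    (h : HasWeakPartial Ω i u v) (h' : HasWeakPartial Ω i u' v') :
    HasWeakPartial Ω i (fun x => u x + u' x) (fun x => v x + v' x) := by
  refine ⟨h.1.add h'.1, h.2.1.add h'.2.1, fun φ hφ hc hs => ?_⟩
  have hφ1 : ContDiff ℝ 1 φ := hφ.of_le (by exact_mod_cast le_top)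
  have hp := continuous_pderiv hφ1 i
  have hpc := hasCompactSupport_pderiv hc i
  have hps := (tsupport_pderiv_subset φ i).trans hs
  have I := fun (w ψ : E3 → ℝ) hw hψ hcψ hsψ =>
    (integrable_mul_of_tsupport_subset (Ω := Ω) (u := w) (φ := ψ) hw hψ hcψ hsψ).restrict (s := Ω)
  simp only [add_mul]
  rw [integral_add (I _ _ h.1 hp hpc hps) (I _ _ h'.1 hp hpc hps),
    integral_add (I _ _ h.2.1 hφ.continuous hc hs) (I _ _ h'.2.1 hφ.continuous hc hs),
    h.2.2 φ hφ hc hs, h'.2.2 φ hφ hc hs]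
  ring

/-! ### Products of Sobolev functions -/

lemma tendsto_lintegral_enorm_mul_sub {α : Type*} [MeasurableSpace α] {μ : Measure α}
    {G H : α → ℝ} {Gn Hn : ℕ → α → ℝ} (hG : MemLp G 2 μ) (hH : MemLp H 2 μ)
    (hGn : ∀ n, AEStronglyMeasurable (Gn n) μ) (hHn : ∀ n, AEStronglyMeasurable (Hn n) μ)
    (hGt : Tendsto (fun n => eLpNorm (fun x => Gn n x - G x) 2 μ) atTop (𝓝 0))
    (hHt : Tendsto (fun n => eLpNorm (fun x => Hn n x - H x) 2 μ) atTop (𝓝 0)) :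
    Tendsto (fun n => ∫⁻ x, ‖Gn n x * Hn n x - G x * H x‖ₑ ∂μ) atTop (𝓝 0) := by
  have hold : ∀ u v : α → ℝ, AEStronglyMeasurable u μ → AEStronglyMeasurable v μ →
      ∫⁻ x, ‖u x * v x‖ₑ ∂μ ≤ eLpNorm u 2 μ * eLpNorm v 2 μ := by
    intro u v hu hv
    have := eLpNorm_smul_le_mul_eLpNorm (p := 2) (q := 2) (r := 1) hv hu
    rw [eLpNorm_one_eq_lintegral_enorm] at this
    exact this
  have hlim : Tendsto (fun n => eLpNorm (fun x => Gn n x - G x) 2 μ *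
      eLpNorm (fun x => Hn n x - H x) 2 μ + eLpNorm (fun x => Gn n x - G x) 2 μ * eLpNorm H 2 μ
      + eLpNorm G 2 μ * eLpNorm (fun x => Hn n x - H x) 2 μ) atTop (𝓝 0) := by
    have h1 := ENNReal.Tendsto.mul hGt (by simp) hHt (by simp)
    have h2 := ENNReal.Tendsto.mul_const (b := eLpNorm H 2 μ) hGt (Or.inr hH.2.ne)
    have h3 := ENNReal.Tendsto.const_mul (a := eLpNorm G 2 μ) hHt (Or.inr hG.2.ne)
    simpa using (h1.add h2).add h3
  refine tendsto_of_tendsto_of_tendsto_of_le_of_le tendsto_const_nhds hlim (fun _ => zero_le)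
    fun n => ?_
  have mG : AEStronglyMeasurable (fun x => Gn n x - G x) μ := (hGn n).sub hG.1
  have mH : AEStronglyMeasurable (fun x => Hn n x - H x) μ := (hHn n).sub hH.1
  calc ∫⁻ x, ‖Gn n x * Hn n x - G x * H x‖ₑ ∂μ
      ≤ ∫⁻ x, (‖(Gn n x - G x) * (Hn n x - H x)‖ₑ + ‖(Gn n x - G x) * H x‖ₑ)
          + ‖G x * (Hn n x - H x)‖ₑ ∂μ := by
        refine lintegral_mono fun x => ?_
        have : Gn n x * Hn n x - G x * H x = (Gn n x - G x) * (Hn n x - H x)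
          + (Gn n x - G x) * H x + G x * (Hn n x - H x) := by ring
        rw [this]
        exact (enorm_add_le _ _).trans (by gcongr; exact enorm_add_le _ _)
    _ = (∫⁻ x, ‖(Gn n x - G x) * (Hn n x - H x)‖ₑ ∂μ + ∫⁻ x, ‖(Gn n x - G x) * H x‖ₑ ∂μ)
          + ∫⁻ x, ‖G x * (Hn n x - H x)‖ₑ ∂μ := by
        rw [← lintegral_add_left' (f := fun x => ‖(Gn n x - G x) * (Hn n x - H x)‖ₑ)
          (mG.mul mH).enorm]
        exact lintegral_add_left' ((mG.mul mH).enorm.add (mG.mul hH.1).enorm) _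
    _ ≤ _ := by
        gcongr
        · exact hold _ _ mG mH
        · exact hold _ _ mG hH.1
        · exact hold _ _ hG.1 mH

lemma MemLp.ae_abs_le {Ω : Set E3} {a : E3 → ℝ} (ha : MemLp a ⊤ (volume.restrict Ω)) :
    ∃ M : ℝ, 0 ≤ M ∧ ∀ᵐ x ∂volume.restrict Ω, |a x| ≤ M := by
  refine ⟨(eLpNorm a ⊤ (volume.restrict Ω)).toReal, ENNReal.toReal_nonneg, ?_⟩
  have h := ae_le_eLpNormEssSup (f := a) (μ := volume.restrict Ω)
  filter_upwards [h] with x hx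
  rw [← eLpNorm_exponent_top] at hx
  have := ENNReal.toReal_mono ha.2.ne hx
  simpa using this

lemma locallyIntegrableOn_of_memLp {Ω : Set E3} {u : E3 → ℝ} {p : ℝ≥0∞} (hp : 1 ≤ p)
    (hu : MemLp u p (volume.restrict Ω)) : LocallyIntegrableOn u Ω volume :=
  locallyIntegrableOn_of_locallyIntegrable_restrict (hu.locallyIntegrable hp)

/-- The functions `F n` of class `C¹(ℝ³)` converge to `f` in `H¹(Ω)`, where `Df` is the gradient
of `f`. -/
structure StrongApprox (Ω : Set E3) (F : ℕ → E3 → ℝ) (f : E3 → ℝ) (Df : Fin 3 → E3 → ℝ) :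
    Prop where
  contDiff : ∀ n, ContDiff ℝ 1 (F n)
  memLp : MemLp f 2 (volume.restrict Ω)
  memLp_grad : ∀ i, MemLp (Df i) 2 (volume.restrict Ω)
  tendsto : Tendsto (fun n => eLpNorm (fun x => F n x - f x) 2 (volume.restrict Ω)) atTop (𝓝 0)
  tendsto_grad : ∀ i, Tendsto (fun n => eLpNorm (fun x => pderiv i (F n) x - Df i x) 2
      (volume.restrict Ω)) atTop (𝓝 0)

lemma tendsto_integral_mul_of_tendsto_eLpNorm {Ω : Set E3} {G k : E3 → ℝ} {Gn : ℕ → E3 → ℝ}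
    (hG : MemLp G 2 (volume.restrict Ω)) (hk : MemLp k 2 (volume.restrict Ω))
    (hGn : ∀ n, AEStronglyMeasurable (Gn n) (volume.restrict Ω))
    (hGt : Tendsto (fun n => eLpNorm (fun x => Gn n x - G x) 2 (volume.restrict Ω)) atTop (𝓝 0)) :
    Tendsto (fun n => ∫ x in Ω, Gn n x * k x) atTop (𝓝 (∫ x in Ω, G x * k x)) := by
  have h := tendsto_lintegral_enorm_mul_sub (Hn := fun _ => k) hG hk hGn (fun _ => hk.1) hGt
    (by simp)
  refine tendsto_integral_of_L1 _ (hG.1.mul hk.1) ?_ h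
  filter_upwards [hGt.eventually (gt_mem_nhds ENNReal.zero_lt_top)] with n hn
  have h1 : MemLp (fun x => Gn n x - G x) 2 (volume.restrict Ω) := ⟨(hGn n).sub hG.1, hn⟩
  have h2 : MemLp (Gn n) 2 (volume.restrict Ω) := by
    have := h1.add hG
    refine this.ae_eq (Eventually.of_forall fun x => ?_)
    simp
  exact h2.integrable_mul hk

/-- The product rule for an `H¹` function that is a limit of `C¹` functions and a `W^{1,∞}`
function. -/
lemma HasWeakPartial.mul_of_strongApprox {Ω : Set E3} (hΩ : IsOpen Ω) {i : Fin 3}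
    {F : ℕ → E3 → ℝ} {f : E3 → ℝ} {Df : Fin 3 → E3 → ℝ} (hF : StrongApprox Ω F f Df)
    {a a' : E3 → ℝ} (ha : HasWeakPartial Ω i a a') (hab : MemLp a ⊤ (volume.restrict Ω))
    (hab' : MemLp a' ⊤ (volume.restrict Ω)) :
    HasWeakPartial Ω i (fun x => f x * a x) (fun x => Df i x * a x + f x * a' x) := by
  have m1 : MemLp (fun x => f x * a x) 2 (volume.restrict Ω) := hab.mul' hF.memLp
  have m2 : MemLp (fun x => Df i x * a x) 2 (volume.restrict Ω) := hab.mul' (hF.memLp_grad i)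
  have m3 : MemLp (fun x => f x * a' x) 2 (volume.restrict Ω) := hab'.mul' hF.memLp
  refine ⟨locallyIntegrableOn_of_memLp (by norm_num) m1,
    locallyIntegrableOn_of_memLp (by norm_num) (m2.add m3), fun φ hφ hc hs => ?_⟩
  have hφ1 : ContDiff ℝ 1 φ := hφ.of_le (by exact_mod_cast le_top)
  have mφ : MemLp φ 2 (volume.restrict Ω) :=
    (hφ.continuous.memLp_of_hasCompactSupport hc).restrict Ω
  have mdφ : MemLp (pderiv i φ) 2 (volume.restrict Ω) :=
    ((continuous_pderiv hφ1 i).memLp_of_hasCompactSupport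
      (hasCompactSupport_pderiv hc i)).restrict Ω
  have k1 : MemLp (fun x => a x * pderiv i φ x) 2 (volume.restrict Ω) := mdφ.mul' hab
  have k2 : MemLp (fun x => a x * φ x) 2 (volume.restrict Ω) := mφ.mul' hab
  have k3 : MemLp (fun x => a' x * φ x) 2 (volume.restrict Ω) := mφ.mul' hab'
  have mF : ∀ n, AEStronglyMeasurable (F n) (volume.restrict Ω) :=
    fun n => (hF.contDiff n).continuous.aestronglyMeasurable
  have mdF : ∀ n, AEStronglyMeasurable (pderiv i (F n)) (volume.restrict Ω) :=
    fun n => (continuous_pderiv (hF.contDiff n) i).aestronglyMeasurable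
  have t1 := tendsto_integral_mul_of_tendsto_eLpNorm hF.memLp k1 mF hF.tendsto
  have t2 := tendsto_integral_mul_of_tendsto_eLpNorm (hF.memLp_grad i) k2 mdF (hF.tendsto_grad i)
  have t3 := tendsto_integral_mul_of_tendsto_eLpNorm hF.memLp k3 mF hF.tendsto
  have key : ∀ n, ∫ x in Ω, F n x * (a x * pderiv i φ x) =
      -((∫ x in Ω, pderiv i (F n) x * (a x * φ x)) + ∫ x in Ω, F n x * (a' x * φ x)) := by
    intro n
    have hFc := hF.contDiff n
    have hFφ : ContDiff ℝ 1 (fun x => F n x * φ x) := hFc.mul hφ1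
    have hsub : tsupport (fun x => F n x * φ x) ⊆ tsupport φ :=
      closure_mono fun x hx => right_ne_zero_of_mul hx
    have hcc : HasCompactSupport (fun x => F n x * φ x) :=
      hc.of_isClosed_subset (isClosed_tsupport _) hsub
    have h := ha.integral_eq hΩ hFφ hcc (hsub.trans hs)
    have e1 : ∀ x, a x * pderiv i (fun x => F n x * φ x) x =
        a x * (F n x * pderiv i φ x) + a x * (pderiv i (F n) x * φ x) := fun x => by
      rw [pderiv_mul (hFc.differentiable one_ne_zero x) (hφ1.differentiable one_ne_zero x)]
      ring
    have i1 : IntegrableOn (fun x => a x * (F n x * pderiv i φ x)) Ω :=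
      (integrable_mul_of_tsupport_subset ha.1 (hFc.continuous.mul (continuous_pderiv hφ1 i))
        ((hasCompactSupport_pderiv hc i).mul_left)
        ((closure_mono fun x hx => right_ne_zero_of_mul hx).trans
          ((tsupport_pderiv_subset φ i).trans hs))).integrableOn
    have i2 : IntegrableOn (fun x => a x * (pderiv i (F n) x * φ x)) Ω :=
      (integrable_mul_of_tsupport_subset ha.1 ((continuous_pderiv hFc i).mul hφ.continuous)
        hc.mul_left ((closure_mono fun x hx => right_ne_zero_of_mul hx).trans hs)).integrableOn
    simp only [e1] at h
    rw [integral_add i1 i2] at h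
    have r1 : ∫ x in Ω, F n x * (a x * pderiv i φ x) = ∫ x in Ω, a x * (F n x * pderiv i φ x) := by
      congr 1; ext x; ring
    have r2 : ∫ x in Ω, pderiv i (F n) x * (a x * φ x) =
        ∫ x in Ω, a x * (pderiv i (F n) x * φ x) := by
      congr 1; ext x; ring
    have r3 : ∫ x in Ω, F n x * (a' x * φ x) = ∫ x in Ω, a' x * (F n x * φ x) := by
      congr 1; ext x; ring
    rw [r1, r2, r3]
    linarith
  have hlim := tendsto_nhds_unique t1 (((t2.add t3).neg).congr fun n => (key n).symm)
  have s1 : ∫ x in Ω, f x * a x * pderiv i φ x = ∫ x in Ω, f x * (a x * pderiv i φ x) := by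
    congr 1; ext x; ring
  have s2 : ∫ x in Ω, (Df i x * a x + f x * a' x) * φ x =
      (∫ x in Ω, Df i x * (a x * φ x)) + ∫ x in Ω, f x * (a' x * φ x) := by
    have := integral_add ((hF.memLp_grad i).integrable_mul k2) (hF.memLp.integrable_mul k3)
    refine Eq.trans ?_ this
    congr 1; ext x; simp only [Pi.mul_apply]; ring
  rw [s1, s2, hlim]

/-! ### Slices by coordinate lines -/

/-- Euclidean space as a family of lines parallel to the `i`-th axis: `sliceEquiv i (y, t)` has
`i`-th coordinate `t` and remaining coordinates `y`. -/
noncomputable def sliceEquiv (i : Fin 3) : (Fin 2 → ℝ) × ℝ ≃ᵐ E3 :=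
  MeasurableEquiv.prodComm.trans
    ((MeasurableEquiv.piFinSuccAbove (fun _ : Fin 3 => ℝ) i).symm.trans
      (MeasurableEquiv.toLp 2 (Fin 3 → ℝ)))

/-- The point of the line indexed by `y` in direction `i` with `i`-th coordinate `t`. -/
noncomputable def sl (i : Fin 3) (y : Fin 2 → ℝ) (t : ℝ) : E3 := sliceEquiv i (y, t)

lemma sl_apply_same (i : Fin 3) (y : Fin 2 → ℝ) (t : ℝ) : sl i y t i = t := by
  change (i.insertNth t y : Fin 3 → ℝ) i = t
  simp

lemma sl_apply_succAbove (i : Fin 3) (y : Fin 2 → ℝ) (t : ℝ) (j : Fin 2) :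
    sl i y t (i.succAbove j) = y j := by
  change (i.insertNth t y : Fin 3 → ℝ) (i.succAbove j) = y j
  simp

lemma sl_eq (i : Fin 3) (y : Fin 2 → ℝ) (t : ℝ) :
    sl i y t = sl i y 0 + t • EuclideanSpace.single i (1 : ℝ) := by
  ext j
  rcases Fin.eq_self_or_eq_succAbove i j with rfl | ⟨k, rfl⟩
  · simp [sl_apply_same]
  · simp [sl_apply_succAbove]

lemma measurePreserving_sliceEquiv (i : Fin 3) :
    MeasurePreserving (sliceEquiv i) (volume : Measure ((Fin 2 → ℝ) × ℝ)) volume :=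
  (Measure.measurePreserving_swap (μ := (volume : Measure (Fin 2 → ℝ)))
    (ν := (volume : Measure ℝ))).trans
    (((volume_preserving_piFinSuccAbove (fun _ : Fin 3 => ℝ) i).symm _).trans
      (PiLp.volume_preserving_toLp (Fin 3)))

lemma ae_ae_sl {p : E3 → Prop} (i : Fin 3) (h : ∀ᵐ x, p x) : ∀ᵐ y, ∀ᵐ t, p (sl i y t) :=
  Measure.ae_ae_of_ae_prod ((measurePreserving_sliceEquiv i).quasiMeasurePreserving.ae h)

lemma hasDerivAt_sl (i : Fin 3) (y : Fin 2 → ℝ) (t : ℝ) :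
    HasDerivAt (sl i y) (EuclideanSpace.single i (1 : ℝ)) t := by
  have h : sl i y = fun t => sl i y 0 + t • EuclideanSpace.single i (1 : ℝ) := funext (sl_eq i y)
  rw [h]
  simpa using ((hasDerivAt_id t).smul_const (EuclideanSpace.single i (1 : ℝ))).const_add (sl i y 0)

lemma contDiff_sl (i : Fin 3) (y : Fin 2 → ℝ) {n : WithTop ℕ∞} : ContDiff ℝ n (sl i y) := by
  have h : sl i y = fun t => sl i y 0 + t • EuclideanSpace.single i (1 : ℝ) := funext (sl_eq i y)
  rw [h]
  fun_prop

lemma continuous_sl (i : Fin 3) (y : Fin 2 → ℝ) : Continuous (sl i y) :=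
  (contDiff_sl i y (n := 0)).continuous

lemma hasDerivAt_comp_sl {u : E3 → ℝ} (i : Fin 3) (y : Fin 2 → ℝ) {t : ℝ}
    (hu : DifferentiableAt ℝ u (sl i y t)) :
    HasDerivAt (fun t => u (sl i y t)) (pderiv i u (sl i y t)) t :=
  hu.hasFDerivAt.comp_hasDerivAt t (hasDerivAt_sl i y t)

/-- `w` is absolutely continuous with derivative `z` on the compact segments in `O` of almost
every line parallel to the `i`-th axis. -/
def SliceDeriv (O : Set E3) (i : Fin 3) (w z : E3 → ℝ) : Prop :=
  ∀ᵐ y, ∀ p q : ℝ, p ≤ q → (∀ t ∈ Set.Icc p q, sl i y t ∈ O) →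
    AbsolutelyContinuousOnInterval (fun t => w (sl i y t)) p q ∧
    ∀ᵐ t, t ∈ Set.Icc p q → HasDerivAt (fun t => w (sl i y t)) (z (sl i y t)) t

lemma SliceDeriv.mono {O O' : Set E3} {i : Fin 3} {w z : E3 → ℝ} (h : SliceDeriv O i w z)
    (hO : O' ⊆ O) : SliceDeriv O' i w z := by
  filter_upwards [h] with y hy p q hpq hseg using hy p q hpq fun t ht => hO (hseg t ht)

lemma SliceDeriv.mul {O : Set E3} {i : Fin 3} {w z w' z' : E3 → ℝ} (h : SliceDeriv O i w z)
    (h' : SliceDeriv O i w' z') :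
    SliceDeriv O i (fun x => w x * w' x) (fun x => z x * w' x + w x * z' x) := by
  filter_upwards [h, h'] with y hy hy' p q hpq hseg
  refine ⟨(hy p q hpq hseg).1.mul (hy' p q hpq hseg).1, ?_⟩
  filter_upwards [(hy p q hpq hseg).2, (hy' p q hpq hseg).2] with t ht ht' hm
  exact (ht hm).mul (ht' hm)

lemma SliceDeriv.add {O : Set E3} {i : Fin 3} {w z w' z' : E3 → ℝ} (h : SliceDeriv O i w z)
    (h' : SliceDeriv O i w' z') :
    SliceDeriv O i (fun x => w x + w' x) (fun x => z x + z' x) := by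
  filter_upwards [h, h'] with y hy hy' p q hpq hseg
  refine ⟨(hy p q hpq hseg).1.add (hy' p q hpq hseg).1, ?_⟩
  filter_upwards [(hy p q hpq hseg).2, (hy' p q hpq hseg).2] with t ht ht' hm
  exact (ht hm).add (ht' hm)

lemma SliceDeriv.sub {O : Set E3} {i : Fin 3} {w z w' z' : E3 → ℝ} (h : SliceDeriv O i w z)
    (h' : SliceDeriv O i w' z') :
    SliceDeriv O i (fun x => w x - w' x) (fun x => z x - z' x) := by
  filter_upwards [h, h'] with y hy hy' p q hpq hseg
  refine ⟨(hy p q hpq hseg).1.sub (hy' p q hpq hseg).1, ?_⟩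
  filter_upwards [(hy p q hpq hseg).2, (hy' p q hpq hseg).2] with t ht ht' hm
  exact (ht hm).sub (ht' hm)

lemma sliceDeriv_of_contDiff {u : E3 → ℝ} (hu : ContDiff ℝ 1 u) (O : Set E3) (i : Fin 3) :
    SliceDeriv O i u (pderiv i u) := by
  refine Eventually.of_forall fun y p q _ _ => ⟨?_, Eventually.of_forall fun t _ =>
    hasDerivAt_comp_sl i y (hu.differentiable one_ne_zero _)⟩
  exact (hu.comp (contDiff_sl i y)).contDiffOn.absolutelyContinuousOnInterval

lemma pderiv_mollify_indicator {Ω : Set E3} (hΩ : MeasurableSet Ω) {i : Fin 3} {u v : E3 → ℝ}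
    (h : HasWeakPartial Ω i u v) (hu : LocallyIntegrable (Ω.indicator u) volume) {n : ℕ} {x : E3}
    (hx : Metric.closedBall x (mollifier n).rOut ⊆ Ω) :
    pderiv i (mollify n (Ω.indicator u)) x = mollify n (Ω.indicator v) x := by
  set ρ := (mollifier n).normed (volume : Measure E3) with hρ
  have hρs : ContDiff ℝ (⊤ : ℕ∞) ρ := (mollifier n).contDiff_normed
  have hφ : ContDiff ℝ (⊤ : ℕ∞) (fun y => ρ (x - y)) := hρs.comp (contDiff_const.sub contDiff_id)
  have hsupp : tsupport (fun y => ρ (x - y)) ⊆ Metric.closedBall x (mollifier n).rOut := by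
    refine closure_minimal (fun y hy => ?_) Metric.isClosed_closedBall
    have : x - y ∈ Function.support ρ := hy
    rw [hρ, (mollifier n).support_normed_eq, mem_ball_zero_iff, ← dist_eq_norm] at this
    rw [Metric.mem_closedBall, dist_comm]
    exact this.le
  have hc : HasCompactSupport (fun y => ρ (x - y)) :=
    (isCompact_closedBall x _).of_isClosed_subset (isClosed_tsupport _) hsupp
  have hpd : ∀ y, pderiv i (fun y => ρ (x - y)) y = -pderiv i ρ (x - y) := by
    intro y
    have hd : HasFDerivAt ρ (fderiv ℝ ρ (x - y)) (x - y) :=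
      (hρs.differentiable (by simp) _).hasFDerivAt
    have := hd.comp y ((hasFDerivAt_id y).const_sub x)
    have h2 : fderiv ℝ (fun y => ρ (x - y)) y = _ := this.fderiv
    rw [pderiv, h2]
    simp [pderiv]
  have ht := h.2.2 _ hφ hc (hsupp.trans hx)
  rw [pderiv_mollify hu, mollify_apply]
  simp only [hpd] at ht
  rw [← integral_indicator hΩ, ← integral_indicator hΩ] at ht
  have e1 : ∀ y, Ω.indicator (fun y => u y * -pderiv i ρ (x - y)) y =
      -(pderiv i ρ (x - y) * Ω.indicator u y) := fun y => by
    by_cases hy : y ∈ Ω <;> simp [hy, mul_comm]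
  have e2 : ∀ y, Ω.indicator (fun y => v y * ρ (x - y)) y = ρ (x - y) * Ω.indicator v y :=
    fun y => by by_cases hy : y ∈ Ω <;> simp [hy, mul_comm]
  simp only [e1, e2, integral_neg] at ht
  exact neg_injective ht

/-- A continuous function with a bounded weak derivative is absolutely continuous along almost
every line, with the weak derivative as derivative: pass to the limit in the fundamental theorem
of calculus for its mollifications. -/
lemma HasWeakPartial.sliceDeriv {Ω : Set E3} (hΩ : IsOpen Ω) {i : Fin 3} {u v : E3 → ℝ}
    (h : HasWeakPartial Ω i u v) (hu : MemLp u ⊤ (volume.restrict Ω))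
    (hv : MemLp v ⊤ (volume.restrict Ω)) (hc : ContinuousOn u Ω) : SliceDeriv Ω i u v := by
  have hu0 : MemLp (Ω.indicator u) ⊤ volume := (memLp_indicator_iff_restrict hΩ.measurableSet).2 hu
  have hv0 : MemLp (Ω.indicator v) ⊤ volume := (memLp_indicator_iff_restrict hΩ.measurableSet).2 hv
  have hul := hu0.locallyIntegrable le_top
  have hvl := hv0.locallyIntegrable le_top
  obtain ⟨M, hM0, hM⟩ := MemLp.ae_abs_le hv
  have hM' : ∀ᵐ x, |Ω.indicator v x| ≤ M := by
    rw [ae_restrict_iff' hΩ.measurableSet] at hM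
    filter_upwards [hM] with x hx
    by_cases hxΩ : x ∈ Ω
    · simpa [hxΩ] using hx hxΩ
    · simpa [hxΩ] using hM0
  have hut : ∀ x ∈ Ω, Tendsto (fun n => mollify n (Ω.indicator u) x) atTop (𝓝 (u x)) := by
    intro x hx
    have hcx : ContinuousAt (Ω.indicator u) x :=
      ((hc x hx).continuousAt (hΩ.mem_nhds hx)).congr
        (by filter_upwards [hΩ.mem_nhds hx] with z hz; simp [hz])
    simpa [hx] using tendsto_mollify_of_continuousAt hu0.1 hcx
  filter_upwards [ae_ae_sl i (ae_tendsto_mollify hvl), ae_ae_sl i hM'] with y hy hyM p q hpq hseg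
  -- the fundamental theorem of calculus for `u` and `v` on the subsegments
  have hint : ∀ r s, r ≤ s → Set.Icc r s ⊆ Set.Icc p q →
      IntervalIntegrable (fun t => v (sl i y t)) volume r s ∧
      u (sl i y s) - u (sl i y r) = ∫ t in r..s, v (sl i y t) := by
    intro r s hrs hsub
    have hseg' : ∀ t ∈ Set.Icc r s, sl i y t ∈ Ω := fun t ht => hseg t (hsub ht)
    have hcpt : IsCompact (sl i y '' Set.Icc r s) := isCompact_Icc.image (continuous_sl i y)
    obtain ⟨δ, hδ, hδΩ⟩ := hcpt.exists_cthickening_subset_open hΩ (by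
      rintro _ ⟨t, ht, rfl⟩; exact hseg' t ht)
    have hioc : ∀ t ∈ Set.uIoc r s, sl i y t ∈ Ω := fun t ht => by
      rw [Set.uIoc_of_le hrs] at ht
      exact hseg' t ⟨ht.1.le, ht.2⟩
    have htend : ∀ᵐ t, t ∈ Set.uIoc r s → Tendsto (fun n => mollify n (Ω.indicator v) (sl i y t))
        atTop (𝓝 (v (sl i y t))) := by
      filter_upwards [hy] with t ht hm
      simpa [hioc t hm] using ht
    have hmeas : ∀ n, Continuous (fun t => mollify n (Ω.indicator v) (sl i y t)) :=
      fun n => (contDiff_mollify hvl n).continuous.comp (continuous_sl i y)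
    have hlim := intervalIntegral.tendsto_integral_filter_of_dominated_convergence (fun _ => M)
      (Eventually.of_forall fun n => (hmeas n).aestronglyMeasurable)
      (Eventually.of_forall fun n => Eventually.of_forall fun t _ =>
        abs_mollify_le hM' n (sl i y t)) intervalIntegrable_const htend
    have hlim2 := (hut _ (hseg' s ⟨hrs, le_rfl⟩)).sub (hut _ (hseg' r ⟨le_rfl, hrs⟩))
    refine ⟨?_, ?_⟩
    · have hms : AEStronglyMeasurable (fun t => v (sl i y t)) (volume.restrict (Set.uIoc r s)) :=
        aestronglyMeasurable_of_tendsto_ae atTop (fun n => (hmeas n).aestronglyMeasurable)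
          ((ae_restrict_iff' measurableSet_uIoc).2 htend)
      refine (intervalIntegrable_const (c := M)).mono_fun' hms
        ((ae_restrict_iff' measurableSet_uIoc).2 ?_)
      filter_upwards [hyM] with t ht hm
      simpa [hioc t hm] using ht
    · refine tendsto_nhds_unique_of_eventuallyEq hlim2 hlim ?_
      filter_upwards [tendsto_mollifier_rOut.eventually (gt_mem_nhds hδ)] with n hn
      refine (intervalIntegral.integral_eq_sub_of_hasDerivAt
        (f := fun t => mollify n (Ω.indicator u) (sl i y t)) (fun t ht => ?_)
        ((hmeas n).intervalIntegrable _ _)).symm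
      rw [Set.uIcc_of_le hrs] at ht
      have hball : Metric.closedBall (sl i y t) (mollifier n).rOut ⊆ Ω := fun z hz => hδΩ
        (Metric.mem_cthickening_of_dist_le z (sl i y t) δ _ ⟨t, ht, rfl⟩
          ((Metric.mem_closedBall.1 hz).trans hn.le))
      rw [← pderiv_mollify_indicator hΩ.measurableSet h hul hball]
      exact hasDerivAt_comp_sl i y ((contDiff_mollify hul n).differentiable (by simp) _)
  refine ⟨LipschitzOnWith.absolutelyContinuousOnInterval (K := ⟨M, hM0⟩) ?_, ?_⟩
  · rw [Set.uIcc_of_le hpq]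
    have hlip : ∀ r ∈ Set.Icc p q, ∀ s ∈ Set.Icc p q, r ≤ s →
        dist (u (sl i y s)) (u (sl i y r)) ≤ M * dist s r := by
      intro r hr s hs hrs
      have hsub : Set.Icc r s ⊆ Set.Icc p q := Set.Icc_subset_Icc hr.1 hs.2
      rw [Real.dist_eq, (hint r s hrs hsub).2, Real.dist_eq, ← Real.norm_eq_abs]
      refine intervalIntegral.norm_integral_le_of_norm_le_const_ae ?_
      filter_upwards [hyM] with t ht hm
      rw [Set.uIoc_of_le hrs] at hm
      simpa [hseg t (hsub ⟨hm.1.le, hm.2⟩)] using ht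
    refine LipschitzOnWith.of_dist_le_mul fun r hr s hs => ?_
    rcases le_total r s with hrs | hrs
    · rw [dist_comm, dist_comm r s]; exact hlip r hr s hs hrs
    · exact hlip s hs r hr hrs
  · have hder := (hint p q hpq subset_rfl).1.ae_hasDerivAt_integral
    filter_upwards [hder, (measure_eq_zero_iff_ae_notMem.1 (measure_singleton p)),
      (measure_eq_zero_iff_ae_notMem.1 (measure_singleton q))] with t ht htp htq hm
    have h1 := ht (by rwa [Set.uIcc_of_le hpq]) p (by simp)
    have hnhds : Set.Icc p q ∈ 𝓝 t :=
      Icc_mem_nhds (lt_of_le_of_ne hm.1 fun h => htp h.symm) (lt_of_le_of_ne hm.2 htq)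
    refine (h1.const_add (u (sl i y p))).congr_of_eventuallyEq ?_
    filter_upwards [hnhds] with s hs
    have := (hint p s hs.1 (Set.Icc_subset_Icc le_rfl hs.2)).2
    linarith

/-! ### Slicing the surface measure -/

/-- The projection along the `i`-th axis. -/
def proj (i : Fin 3) (x : E3) : Fin 2 → ℝ := fun j => x (i.succAbove j)

lemma proj_sl (i : Fin 3) (y : Fin 2 → ℝ) (t : ℝ) : proj i (sl i y t) = y :=
  funext fun j => sl_apply_succAbove i y t j

lemma lipschitzWith_toLp_proj (i : Fin 3) :
    LipschitzWith 1 (fun x : E3 => (WithLp.toLp 2 (proj i x) : EuclideanSpace ℝ (Fin 2))) := by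
  refine LipschitzWith.of_dist_le_mul fun x y => ?_
  rw [NNReal.coe_one, one_mul, EuclideanSpace.dist_eq, EuclideanSpace.dist_eq]
  refine Real.sqrt_le_sqrt ?_
  rw [Fin.sum_univ_succAbove (fun j => dist (x j) (y j) ^ 2) i]
  simp [proj]

/-- Orthogonal projections onto coordinate planes do not increase area. -/
lemma volume_image_proj_le (i : Fin 3) (s : Set E3) :
    volume (proj i '' s) ≤ (μHE[2] : Measure E3) s := by
  set P := fun x : E3 => (WithLp.toLp 2 (proj i x) : EuclideanSpace ℝ (Fin 2)) with hP
  have h1 : (μHE[2] : Measure (EuclideanSpace ℝ (Fin 2))) (P '' s) ≤ (μHE[2] : Measure E3) s := by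
    have := (lipschitzWith_toLp_proj i).hausdorffMeasure_image_le (d := ((2 : ℕ) : ℝ))
      (by norm_num) s
    rw [ENNReal.coe_one, ENNReal.one_rpow, one_mul] at this
    rw [Measure.euclideanHausdorffMeasure_def, Measure.euclideanHausdorffMeasure_def,
      Measure.smul_apply, Measure.smul_apply]
    rw [ENNReal.smul_def, ENNReal.smul_def, smul_eq_mul, smul_eq_mul]
    exact mul_le_mul' le_rfl this
  rw [EuclideanSpace.euclideanHausdorffMeasure_eq_volume] at h1
  refine le_trans (le_of_eq ?_) h1
  rw [← (EuclideanSpace.volume_preserving_symm_measurableEquiv_toLp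
    (Fin 2)).symm.measure_preimage_equiv]
  congr 1
  ext z
  simp only [hP, Set.mem_image, Set.mem_preimage]
  constructor
  · rintro ⟨x, hx, rfl⟩
    exact ⟨x, hx, rfl⟩
  · rintro ⟨x, hx, hxz⟩
    exact ⟨x, hx, WithLp.toLp_injective 2 hxz⟩

lemma measurable_coord (i : Fin 3) : Measurable (fun x : E3 => x i) :=
  (EuclideanSpace.proj (𝕜 := ℝ) i).continuous.measurable

/-- Counting the points of a measurable set on the lines parallel to an axis: cut the set into
slabs orthogonal to the axis, so thin that each of finitely many given points on a line lies in a
slab of its own, and project each slab. -/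
lemma exists_measurable_majorant_indicator (i : Fin 3) {E : Set E3} (hE : MeasurableSet E) :
    ∃ G : (Fin 2 → ℝ) → ℝ≥0∞, Measurable G ∧
      (∀ y, ∀ T : Finset ℝ, (∀ t ∈ T, sl i y t ∈ E) → (T.card : ℝ≥0∞) ≤ G y) ∧
      ∫⁻ y, G y ≤ (μHE[2] : Measure E3) E := by
  set Q : ℕ → ℤ → Set E3 := fun m j => {x | ⌊(m : ℝ) * x i⌋ = j} with hQ
  have hQm : ∀ m j, MeasurableSet (Q m j) := fun m j =>
    (Int.measurable_floor.comp ((measurable_coord i).const_mul (m : ℝ))) (measurableSet_singleton j)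
  set H : ℕ → ℤ → Set (Fin 2 → ℝ) := fun m j => toMeasurable volume (proj i '' (E ∩ Q m j)) with hH
  set g : ℕ → (Fin 2 → ℝ) → ℝ≥0∞ := fun m y => ∑' j, (H m j).indicator 1 y with hg
  have hgm : ∀ m, Measurable (g m) := fun m => Measurable.tsum fun j =>
    measurable_one.indicator (measurableSet_toMeasurable _ _)
  refine ⟨fun y => liminf (fun m => g m y) atTop, Measurable.liminf hgm, ?_, ?_⟩
  · intro y T hT
    refine le_liminf_of_le (by isBoundedDefault) ?_
    have hinj : ∀ᶠ m : ℕ in atTop, Set.InjOn (fun t : ℝ => ⌊(m : ℝ) * t⌋) T := by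
      have hp : ∀ p ∈ T ×ˢ T, ∀ᶠ m : ℕ in atTop,
          ⌊(m : ℝ) * p.1⌋ = ⌊(m : ℝ) * p.2⌋ → p.1 = p.2 := by
        intro p _
        by_cases hne : p.1 = p.2
        · exact Eventually.of_forall fun _ _ => hne
        · have hpos : 0 < |p.1 - p.2| := abs_pos.2 (sub_ne_zero.2 hne)
          filter_upwards [(tendsto_natCast_atTop_atTop (R := ℝ)).eventually
            (eventually_gt_atTop (1 / |p.1 - p.2|))] with m hm heq
          have h1 := Int.abs_sub_lt_one_of_floor_eq_floor heq
          rw [← mul_sub, abs_mul, abs_of_nonneg (Nat.cast_nonneg m)] at h1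
          rw [div_lt_iff₀ hpos] at hm
          linarith
      have hall := (eventually_all_finset (T ×ˢ T)).2 hp
      filter_upwards [hall] with m hm t ht s hs hts
      exact hm (t, s) (Finset.mem_product.2 ⟨ht, hs⟩) hts
    filter_upwards [hinj] with m hm
    rw [← Finset.card_image_of_injOn hm]
    refine le_trans (le_of_eq ?_) (ENNReal.sum_le_tsum (T.image fun t : ℝ => ⌊(m : ℝ) * t⌋))
    rw [Finset.card_eq_sum_ones, Nat.cast_sum]
    refine Finset.sum_congr rfl fun j hj => ?_
    obtain ⟨t, ht, rfl⟩ := Finset.mem_image.1 hj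
    have : y ∈ H m ⌊(m : ℝ) * t⌋ := subset_toMeasurable _ _
      ⟨sl i y t, ⟨hT t ht, by simp [hQ, sl_apply_same]⟩, proj_sl i y t⟩
    simp [this]
  · refine (lintegral_liminf_le hgm).trans ?_
    have : ∀ m, ∫⁻ y, g m y ≤ (μHE[2] : Measure E3) E := by
      intro m
      rw [lintegral_tsum fun j => (measurable_one.indicator
        (measurableSet_toMeasurable _ _)).aemeasurable]
      have hU : E = ⋃ j, E ∩ Q m j := by
        ext x; simp [hQ]
      calc ∑' j, ∫⁻ y, (H m j).indicator 1 y
          ≤ ∑' j, (μHE[2] : Measure E3) (E ∩ Q m j) := by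
            refine ENNReal.tsum_le_tsum fun j => ?_
            rw [lintegral_indicator_one (measurableSet_toMeasurable _ _), measure_toMeasurable]
            exact volume_image_proj_le i _
        _ = (μHE[2] : Measure E3) E := by
            conv_rhs => rw [hU]
            rw [measure_iUnion ?_ fun j => hE.inter (hQm m j)]
            intro j k hjk
            refine Set.disjoint_left.2 fun x hx hx' => hjk ?_
            exact hx.2.symm.trans hx'.2
    exact (liminf_le_liminf (Eventually.of_forall this)).trans (by simp)

/-- The integral over the lines parallel to an axis of the sum of `h` over the points of `S` on
the line is at most the integral of `h` over `S` for the surface measure. Finite sums and a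
measurable majorant take the place of the sum, whose measurability is not needed. -/
lemma exists_measurable_majorant (i : Fin 3) {S : Set E3} (hS : MeasurableSet S)
    {h : E3 → ℝ≥0∞} (hh : Measurable h) :
    ∃ G : (Fin 2 → ℝ) → ℝ≥0∞, Measurable G ∧
      (∀ y, ∀ T : Finset ℝ, (∀ t ∈ T, sl i y t ∈ S) → ∑ t ∈ T, h (sl i y t) ≤ G y) ∧
      ∫⁻ y, G y ≤ ∫⁻ x in S, h x ∂μHE[2] := by
  refine Measurable.ennreal_induction (motive := fun h => ∃ G : (Fin 2 → ℝ) → ℝ≥0∞, Measurable G ∧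
      (∀ y, ∀ T : Finset ℝ, (∀ t ∈ T, sl i y t ∈ S) → ∑ t ∈ T, h (sl i y t) ≤ G y) ∧
      ∫⁻ y, G y ≤ ∫⁻ x in S, h x ∂μHE[2]) (fun c s hs => ?_) (fun f g _ hf _ hfG hgG => ?_)
    (fun f hf hmono hfG => ?_) hh
  · obtain ⟨G, hGm, hG, hGi⟩ := exists_measurable_majorant_indicator i (hs.inter hS)
    refine ⟨fun y => c * G y, hGm.const_mul c, fun y T hT => ?_, ?_⟩
    · classical
      have h1 : ∑ t ∈ T, s.indicator (fun _ => c) (sl i y t) =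
          c * ((T.filter fun t => sl i y t ∈ s).card : ℝ≥0∞) := by
        rw [Finset.card_filter, Nat.cast_sum, Finset.mul_sum]
        refine Finset.sum_congr rfl fun t _ => ?_
        by_cases ht : sl i y t ∈ s <;> simp [ht]
      rw [h1]
      refine mul_le_mul' le_rfl (hG y _ fun t ht => ?_)
      rw [Finset.mem_filter] at ht
      exact ⟨ht.2, hT t ht.1⟩
    · rw [lintegral_const_mul c hGm, lintegral_indicator_const hs, Measure.restrict_apply hs]
      exact mul_le_mul' le_rfl hGi
  · obtain ⟨G, hGm, hG, hGi⟩ := hfG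
    obtain ⟨G', hGm', hG', hGi'⟩ := hgG
    refine ⟨fun y => G y + G' y, hGm.add hGm', fun y T hT => ?_, ?_⟩
    · simp only [Pi.add_apply, Finset.sum_add_distrib]
      exact add_le_add (hG y T hT) (hG' y T hT)
    · simp only [Pi.add_apply]
      rw [lintegral_add_left hGm, lintegral_add_left hf]
      exact add_le_add hGi hGi'
  · choose G hGm hG hGi using hfG
    refine ⟨fun y => liminf (fun n => G n y) atTop, Measurable.liminf hGm, fun y T hT => ?_, ?_⟩
    · have hlim : Tendsto (fun n => ∑ t ∈ T, f n (sl i y t)) atTop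
          (𝓝 (∑ t ∈ T, ⨆ n, f n (sl i y t))) :=
        tendsto_finsetSum _ fun t _ => tendsto_atTop_iSup fun m n hmn => hmono hmn _
      rw [← hlim.liminf_eq]
      exact liminf_le_liminf (Eventually.of_forall fun n => hG n y T hT)
    · refine (lintegral_liminf_le hGm).trans ?_
      refine (liminf_le_liminf (Eventually.of_forall fun n => (hGi n).trans
        (lintegral_mono fun x => le_iSup (fun n => f n x) n))).trans ?_
      simp

/-- A null set for the surface measure is missed by almost every line parallel to an axis. -/
lemma ae_forall_sl_of_ae_hausdorff (i : Fin 3) {S : Set E3} (hS : MeasurableSet S)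
    {p : E3 → Prop} (h : ∀ᵐ x ∂(μHE[2] : Measure E3).restrict S, p x) :
    ∀ᵐ y, ∀ t, sl i y t ∈ S → p (sl i y t) := by
  rw [ae_restrict_iff' hS] at h
  have h0 : volume (proj i '' {x | ¬ (x ∈ S → p x)}) = 0 :=
    le_antisymm ((volume_image_proj_le i _).trans (le_of_eq h)) zero_le
  filter_upwards [measure_eq_zero_iff_ae_notMem.1 h0] with y hy t ht
  by_contra hp
  exact hy ⟨sl i y t, fun hh => hp (hh ht), proj_sl i y t⟩

/-! ### Open subsets of the line -/

lemma exists_eq_Ioo_of_connectedComponentIn {U : Set ℝ} (hU : IsOpen U)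
    (hb : Bornology.IsBounded U) {x : ℝ} (hx : x ∈ U) :
    ∃ a b, a < b ∧ connectedComponentIn U x = Set.Ioo a b ∧ a ∈ frontier U ∧ b ∈ frontier U := by
  set s := connectedComponentIn U x with hs
  have hsU : s ⊆ U := connectedComponentIn_subset U x
  have hxs : x ∈ s := mem_connectedComponentIn hx
  have hso : IsOpen s := hU.connectedComponentIn
  have hsb : Bornology.IsBounded s := hb.subset hsU
  have hoc : s.OrdConnected := isPreconnected_connectedComponentIn.ordConnected
  have heq : s = Set.Ioo (sInf s) (sSup s) := by
    refine Set.Subset.antisymm ?_ fun z hz => ?_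
    · rw [← interior_Icc]
      exact hso.subset_interior_iff.2 (subset_Icc_csInf_csSup hsb.bddBelow hsb.bddAbove)
    · obtain ⟨p, hp, hpz⟩ := exists_lt_of_csInf_lt ⟨x, hxs⟩ hz.1
      obtain ⟨q, hq, hzq⟩ := exists_lt_of_lt_csSup ⟨x, hxs⟩ hz.2
      exact hoc.out hp hq ⟨hpz.le, hzq.le⟩
  set a := sInf s
  set b := sSup s
  have hxab : x ∈ Set.Ioo a b := heq ▸ hxs
  have hab : a < b := hxab.1.trans hxab.2
  have hcl : Set.Icc a b ⊆ closure U := by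
    rw [← closure_Ioo hab.ne, ← heq]; exact closure_mono hsU
  refine ⟨a, b, hab, heq, ?_, ?_⟩
  · rw [hU.frontier_eq]
    refine ⟨hcl ⟨le_rfl, hab.le⟩, fun haU => ?_⟩
    have hsub : Set.Ico a b ⊆ U := fun z hz => by
      rcases hz.1.eq_or_lt with h | h
      · exact h ▸ haU
      · exact hsU (heq ▸ ⟨h, hz.2⟩)
    have := isPreconnected_Ico.subset_connectedComponentIn ⟨hxab.1.le, hxab.2⟩ hsub
      ⟨le_rfl, hab⟩
    rw [← hs, heq] at this
    exact lt_irrefl _ this.1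
  · rw [hU.frontier_eq]
    refine ⟨hcl ⟨hab.le, le_rfl⟩, fun hbU => ?_⟩
    have hsub : Set.Ioc a b ⊆ U := fun z hz => by
      rcases hz.2.eq_or_lt with h | h
      · exact h ▸ hbU
      · exact hsU (heq ▸ ⟨hz.1, h⟩)
    have := isPreconnected_Ioc.subset_connectedComponentIn ⟨hxab.1, hxab.2.le⟩ hsub
      ⟨hab, le_rfl⟩
    rw [← hs, heq] at this
    exact lt_irrefl _ this.2

/-- If the integral of `K` over each component `(a, b)` of a bounded open set is at most
`h a + h b`, the integral over the whole set is at most twice the sum of `h` over the frontier. -/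
lemma enorm_setIntegral_le_of_components {U : Set ℝ} (hU : IsOpen U) (hb : Bornology.IsBounded U)
    {K : ℝ → ℝ} (hK : IntegrableOn K U) {h : ℝ → ℝ≥0∞} {G : ℝ≥0∞}
    (hG : ∀ T : Finset ℝ, (∀ t ∈ T, t ∈ frontier U) → ∑ t ∈ T, h t ≤ G)
    (hKh : ∀ a b, a < b → Set.Ioo a b ⊆ U → a ∈ frontier U → b ∈ frontier U →
      ‖∫ t in Set.Ioo a b, K t‖ₑ ≤ h a + h b) :
    ‖∫ t in U, K t‖ₑ ≤ G + G := by
  classical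
  set I : Set (Set ℝ) := {s | ∃ x ∈ U, s = connectedComponentIn U x} with hI
  have hdisj : I.PairwiseDisjoint id := by
    rintro _ ⟨x, hx, rfl⟩ _ ⟨z, hz, rfl⟩ hne
    refine Set.disjoint_left.2 fun w hw hw' => hne ?_
    exact (connectedComponentIn_eq hw).trans (connectedComponentIn_eq hw').symm
  have hopen : ∀ s ∈ I, IsOpen s := by
    rintro _ ⟨x, hx, rfl⟩
    exact hU.connectedComponentIn
  have hcount : I.Countable := hdisj.countable_of_isOpen hopen (by
    rintro _ ⟨x, hx, rfl⟩
    exact ⟨x, mem_connectedComponentIn hx⟩)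
  have := hcount.to_subtype
  have hUn : U = ⋃ s : I, (s : Set ℝ) := by
    ext x
    simp only [Set.mem_iUnion, Subtype.exists, exists_prop]
    constructor
    · intro hx
      exact ⟨_, ⟨x, hx, rfl⟩, mem_connectedComponentIn hx⟩
    · rintro ⟨_, ⟨z, hz, rfl⟩, hx⟩
      exact connectedComponentIn_subset U z hx
  have hsum : HasSum (fun s : I => ∫ t in (s : Set ℝ), K t) (∫ t in U, K t) := by
    have := hasSum_integral_iUnion (μ := volume) (f := K) (s := fun s : I => (s : Set ℝ))
      (fun s => (hopen s s.2).measurableSet)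
      (fun s s' hne => hdisj s.2 s'.2 fun h => hne (Subtype.ext h)) (hUn ▸ hK)
    rwa [← hUn] at this
  have hend : ∀ s : I, ∃ p : ℝ × ℝ, p.1 < p.2 ∧ (s : Set ℝ) = Set.Ioo p.1 p.2 ∧
      p.1 ∈ frontier U ∧ p.2 ∈ frontier U := by
    rintro ⟨_, x, hx, rfl⟩
    obtain ⟨a, b, h⟩ := exists_eq_Ioo_of_connectedComponentIn hU hb hx
    exact ⟨(a, b), h⟩
  choose p hp1 hp2 hp3 hp4 using hend
  have hinj1 : Function.Injective fun s => (p s).1 := by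
    intro s s' hss
    by_contra hne
    have hd := hdisj s.2 s'.2 fun h => hne (Subtype.ext h)
    simp only [Function.onFun, id, hp2] at hd
    rw [Set.Ioo_disjoint_Ioo] at hd
    simp only at hss
    rw [hss, max_self] at hd
    exact absurd hd (not_le.2 (lt_min (hss ▸ hp1 s) (hp1 s')))
  have hinj2 : Function.Injective fun s => (p s).2 := by
    intro s s' hss
    by_contra hne
    have hd := hdisj s.2 s'.2 fun h => hne (Subtype.ext h)
    simp only [Function.onFun, id, hp2] at hd
    rw [Set.Ioo_disjoint_Ioo] at hd
    simp only at hss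
    rw [hss, min_self] at hd
    exact absurd hd (not_le.2 (max_lt (hss ▸ hp1 s) (hp1 s')))
  refine le_of_tendsto hsum.enorm (Eventually.of_forall fun F => ?_)
  calc ‖∑ s ∈ F, ∫ t in (s : Set ℝ), K t‖ₑ
      ≤ ∑ s ∈ F, ‖∫ t in (s : Set ℝ), K t‖ₑ := enorm_sum_le _ _
    _ ≤ ∑ s ∈ F, (h (p s).1 + h (p s).2) := by
        refine Finset.sum_le_sum fun s _ => ?_
        have hsub : Set.Ioo (p s).1 (p s).2 ⊆ U := by
          rw [← hp2 s, hUn]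
          exact Set.subset_iUnion (fun s : I => (s : Set ℝ)) s
        have := hKh _ _ (hp1 s) hsub (hp3 s) (hp4 s)
        rwa [← hp2 s] at this
    _ = ∑ t ∈ F.image fun s => (p s).1, h t + ∑ t ∈ F.image fun s => (p s).2, h t := by
        rw [Finset.sum_add_distrib, Finset.sum_image fun s _ s' _ hss => hinj1 hss,
          Finset.sum_image fun s _ s' _ hss => hinj2 hss]
    _ ≤ G + G := by
        refine add_le_add (hG _ fun t ht => ?_) (hG _ fun t ht => ?_)
        · obtain ⟨s, _, rfl⟩ := Finset.mem_image.1 ht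
          exact hp3 s
        · obtain ⟨s, _, rfl⟩ := Finset.mem_image.1 ht
          exact hp4 s

/-! ### Gauss inequality for traces on the boundary of an arbitrary open set -/

lemma StrongApprox.mono {Ω O : Set E3} {F : ℕ → E3 → ℝ} {f : E3 → ℝ} {Df : Fin 3 → E3 → ℝ}
    (h : StrongApprox Ω F f Df) (hO : O ⊆ Ω) : StrongApprox O F f Df := by
  have hm : volume.restrict O ≤ volume.restrict Ω := Measure.restrict_mono_set _ hO
  exact ⟨h.contDiff, h.memLp.mono_measure hm, fun i => (h.memLp_grad i).mono_measure hm,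
    tendsto_of_tendsto_of_tendsto_of_le_of_le tendsto_const_nhds h.tendsto (fun _ => zero_le)
      fun n => eLpNorm_mono_measure _ hm,
    fun i => tendsto_of_tendsto_of_tendsto_of_le_of_le tendsto_const_nhds (h.tendsto_grad i)
      (fun _ => zero_le) fun n => eLpNorm_mono_measure _ hm⟩

/-- The fundamental theorem of calculus for `u ^ 2 * w` on an interval, where `w` is absolutely
continuous on the compact subintervals of the open interval only. -/
lemma setIntegral_Ioo_eq_sub {a b : ℝ} (hab : a < b) {u u' w z : ℝ → ℝ} {M : ℝ}
    (hu : ∀ t, HasDerivAt u (u' t) t) (hu' : Continuous u') (hw : ContinuousOn w (Set.Icc a b))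
    (hwac : ∀ p q, p ≤ q → Set.Icc p q ⊆ Set.Ioo a b → AbsolutelyContinuousOnInterval w p q ∧
      ∀ᵐ t, t ∈ Set.Icc p q → HasDerivAt w (z t) t)
    (hzm : AEStronglyMeasurable z (volume.restrict (Set.Ioo a b)))
    (hzM : ∀ᵐ t, t ∈ Set.Ioo a b → |z t| ≤ M) :
    IntegrableOn (fun t => 2 * (u t * u' t) * w t + u t ^ 2 * z t) (Set.Ioo a b) ∧
    ∫ t in Set.Ioo a b, (2 * (u t * u' t) * w t + u t ^ 2 * z t) =
      u b ^ 2 * w b - u a ^ 2 * w a := by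
  have huc : Continuous u := continuous_iff_continuousAt.2 fun t => (hu t).continuousAt
  have hI1 : IntegrableOn (fun t => 2 * (u t * u' t) * w t) (Set.Ioo a b) :=
    (ContinuousOn.integrableOn_Icc (by fun_prop)).mono_set Set.Ioo_subset_Icc_self
  have hz : IntegrableOn z (Set.Ioo a b) :=
    Integrable.of_bound hzm M ((ae_restrict_iff' measurableSet_Ioo).2 hzM)
  have hI2 : IntegrableOn (fun t => u t ^ 2 * z t) (Set.Ioo a b) := by
    rw [← integrableOn_Icc_iff_integrableOn_Ioo] at hz ⊢
    exact hz.continuousOn_mul (huc.pow 2).continuousOn isCompact_Icc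
  have hI := hI1.add hI2
  refine ⟨hI, ?_⟩
  set K := fun t => 2 * (u t * u' t) * w t + u t ^ 2 * z t with hK
  have hKi : IntervalIntegrable K volume a b := by
    rw [intervalIntegrable_iff_integrableOn_Ioo_of_le hab.le]
    exact hI
  have hseg : ∀ p q, p ≤ q → Set.Icc p q ⊆ Set.Ioo a b →
      ∫ t in p..q, K t = u q ^ 2 * w q - u p ^ 2 * w p := by
    intro p q hpq hsub
    obtain ⟨hac, hder⟩ := hwac p q hpq hsub
    have hu2 : ContDiff ℝ 1 (fun t => u t ^ 2) := by
      refine ContDiff.pow ?_ 2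
      rw [contDiff_one_iff_deriv]
      refine ⟨fun t => (hu t).differentiableAt, ?_⟩
      rwa [show deriv u = u' from funext fun t => (hu t).deriv]
    have hG := hu2.contDiffOn.absolutelyContinuousOnInterval.mul hac
    have hGd := hG.integral_deriv_eq_sub
    simp only [Pi.mul_apply] at hGd
    rw [← hGd]
    refine intervalIntegral.integral_congr_ae ?_
    filter_upwards [hder] with t ht hm
    rw [Set.uIoc_of_le hpq] at hm
    have h1 := (((hu t).pow 2).mul (ht ⟨hm.1.le, hm.2⟩)).deriv
    refine Eq.trans ?_ h1.symm
    simp only [hK, Pi.pow_apply]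
    push_cast
    ring
  set m := (a + b) / 2 with hm
  have hma : a < m := by rw [hm]; linarith
  have hmb : m < b := by rw [hm]; linarith
  have heq : Set.EqOn (fun t => ∫ s in m..t, K s) (fun t => u t ^ 2 * w t - u m ^ 2 * w m)
      (Set.Ioo a b) := by
    intro t ht
    rcases le_total m t with h | h
    · exact hseg m t h fun s hs => ⟨hma.trans_le hs.1, hs.2.trans_lt ht.2⟩
    · have := hseg t m h fun s hs => ⟨ht.1.trans_le hs.1, hs.2.trans_lt hmb⟩
      simp only
      rw [intervalIntegral.integral_symm, this]
      ring
  have hcl : Set.EqOn (fun t => ∫ s in m..t, K s) (fun t => u t ^ 2 * w t - u m ^ 2 * w m)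
      (Set.Icc a b) := by
    refine heq.of_subset_closure ?_ ?_ Set.Ioo_subset_Icc_self (closure_Ioo hab.ne).ge
    · rw [← Set.uIcc_of_le hab.le]
      exact intervalIntegral.continuousOn_primitive_interval' hKi
        (by rw [Set.uIcc_of_le hab.le]; exact ⟨hma.le, hmb.le⟩)
    · exact ((huc.pow 2).continuousOn.mul hw).sub continuousOn_const
  have ea : (∫ s in m..a, K s) = u a ^ 2 * w a - u m ^ 2 * w m := hcl ⟨le_rfl, hab.le⟩
  have eb : (∫ s in m..b, K s) = u b ^ 2 * w b - u m ^ 2 * w m := hcl ⟨hab.le, le_rfl⟩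
  have hKm : IntervalIntegrable K volume a m :=
    hKi.mono_set (by rw [Set.uIcc_of_le hab.le, Set.uIcc_of_le hma.le]
                     exact Set.Icc_subset_Icc le_rfl hmb.le)
  have hKm' : IntervalIntegrable K volume m b :=
    hKi.mono_set (by rw [Set.uIcc_of_le hab.le, Set.uIcc_of_le hmb.le]
                     exact Set.Icc_subset_Icc hma.le le_rfl)
  rw [← integral_Ioc_eq_integral_Ioo, ← intervalIntegral.integral_of_le hab.le,
    ← intervalIntegral.integral_add_adjacent_intervals hKm hKm', intervalIntegral.integral_symm,
    ea, eb]
  ring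

/-- The integrals over the lines parallel to an axis of a sequence that tends to zero in `L¹`
have lower limit zero on almost every line. -/
lemma ae_liminf_lintegral_sl_eq_zero {O : Set E3} (hO : MeasurableSet O) (i : Fin 3)
    {k : ℕ → E3 → ℝ≥0∞} (hk : ∀ n, AEMeasurable (k n) (volume.restrict O))
    (hlim : Tendsto (fun n => ∫⁻ x in O, k n x) atTop (𝓝 0)) :
    ∀ᵐ y, liminf (fun n => ∫⁻ t in sl i y ⁻¹' O, k n (sl i y t)) atTop = 0 := by
  have hmp := measurePreserving_sliceEquiv i
  have hmeas : ∀ n, AEMeasurable (fun p : (Fin 2 → ℝ) × ℝ => O.indicator (k n) (sliceEquiv i p))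
      (volume : Measure ((Fin 2 → ℝ) × ℝ)) := fun n =>
    ((aemeasurable_indicator_iff hO).2 (hk n)).comp_quasiMeasurePreserving
      hmp.quasiMeasurePreserving
  have hint : ∀ n y, ∫⁻ t, O.indicator (k n) (sliceEquiv i (y, t)) =
      ∫⁻ t in sl i y ⁻¹' O, k n (sl i y t) := by
    intro n y
    rw [← lintegral_indicator ((continuous_sl i y).measurable hO)]
    rfl
  have hfub : ∀ n, ∫⁻ y, ∫⁻ t in sl i y ⁻¹' O, k n (sl i y t) = ∫⁻ x in O, k n x := by
    intro n
    rw [← lintegral_indicator hO, hmp.lintegral_map_equiv, Measure.volume_eq_prod,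
      lintegral_prod _ (hmeas n)]
    simp only [hint]
  have hm : ∀ n, AEMeasurable (fun y => ∫⁻ t in sl i y ⁻¹' O, k n (sl i y t)) := by
    intro n
    have := (hmeas n).lintegral_prod_right'
    simpa only [hint] using this
  have h0 : ∫⁻ y, liminf (fun n => ∫⁻ t in sl i y ⁻¹' O, k n (sl i y t)) atTop = 0 := by
    refine le_antisymm ((lintegral_liminf_le' hm).trans ?_) zero_le
    simp only [hfub, hlim.liminf_eq, le_refl]
  refine (lintegral_eq_zero_iff' ?_).1 h0
  simp only [liminf_eq_iSup_iInf_of_nat]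
  exact AEMeasurable.iSup fun n => AEMeasurable.biInf _ (Set.to_countable _) fun m _ => hm m

lemma isBounded_preimage_sl {O : Set E3} (hO : Bornology.IsBounded O) (i : Fin 3)
    (y : Fin 2 → ℝ) : Bornology.IsBounded (sl i y ⁻¹' O) := by
  obtain ⟨R, hR⟩ := hO.exists_norm_le
  refine isBounded_iff_forall_norm_le.2 ⟨R, fun t ht => ?_⟩
  have := PiLp.norm_apply_le (sl i y t) i
  rw [sl_apply_same] at this
  exact this.trans (hR _ ht)

/-- Let `f` be an `H¹` function with trace `τ` on the frontier of a bounded open set `O`. Along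
almost every line in direction `i`, the fundamental theorem of calculus on the components of the
slice of `O` bounds the integral of `∂ᵢ (f ^ 2 * w)` by the values of `τ ^ 2 * |w|` at their end
points. No regularity of the frontier is needed. -/
theorem enorm_integral_partial_sq_mul_le {O : Set E3} (hO : IsOpen O)
    (hOb : Bornology.IsBounded O) (i : Fin 3) {F : ℕ → E3 → ℝ} {f : E3 → ℝ}
    {Df : Fin 3 → E3 → ℝ} (hF : StrongApprox O F f Df) {τ : E3 → ℝ}
    (hτ : ∀ᵐ x ∂((μHE[2] : Measure E3).restrict (frontier O)),
      Tendsto (fun n => F n x) atTop (𝓝 (τ x)))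
    {w z W : E3 → ℝ} {M : ℝ} (hw : SliceDeriv O i w z) (hwc : ContinuousOn w (closure O))
    (hwW : ∀ x ∈ closure O, |w x| ≤ W x) (hW : Measurable W)
    (hz : AEStronglyMeasurable z (volume.restrict O)) (hzM : ∀ᵐ x ∂volume.restrict O, |z x| ≤ M) :
    IntegrableOn (fun x => 2 * (f x * Df i x) * w x + f x ^ 2 * z x) O ∧
    ‖∫ x in O, (2 * (f x * Df i x) * w x + f x ^ 2 * z x)‖ₑ ≤
      2 * ∫⁻ x in frontier O, ENNReal.ofReal (τ x ^ 2 * W x) ∂μHE[2] := by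
  have hOm := hO.measurableSet
  have hmp := measurePreserving_sliceEquiv i
  have hcl : IsCompact (closure O) := hOb.isCompact_closure
  obtain ⟨C, hC⟩ := hcl.exists_bound_of_continuousOn hwc
  have hwm : AEStronglyMeasurable w (volume.restrict O) :=
    (hwc.mono subset_closure).aestronglyMeasurable hOm
  have hwC : ∀ᵐ x ∂volume.restrict O, ‖w x‖ ≤ C :=
    (ae_restrict_iff' hOm).2 (Eventually.of_forall fun x hx => hC x (subset_closure hx))
  set K : E3 → ℝ := fun x => 2 * (f x * Df i x) * w x + f x ^ 2 * z x with hK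
  set Kn : ℕ → E3 → ℝ := fun n x =>
    2 * (F n x * pderiv i (F n) x) * w x + F n x ^ 2 * z x with hKn
  have hfm := hF.memLp.1
  have hdm := (hF.memLp_grad i).1
  have hFm : ∀ n, AEStronglyMeasurable (F n) (volume.restrict O) :=
    fun n => (hF.contDiff n).continuous.aestronglyMeasurable
  have hFdm : ∀ n, AEStronglyMeasurable (pderiv i (F n)) (volume.restrict O) :=
    fun n => (continuous_pderiv (hF.contDiff n) i).aestronglyMeasurable
  have hKi : IntegrableOn K O := by
    have h1 : Integrable (fun x => w x * (f x * Df i x)) (volume.restrict O) :=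
      (hF.memLp.integrable_mul (hF.memLp_grad i)).bdd_mul hwm hwC
    have h2 : Integrable (fun x => z x * (f x * f x)) (volume.restrict O) :=
      (hF.memLp.integrable_mul hF.memLp).bdd_mul hz hzM
    refine ((h1.const_mul 2).add h2).congr (Eventually.of_forall fun x => ?_)
    simp only [hK, Pi.add_apply]
    ring
  refine ⟨hKi, ?_⟩
  have hKnm : ∀ n, AEStronglyMeasurable (Kn n) (volume.restrict O) := fun n =>
    ((((hFm n).mul (hFdm n)).const_mul 2).mul hwm).add (((hFm n).pow 2).mul hz)
  -- `Kn n` tends to `K` in `L¹(O)`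
  have hlim : Tendsto (fun n => ∫⁻ x in O, ‖Kn n x - K x‖ₑ) atTop (𝓝 0) := by
    have l1 := tendsto_lintegral_enorm_mul_sub hF.memLp (hF.memLp_grad i) hFm hFdm hF.tendsto
      (hF.tendsto_grad i)
    have l2 := tendsto_lintegral_enorm_mul_sub hF.memLp hF.memLp hFm hFm hF.tendsto hF.tendsto
    have l3 := (ENNReal.Tendsto.const_mul (a := ENNReal.ofReal (2 * C)) l1
      (Or.inr ENNReal.ofReal_ne_top)).add
      (ENNReal.Tendsto.const_mul (a := ENNReal.ofReal M) l2
        (Or.inr ENNReal.ofReal_ne_top))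
    simp only [mul_zero, add_zero] at l3
    refine tendsto_of_tendsto_of_tendsto_of_le_of_le tendsto_const_nhds l3 (fun _ => zero_le)
      fun n => ?_
    have m1 : AEMeasurable (fun x => ‖F n x * pderiv i (F n) x - f x * Df i x‖ₑ)
        (volume.restrict O) := (((hFm n).mul (hFdm n)).sub (hfm.mul hdm)).enorm
    have m2 : AEMeasurable (fun x => ‖F n x * F n x - f x * f x‖ₑ)
        (volume.restrict O) := (((hFm n).mul (hFm n)).sub (hfm.mul hfm)).enorm
    simp only
    rw [← lintegral_const_mul'' _ m1, ← lintegral_const_mul'' _ m2,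
      ← lintegral_add_left' (m1.const_mul _)]
    refine lintegral_mono_ae ?_
    filter_upwards [hwC, hzM] with x hx hx'
    have e : Kn n x - K x = 2 * w x * (F n x * pderiv i (F n) x - f x * Df i x)
        + z x * (F n x * F n x - f x * f x) := by simp only [hKn, hK]; ring
    rw [e]
    refine (enorm_add_le _ _).trans ?_
    rw [enorm_mul (2 * w x), enorm_mul (z x)]
    gcongr
    · rw [Real.enorm_eq_ofReal_abs, abs_mul, abs_two]
      exact ENNReal.ofReal_le_ofReal (by rw [Real.norm_eq_abs] at hx; linarith)
    · rw [Real.enorm_eq_ofReal_abs]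
      exact ENNReal.ofReal_le_ofReal hx'
  have hlimae := ae_liminf_lintegral_sl_eq_zero hOm i (k := fun n x => ‖Kn n x - K x‖ₑ)
    (fun n => ((hKnm n).sub hKi.1).enorm) hlim
  -- a measurable version of the trace
  have hτm : AEMeasurable τ ((μHE[2] : Measure E3).restrict (frontier O)) :=
    aemeasurable_of_tendsto_metrizable_ae atTop
      (fun n => (hF.contDiff n).continuous.measurable.aemeasurable) hτ
  set T := hτm.mk τ with hT
  have hτT : ∀ᵐ x ∂((μHE[2] : Measure E3).restrict (frontier O)),
      Tendsto (fun n => F n x) atTop (𝓝 (T x)) := by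
    filter_upwards [hτ, hτm.ae_eq_mk] with x hx hx'
    rwa [hT, ← hx']
  have hhm : Measurable fun x => ENNReal.ofReal (T x ^ 2 * W x) :=
    ((hτm.measurable_mk.pow_const 2).mul hW).ennreal_ofReal
  obtain ⟨G, hGm, hG, hGi⟩ := exists_measurable_majorant i isClosed_frontier.measurableSet
    (S := frontier O) hhm
  have hGi' : ∫⁻ y, G y ≤ ∫⁻ x in frontier O, ENNReal.ofReal (τ x ^ 2 * W x) ∂μHE[2] := by
    refine hGi.trans (le_of_eq (lintegral_congr_ae ?_))
    filter_upwards [hτm.ae_eq_mk] with x hx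
    simp only [hT, ← hx]
  -- Fubini
  have hKp : Integrable (fun p => O.indicator K (sliceEquiv i p))
      ((volume : Measure (Fin 2 → ℝ)).prod (volume : Measure ℝ)) :=
    (hmp.integrable_comp_emb (sliceEquiv i).measurableEmbedding).2
      ((integrable_indicator_iff hOm).2 hKi)
  have hU : ∀ y, MeasurableSet (sl i y ⁻¹' O) := fun y => (continuous_sl i y).measurable hOm
  have hind : ∀ (g : E3 → ℝ) y, (fun t => O.indicator g (sliceEquiv i (y, t))) =
      (sl i y ⁻¹' O).indicator (fun t => g (sl i y t)) := fun g y => rfl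
  have hfub : ∫ x in O, K x = ∫ y, ∫ t in sl i y ⁻¹' O, K (sl i y t) := by
    rw [← integral_indicator hOm, ← hmp.integral_comp', Measure.volume_eq_prod,
      integral_prod _ hKp]
    refine integral_congr_ae (Eventually.of_forall fun y => ?_)
    simp only
    rw [hind K y, integral_indicator (hU y)]
  have hzp : AEStronglyMeasurable (fun p => O.indicator z (sliceEquiv i p))
      ((volume : Measure (Fin 2 → ℝ)).prod (volume : Measure ℝ)) :=
    ((aestronglyMeasurable_indicator_iff hOm).2 hz).comp_quasiMeasurePreserving
      hmp.quasiMeasurePreserving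
  rw [ae_restrict_iff' hOm] at hzM
  have hline : ∀ᵐ y, ‖∫ t in sl i y ⁻¹' O, K (sl i y t)‖ₑ ≤ G y + G y := by
    filter_upwards [hlimae, hw, ae_forall_sl_of_ae_hausdorff i isClosed_frontier.measurableSet hτT,
      hKp.prod_right_ae, hzp.prodMk_left, ae_ae_sl i hzM] with y hy1 hy2 hy3 hy4 hy5 hy6
    rw [hind K y, integrable_indicator_iff (hU y)] at hy4
    rw [hind z y, aestronglyMeasurable_indicator_iff (hU y)] at hy5
    have hfr : frontier (sl i y ⁻¹' O) ⊆ sl i y ⁻¹' frontier O :=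
      (continuous_sl i y).frontier_preimage_subset O
    refine enorm_setIntegral_le_of_components (hO.preimage (continuous_sl i y))
      (isBounded_preimage_sl hOb i y) hy4 (fun S hS => hG y S fun t ht => hfr (hS t ht)) ?_
    intro a b hab hsub ha hb
    have hsubcl : ∀ t ∈ Set.Icc a b, sl i y t ∈ closure O := by
      intro t ht
      rw [← closure_Ioo hab.ne] at ht
      exact (continuous_sl i y).closure_preimage_subset O (closure_mono hsub ht)
    -- the fundamental theorem of calculus on a component of the slice
    have hftc : ∀ n, IntegrableOn (fun t => Kn n (sl i y t)) (Set.Ioo a b) ∧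
        ∫ t in Set.Ioo a b, Kn n (sl i y t) =
          F n (sl i y b) ^ 2 * w (sl i y b) - F n (sl i y a) ^ 2 * w (sl i y a) := by
      intro n
      refine setIntegral_Ioo_eq_sub (u := fun t => F n (sl i y t)) (M := M)
        (u' := fun t => pderiv i (F n) (sl i y t)) (w := fun t => w (sl i y t))
        (z := fun t => z (sl i y t)) hab
        (fun t => hasDerivAt_comp_sl i y ((hF.contDiff n).differentiable one_ne_zero _))
        ((continuous_pderiv (hF.contDiff n) i).comp (continuous_sl i y))
        (hwc.comp (continuous_sl i y).continuousOn hsubcl)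
        (fun p q hpq hpqs => hy2 p q hpq fun t ht => hsub (hpqs ht))
        (hy5.mono_set hsub) ?_
      filter_upwards [hy6] with t ht hm
      exact ht (hsub hm)
    have hdiff : ∀ n, ‖∫ t in Set.Ioo a b, K (sl i y t)‖ₑ ≤
        ‖F n (sl i y b) ^ 2 * w (sl i y b) - F n (sl i y a) ^ 2 * w (sl i y a)‖ₑ +
          ∫⁻ t in sl i y ⁻¹' O, ‖Kn n (sl i y t) - K (sl i y t)‖ₑ := by
      intro n
      have hK2 : IntegrableOn (fun t => K (sl i y t)) (Set.Ioo a b) := hy4.mono_set hsub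
      have e : ∫ t in Set.Ioo a b, K (sl i y t) = (∫ t in Set.Ioo a b, Kn n (sl i y t))
          - ∫ t in Set.Ioo a b, (Kn n (sl i y t) - K (sl i y t)) := by
        rw [integral_sub (hftc n).1 hK2]; ring
      rw [e, (hftc n).2]
      refine (enorm_sub_le).trans ?_
      gcongr
      exact (enorm_integral_le_lintegral_enorm _).trans (lintegral_mono_set hsub)
    have ta := hy3 a (hfr ha)
    have tb := hy3 b (hfr hb)
    have hV := (((tb.pow 2).mul_const (w (sl i y b))).sub
      ((ta.pow 2).mul_const (w (sl i y a)))).enorm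
    have hle : ‖∫ t in Set.Ioo a b, K (sl i y t)‖ₑ ≤
        ‖T (sl i y b) ^ 2 * w (sl i y b) - T (sl i y a) ^ 2 * w (sl i y a)‖ₑ := by
      refine ENNReal.le_of_forall_pos_le_add fun ε hε hfin => ?_
      have hε2 : (0 : ℝ≥0∞) < (ε : ℝ≥0∞) / 2 := by simp [hε.ne']
      have hfreq := frequently_lt_of_liminf_lt (by isBoundedDefault) (hy1.trans_lt hε2)
      have hev := hV.eventually (gt_mem_nhds (ENNReal.lt_add_right hfin.ne hε2.ne'))
      obtain ⟨n, hn1, hn2⟩ := (hfreq.and_eventually hev).exists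
      refine (hdiff n).trans ((add_le_add hn2.le hn1.le).trans ?_)
      rw [add_assoc, ENNReal.add_halves]
    refine hle.trans ((enorm_sub_le).trans ?_)
    rw [add_comm]
    have hend : ∀ t ∈ Set.Icc a b, ‖T (sl i y t) ^ 2 * w (sl i y t)‖ₑ ≤
        ENNReal.ofReal (T (sl i y t) ^ 2 * W (sl i y t)) := by
      intro t ht
      rw [Real.enorm_eq_ofReal_abs, abs_mul, abs_of_nonneg (sq_nonneg _)]
      exact ENNReal.ofReal_le_ofReal
        (mul_le_mul_of_nonneg_left (hwW _ (hsubcl t ht)) (sq_nonneg _))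
    exact add_le_add (hend a ⟨le_rfl, hab.le⟩) (hend b ⟨hab.le, le_rfl⟩)
  calc ‖∫ x in O, K x‖ₑ = ‖∫ y, ∫ t in sl i y ⁻¹' O, K (sl i y t)‖ₑ := by rw [hfub]
    _ ≤ ∫⁻ y, ‖∫ t in sl i y ⁻¹' O, K (sl i y t)‖ₑ := enorm_integral_le_lintegral_enorm _
    _ ≤ ∫⁻ y, (G y + G y) := lintegral_mono_ae hline
    _ = 2 * ∫⁻ y, G y := by rw [lintegral_add_left hGm, two_mul]
    _ ≤ _ := by gcongr

/-! ### The weighted estimate along a vector field -/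

/-- `w` is continuous on the closure of `O` and, on almost every line in direction `i`, absolutely
continuous with a bounded derivative inside `O`. -/
def SliceLipschitz (O : Set E3) (i : Fin 3) (w : E3 → ℝ) : Prop :=
  ContinuousOn w (closure O) ∧ ∃ z, SliceDeriv O i w z ∧
    AEStronglyMeasurable z (volume.restrict O) ∧ ∃ M : ℝ, ∀ᵐ x ∂volume.restrict O, |z x| ≤ M

lemma exists_ae_abs_le_of_continuousOn {O : Set E3} (hO : MeasurableSet O)
    (hOb : Bornology.IsBounded O) {w : E3 → ℝ} (hw : ContinuousOn w (closure O)) :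
    ∃ C : ℝ, ∀ᵐ x ∂volume.restrict O, |w x| ≤ C := by
  obtain ⟨C, hC⟩ := hOb.isCompact_closure.exists_bound_of_continuousOn hw
  exact ⟨C, (ae_restrict_iff' hO).2
    (Eventually.of_forall fun x hx => hC x (subset_closure hx))⟩

lemma aestronglyMeasurable_of_continuousOn_closure {O : Set E3} (hO : MeasurableSet O) {w : E3 → ℝ}
    (hw : ContinuousOn w (closure O)) : AEStronglyMeasurable w (volume.restrict O) :=
  (hw.mono subset_closure).aestronglyMeasurable hO

lemma SliceLipschitz.mul {O : Set E3} (hO : MeasurableSet O) (hOb : Bornology.IsBounded O)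
    {i : Fin 3} {w w' : E3 → ℝ} (h : SliceLipschitz O i w) (h' : SliceLipschitz O i w') :
    SliceLipschitz O i (fun x => w x * w' x) := by
  obtain ⟨hc, z, hz, hzm, M, hM⟩ := h
  obtain ⟨hc', z', hz', hzm', M', hM'⟩ := h'
  obtain ⟨C, hC⟩ := exists_ae_abs_le_of_continuousOn hO hOb hc
  obtain ⟨C', hC'⟩ := exists_ae_abs_le_of_continuousOn hO hOb hc'
  refine ⟨hc.mul hc', _, hz.mul hz',
    (hzm.mul (aestronglyMeasurable_of_continuousOn_closure hO hc')).add
      ((aestronglyMeasurable_of_continuousOn_closure hO hc).mul hzm'), M * C' + C * M', ?_⟩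
  filter_upwards [hM, hM', hC, hC'] with x h1 h2 h3 h4
  refine (abs_add_le _ _).trans (add_le_add ?_ ?_)
  · rw [abs_mul]
    exact mul_le_mul h1 h4 (abs_nonneg _) ((abs_nonneg _).trans h1)
  · rw [abs_mul]
    exact mul_le_mul h3 h2 (abs_nonneg _) ((abs_nonneg _).trans h3)

lemma SliceLipschitz.add {O : Set E3} {i : Fin 3} {w w' : E3 → ℝ} (h : SliceLipschitz O i w)
    (h' : SliceLipschitz O i w') : SliceLipschitz O i (fun x => w x + w' x) := by
  obtain ⟨hc, z, hz, hzm, M, hM⟩ := h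
  obtain ⟨hc', z', hz', hzm', M', hM'⟩ := h'
  refine ⟨hc.add hc', _, hz.add hz', hzm.add hzm', M + M', ?_⟩
  filter_upwards [hM, hM'] with x h1 h2
  exact (abs_add_le _ _).trans (add_le_add h1 h2)

lemma SliceLipschitz.sub {O : Set E3} {i : Fin 3} {w w' : E3 → ℝ} (h : SliceLipschitz O i w)
    (h' : SliceLipschitz O i w') : SliceLipschitz O i (fun x => w x - w' x) := by
  obtain ⟨hc, z, hz, hzm, M, hM⟩ := h
  obtain ⟨hc', z', hz', hzm', M', hM'⟩ := h'
  refine ⟨hc.sub hc', _, hz.sub hz', hzm.sub hzm', M + M', ?_⟩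
  filter_upwards [hM, hM'] with x h1 h2
  exact (abs_sub _ _).trans (add_le_add h1 h2)

lemma sliceLipschitz_of_contDiff {O : Set E3} (hO : MeasurableSet O) (hOb : Bornology.IsBounded O)
    {u : E3 → ℝ} (hu : ContDiff ℝ 1 u) (i : Fin 3) : SliceLipschitz O i u :=
  ⟨hu.continuous.continuousOn, _, sliceDeriv_of_contDiff hu O i,
    (continuous_pderiv hu i).aestronglyMeasurable,
    exists_ae_abs_le_of_continuousOn hO hOb (continuous_pderiv hu i).continuousOn⟩

/-- The weight `κ e^{pλd} e^{2sφ}` with `φ = e^{λd}`. For `κ = (sλ)^p` it is `(sλφ)^p e^{2sφ}`. -/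
noncomputable def weight (d : E3 → ℝ) (lam s κ p : ℝ) (x : E3) : ℝ :=
  κ * Real.exp (p * lam * d x + 2 * s * Real.exp (lam * d x))

lemma contDiff_weight {d : E3 → ℝ} (hd : ContDiff ℝ 2 d) (lam s κ p : ℝ) :
    ContDiff ℝ 1 (weight d lam s κ p) := by
  have hd1 : ContDiff ℝ 1 d := hd.of_le (by norm_num)
  unfold weight
  fun_prop

lemma pderiv_weight {d : E3 → ℝ} (hd : ContDiff ℝ 2 d) (lam s κ p : ℝ) (i : Fin 3) (x : E3) :
    pderiv i (weight d lam s κ p) x =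
      weight d lam s κ p x * (p * lam + 2 * (s * lam * Real.exp (lam * d x))) * pderiv i d x := by
  have hdx : HasFDerivAt d (fderiv ℝ d x) x := (hd.differentiable (by norm_num) x).hasFDerivAt
  have h := (((hdx.const_mul (p * lam)).add
    (((hdx.const_mul lam).exp).const_mul (2 * s))).exp).const_mul κ
  have h2 : fderiv ℝ (weight d lam s κ p) x = _ := h.fderiv
  rw [pderiv, h2]
  simp only [weight, pderiv, smul_apply, add_apply, Pi.add_apply,
    smul_eq_mul]
  ring

lemma le_parameter {d : E3 → ℝ} {lam s : ℝ} {x : E3} (hlam : 1 ≤ lam) (hs : 1 ≤ s)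
    (hd : 0 ≤ d x) : lam ≤ s * lam * Real.exp (lam * d x) := by
  have h1 : 1 ≤ Real.exp (lam * d x) := Real.one_le_exp (mul_nonneg (by linarith) hd)
  have h2 : lam * 1 ≤ s * lam * Real.exp (lam * d x) :=
    mul_le_mul (by nlinarith) h1 zero_le_one (by positivity)
  simpa using h2

/-- Young's inequality absorbs the cross term and the zeroth order terms of
`div (h ^ 2 * q * Y)` into its leading term. -/
lemma weighted_pointwise_le {c D lam p W q h v δ ζ : ℝ} (hc : 0 < c) (hq : 0 ≤ q)
    (hlam : 0 < lam) (hDl : 12 * D ≤ c * lam) (hW : lam ≤ W) (hp : -1 ≤ p) (hδ : c ≤ δ)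
    (hζ : |ζ| ≤ 3 * D) :
    q * W * h ^ 2 ≤ 2 / c * (q * (2 * h * v + h ^ 2 * ((p * lam + 2 * W) * δ + ζ)))
      + 8 / c ^ 2 * (q / W * v ^ 2) := by
  have hW0 : 0 < W := hlam.trans_le hW
  have h1 : W * δ ≤ (p * lam + 2 * W) * δ := by
    apply mul_le_mul_of_nonneg_right _ (hc.le.trans hδ)
    nlinarith
  have h2 : W * c ≤ W * δ := by gcongr
  have h3 : -(3 * D) ≤ ζ := neg_le_of_abs_le hζ
  have h4 : c / 4 * lam ≤ c / 4 * W := by gcongr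
  have h5 : 3 * c / 4 * W ≤ (p * lam + 2 * W) * δ + ζ := by nlinarith
  have h6 : h ^ 2 * (3 * c / 4 * W) ≤ h ^ 2 * ((p * lam + 2 * W) * δ + ζ) := by gcongr
  -- completing the square
  have h7 : 0 ≤ (c / 4 * W * h ^ 2 + 2 * h * v + 4 / c * (v ^ 2 / W)) := by
    have : c / 4 * W * h ^ 2 + 2 * h * v + 4 / c * (v ^ 2 / W) =
        (c * W * h + 4 * v) ^ 2 / (4 * c * W) := by
      field_simp
      ring
    rw [this]
    positivity
  have h8 : W * h ^ 2 ≤ 2 / c * (2 * h * v + h ^ 2 * ((p * lam + 2 * W) * δ + ζ))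
      + 8 / c ^ 2 * (v ^ 2 / W) := by
    have e : W * h ^ 2 = 2 / c * (c / 2 * W * h ^ 2) := by field_simp
    have e2 : 8 / c ^ 2 * (v ^ 2 / W) = 2 / c * (4 / c * (v ^ 2 / W)) := by field_simp; ring
    rw [e, e2, ← mul_add]
    gcongr
    nlinarith
  calc q * W * h ^ 2 = q * (W * h ^ 2) := by ring
    _ ≤ q * (2 / c * (2 * h * v + h ^ 2 * ((p * lam + 2 * W) * δ + ζ))
      + 8 / c ^ 2 * (v ^ 2 / W)) := by gcongr
    _ = _ := by ring

/-- Carleman estimate for the derivative along a vector field `Y` that is transversal to the level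
sets of `d`: integrate `div (h ^ 2 * q * Y)` over `O`. -/
theorem exists_weighted_estimate {O : Set E3} (hO : IsOpen O) (hOb : Bornology.IsBounded O)
    {d : E3 → ℝ} (hd : ContDiff ℝ 2 d) (hd0 : ∀ x ∈ closure O, 0 ≤ d x) {Y : E3 → Fin 3 → ℝ}
    (hY : ∀ i, SliceLipschitz O i (fun x => Y x i)) {c : ℝ} (hc : 0 < c)
    (hcY : ∀ x ∈ closure O, c ≤ ∑ i, pderiv i d x * Y x i) :
    ∃ C lam₀ : ℝ, 0 < C ∧ 1 ≤ lam₀ ∧ ∀ lam s κ p : ℝ, lam₀ ≤ lam → 1 ≤ s → 0 ≤ κ → -1 ≤ p →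
      ∀ (F : ℕ → E3 → ℝ) (h : E3 → ℝ) (Dh : Fin 3 → E3 → ℝ) (τ : E3 → ℝ),
        StrongApprox O F h Dh →
        (∀ᵐ x ∂((μHE[2] : Measure E3).restrict (frontier O)),
          Tendsto (fun n => F n x) atTop (𝓝 (τ x))) →
        ∫⁻ x in O, ENNReal.ofReal
            (weight d lam s κ p x * (s * lam * Real.exp (lam * d x)) * h x ^ 2) ≤
          ENNReal.ofReal C * (∫⁻ x in O, ENNReal.ofReal
            (weight d lam s κ p x / (s * lam * Real.exp (lam * d x)) *
              (∑ i, Dh i x * Y x i) ^ 2))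
          + ENNReal.ofReal C * ∫⁻ x in frontier O, ENNReal.ofReal
            (weight d lam s κ p x * τ x ^ 2) ∂μHE[2] := by
  have hOm := hO.measurableSet
  choose hYc Z hZ hZm D₀ hD₀ using hY
  set D := ∑ i, |D₀ i| with hD
  have hD0 : 0 ≤ D := Finset.sum_nonneg fun i _ => abs_nonneg _
  have hZD : ∀ᵐ x ∂volume.restrict O, ∀ i, |Z i x| ≤ D := by
    rw [ae_all_iff]
    intro i
    filter_upwards [hD₀ i] with x hx
    exact hx.trans ((le_abs_self _).trans
      (Finset.single_le_sum (f := fun i => |D₀ i|) (fun i _ => abs_nonneg _) (Finset.mem_univ i)))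
  have hYM : ∃ M : ℝ, 0 ≤ M ∧ ∀ x ∈ closure O, ∀ i, |Y x i| ≤ M := by
    have := fun i => hOb.isCompact_closure.exists_bound_of_continuousOn (hYc i)
    choose M hM using this
    refine ⟨∑ i, |M i|, Finset.sum_nonneg fun i _ => abs_nonneg _, fun x hx i => ?_⟩
    exact (hM i x hx).trans ((le_abs_self _).trans
      (Finset.single_le_sum (f := fun i => |M i|) (fun i _ => abs_nonneg _) (Finset.mem_univ i)))
  obtain ⟨M, hM0, hM⟩ := hYM
  refine ⟨8 / c ^ 2 + 2 / c * (3 * (2 * M)), 1 + 12 * D / c, by positivity,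
    by have : 0 ≤ 12 * D / c := by positivity
       linarith, ?_⟩
  intro lam s κ p hlam hs hκ hp F h Dh τ hF hτ
  have hlam0 : 1 ≤ lam := by
    have : 0 ≤ 12 * D / c := by positivity
    linarith
  have hDl : 12 * D ≤ c * lam := by
    have : 12 * D / c ≤ lam := by linarith
    rw [div_le_iff₀ hc] at this
    linarith
  set q := weight d lam s κ p with hq
  set W : E3 → ℝ := fun x => s * lam * Real.exp (lam * d x) with hW
  have hq0 : ∀ x, 0 ≤ q x := fun x => by rw [hq, weight]; positivity
  have hqC : ContDiff ℝ 1 q := contDiff_weight hd lam s κ p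
  have hd1 : ContDiff ℝ 1 d := hd.of_le (by norm_num)
  have hdc : Continuous d := hd.continuous
  have hWc : Continuous W := by fun_prop
  have hW0 : ∀ x, 0 < W x := fun x => by simp only [hW]; positivity
  have hWlam : ∀ x ∈ closure O, lam ≤ W x := fun x hx => le_parameter hlam0 hs (hd0 x hx)
  -- the boundary terms in the three coordinate directions
  have hdiv : ∀ i, IntegrableOn (fun x => 2 * (h x * Dh i x) * (q x * Y x i) + h x ^ 2 *
        (pderiv i q x * Y x i + q x * Z i x)) O ∧
      ‖∫ x in O, (2 * (h x * Dh i x) * (q x * Y x i) + h x ^ 2 *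
        (pderiv i q x * Y x i + q x * Z i x))‖ₑ ≤
      2 * ∫⁻ x in frontier O, ENNReal.ofReal (τ x ^ 2 * (M * q x)) ∂μHE[2] := by
    intro i
    have hzc : ContinuousOn (fun x => pderiv i q x * Y x i) (closure O) :=
      (continuous_pderiv hqC i).continuousOn.mul (hYc i)
    obtain ⟨C₁, hC₁⟩ := exists_ae_abs_le_of_continuousOn hOm hOb hzc
    obtain ⟨C₂, hC₂⟩ := exists_ae_abs_le_of_continuousOn hOm hOb hqC.continuous.continuousOn
    refine enorm_integral_partial_sq_mul_le hO hOb i hF hτ (M := C₁ + C₂ * D)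
      ((sliceDeriv_of_contDiff hqC O i).mul (hZ i)) (hqC.continuous.continuousOn.mul (hYc i))
      (fun x hx => ?_) (measurable_const.mul hqC.continuous.measurable)
      ((aestronglyMeasurable_of_continuousOn_closure hOm hzc).add
        (hqC.continuous.aestronglyMeasurable.mul (hZm i))) ?_
    · rw [abs_mul, abs_of_nonneg (hq0 x), mul_comm]
      exact mul_le_mul_of_nonneg_right (hM x hx i) (hq0 x)
    · filter_upwards [hC₁, hC₂, hZD] with x h1 h2 h3
      refine (abs_add_le _ _).trans (add_le_add h1 ?_)
      rw [abs_mul]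
      exact mul_le_mul h2 (h3 i) (abs_nonneg _) ((abs_nonneg _).trans h2)
  set K : Fin 3 → E3 → ℝ := fun i x => 2 * (h x * Dh i x) * (q x * Y x i) + h x ^ 2 *
        (pderiv i q x * Y x i + q x * Z i x) with hK
  have hhm := hF.memLp
  have hbdd : ∀ (u v : E3 → ℝ), ContinuousOn u (closure O) → Integrable v (volume.restrict O) →
      IntegrableOn (fun x => u x * v x) O := by
    intro u v hu hv
    obtain ⟨C, hC⟩ := exists_ae_abs_le_of_continuousOn hOm hOb hu
    exact hv.bdd_mul (aestronglyMeasurable_of_continuousOn_closure hOm hu) hC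
  have hXi : IntegrableOn (fun x => q x * W x * h x ^ 2) O :=
    hbdd (fun x => q x * W x) _ (hqC.continuous.mul hWc).continuousOn hhm.integrable_sq
  have hvm : MemLp (fun x => ∑ i, Dh i x * Y x i) 2 (volume.restrict O) := by
    refine memLp_finsetSum _ fun i _ => ?_
    obtain ⟨C, hC⟩ := exists_ae_abs_le_of_continuousOn hOm hOb (hYc i)
    have hYi : MemLp (fun x => Y x i) ⊤ (volume.restrict O) :=
      memLp_top_of_bound (aestronglyMeasurable_of_continuousOn_closure hOm (hYc i)) C hC
    exact hYi.mul' (hF.memLp_grad i)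
  have hRi : IntegrableOn (fun x => q x / W x * (∑ i, Dh i x * Y x i) ^ 2) O :=
    hbdd (fun x => q x / W x) _
      (hqC.continuous.div hWc fun x => (hW0 x).ne').continuousOn hvm.integrable_sq
  have hKs : IntegrableOn (fun x => ∑ i, K i x) O := integrable_finsetSum _ fun i _ => (hdiv i).1
  have hpt : ∀ᵐ x ∂volume.restrict O, q x * W x * h x ^ 2 ≤
      2 / c * (∑ i, K i x) + 8 / c ^ 2 * (q x / W x * (∑ i, Dh i x * Y x i) ^ 2) := by
    filter_upwards [hZD, ae_restrict_mem hOm] with x hx hxO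
    have hxcl := subset_closure hxO
    have hζ : |∑ i, Z i x| ≤ 3 * D := by
      refine (Finset.abs_sum_le_sum_abs _ _).trans ?_
      refine (Finset.sum_le_sum fun i _ => hx i).trans ?_
      simp
    have := weighted_pointwise_le (h := h x) (v := ∑ i, Dh i x * Y x i) hc (hq0 x)
      (by linarith) hDl (hWlam x hxcl) hp (hcY x hxcl) hζ
    have e : ∑ i, K i x = q x * (2 * h x * (∑ i, Dh i x * Y x i) + h x ^ 2 *
        ((p * lam + 2 * W x) * (∑ i, pderiv i d x * Y x i) + ∑ i, Z i x)) := by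
      simp only [hK, Fin.sum_univ_three, hq, hW, pderiv_weight hd]
      ring
    rwa [e]
  have hint : ∫ x in O, q x * W x * h x ^ 2 ≤ 2 / c * (∑ i, ∫ x in O, K i x) +
      8 / c ^ 2 * ∫ x in O, q x / W x * (∑ i, Dh i x * Y x i) ^ 2 := by
    rw [← integral_finsetSum _ fun i _ => (hdiv i).1, ← integral_const_mul, ← integral_const_mul,
      ← integral_add (hKs.const_mul _) (hRi.const_mul _)]
    exact integral_mono_ae hXi ((hKs.const_mul _).add (hRi.const_mul _)) hpt
  have hB : ∫⁻ x in frontier O, ENNReal.ofReal (τ x ^ 2 * (M * q x)) ∂μHE[2] =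
      ENNReal.ofReal M * ∫⁻ x in frontier O, ENNReal.ofReal (q x * τ x ^ 2) ∂μHE[2] := by
    rw [← lintegral_const_mul' _ _ ENNReal.ofReal_ne_top]
    refine lintegral_congr fun x => ?_
    rw [← ENNReal.ofReal_mul hM0]
    congr 1
    ring
  rw [← ofReal_integral_eq_lintegral_ofReal hXi (Eventually.of_forall fun x =>
      mul_nonneg (mul_nonneg (hq0 x) (hW0 x).le) (sq_nonneg _)),
    ← ofReal_integral_eq_lintegral_ofReal hRi (Eventually.of_forall fun x =>
      mul_nonneg (div_nonneg (hq0 x) (hW0 x).le) (sq_nonneg _))]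
  set B := ∫⁻ x in frontier O, ENNReal.ofReal (q x * τ x ^ 2) ∂μHE[2]
  set R := ∫ x in O, q x / W x * (∑ i, Dh i x * Y x i) ^ 2
  have hKB : ENNReal.ofReal (∑ i, ∫ x in O, K i x) ≤ ENNReal.ofReal (3 * (2 * M)) * B := by
    calc ENNReal.ofReal (∑ i, ∫ x in O, K i x) ≤ ‖∑ i, ∫ x in O, K i x‖ₑ := by
          rw [Real.enorm_eq_ofReal_abs]
          exact ENNReal.ofReal_le_ofReal (le_abs_self _)
      _ ≤ ∑ i, ‖∫ x in O, K i x‖ₑ := enorm_sum_le _ _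
      _ ≤ ∑ _i : Fin 3, 2 * (ENNReal.ofReal M * B) :=
          Finset.sum_le_sum fun i _ => hB ▸ (hdiv i).2
      _ = _ := by
          rw [ENNReal.ofReal_mul (by norm_num), ENNReal.ofReal_mul (by norm_num)]
          simp [mul_assoc]
  calc ENNReal.ofReal (∫ x in O, q x * W x * h x ^ 2)
      ≤ ENNReal.ofReal (2 / c * (∑ i, ∫ x in O, K i x) + 8 / c ^ 2 * R) :=
        ENNReal.ofReal_le_ofReal hint
    _ ≤ ENNReal.ofReal (2 / c) * ENNReal.ofReal (∑ i, ∫ x in O, K i x) +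
          ENNReal.ofReal (8 / c ^ 2) * ENNReal.ofReal R := by
        rw [← ENNReal.ofReal_mul (by positivity), ← ENNReal.ofReal_mul (by positivity)]
        exact ENNReal.ofReal_add_le
    _ ≤ ENNReal.ofReal (2 / c) * (ENNReal.ofReal (3 * (2 * M)) * B) +
          ENNReal.ofReal (8 / c ^ 2) * ENNReal.ofReal R := by gcongr
    _ = ENNReal.ofReal (2 / c * (3 * (2 * M))) * B +
          ENNReal.ofReal (8 / c ^ 2) * ENNReal.ofReal R := by
        rw [← mul_assoc, ← ENNReal.ofReal_mul (by positivity)]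
    _ ≤ _ := by
        rw [add_comm]
        have p1 : 0 ≤ 8 / c ^ 2 := by positivity
        have p2 : 0 ≤ 2 / c * (3 * (2 * M)) := by positivity
        gcongr <;> linarith

/-! ### Sobolev functions and the operators `P` and `Q` -/

lemma MemW.memLp {Ω : Set E3} {p : ℝ≥0∞} : ∀ {n : ℕ} {u : E3 → ℝ}, MemW Ω p n u →
    MemLp u p (volume.restrict Ω)
  | 0, _, h => h
  | _ + 1, _, h => h.1

lemma MemW.congr_ae {Ω : Set E3} (hΩ : IsOpen Ω) {p : ℝ≥0∞} : ∀ {n : ℕ} {u u' : E3 → ℝ},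
    MemW Ω p n u → u =ᵐ[volume.restrict Ω] u' → MemW Ω p n u'
  | 0, _, _, h, hu => MemLp.ae_eq hu h
  | _ + 1, _, _, h, hu => ⟨h.1.ae_eq hu, fun i => by
      obtain ⟨v, hv, hvW⟩ := h.2 i
      exact ⟨v, hv.congr hΩ hu (EventuallyEq.refl _ _), hvW⟩⟩

lemma MemW.hasWeakPartial {Ω : Set E3} {p : ℝ≥0∞} {n : ℕ} {u : E3 → ℝ}
    (h : MemW Ω p (n + 1) u) (i : Fin 3) : HasWeakPartial Ω i u (weakPartial Ω i u) := by
  obtain ⟨v, hv, _⟩ := h.2 i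
  exact hv.hasWeakPartial_weakPartial

lemma MemW.memW_weakPartial {Ω : Set E3} (hΩ : IsOpen Ω) {p : ℝ≥0∞} {n : ℕ} {u : E3 → ℝ}
    (h : MemW Ω p (n + 1) u) (i : Fin 3) : MemW Ω p n (weakPartial Ω i u) := by
  obtain ⟨v, hv, hvW⟩ := h.2 i
  exact hvW.congr_ae hΩ (hv.weakPartial_ae_eq hΩ).symm

lemma MemW.of_two {Ω : Set E3} {p : ℝ≥0∞} {u : E3 → ℝ} (h : MemW Ω p 2 u) : MemW Ω p 1 u :=
  ⟨h.1, fun i => by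
    obtain ⟨v, hv, hvW⟩ := h.2 i
    exact ⟨v, hv, hvW.memLp⟩⟩

lemma IsTraceOn.exists_strongApprox {Ω S : Set E3} (hΩ : IsOpen Ω) {f τ : E3 → ℝ}
    (h : IsTraceOn Ω S f τ) (hf : MemW Ω 2 1 f) :
    ∃ F, StrongApprox Ω F f (fun i => weakPartial Ω i f) ∧
      ∀ᵐ x ∂((μHE[2] : Measure E3).restrict S), Tendsto (fun n => F n x) atTop (𝓝 (τ x)) := by
  obtain ⟨F, h1, h2, h3, h4⟩ := h
  exact ⟨F, ⟨h1, hf.memLp, fun i => (hf.memW_weakPartial hΩ i).memLp, h2, h3⟩, h4⟩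

lemma StrongApprox.hasWeakPartial_mul {Ω : Set E3} (hΩ : IsOpen Ω) {F : ℕ → E3 → ℝ} {f : E3 → ℝ}
    {Df : Fin 3 → E3 → ℝ} (hF : StrongApprox Ω F f Df) {a : E3 → ℝ} (ha : MemW Ω ⊤ 1 a)
    (i : Fin 3) :
    HasWeakPartial Ω i (fun x => f x * a x) (fun x => Df i x * a x + f x * weakPartial Ω i a x) :=
  (ha.hasWeakPartial i).mul_of_strongApprox hΩ hF ha.memLp (ha.memW_weakPartial hΩ i).memLp

lemma exists_forall_ae_abs_le {ι : Type*} [Fintype ι] {Ω : Set E3} {a : ι → E3 → ℝ}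
    (ha : ∀ l, MemLp (a l) ⊤ (volume.restrict Ω)) :
    ∃ N : ℝ, 0 ≤ N ∧ ∀ᵐ x ∂volume.restrict Ω, ∀ l, |a l x| ≤ N := by
  choose M hM0 hM using fun l => MemLp.ae_abs_le (ha l)
  refine ⟨∑ l, M l, Finset.sum_nonneg fun l _ => hM0 l, ?_⟩
  rw [ae_all_iff]
  intro l
  filter_upwards [hM l] with x hx
  exact hx.trans (Finset.single_le_sum (fun l _ => hM0 l) (Finset.mem_univ l))

/-- `P f = A ∇f + f div A`. -/
lemma opP_ae_eq {Ω : Set E3} (hΩ : IsOpen Ω) {A : E3 → Matrix (Fin 3) (Fin 3) ℝ}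
    (hA : ∀ i j, MemW Ω ⊤ 1 (fun x => A x i j)) {F : ℕ → E3 → ℝ} {f : E3 → ℝ}
    {Df : Fin 3 → E3 → ℝ} (hF : StrongApprox Ω F f Df) :
    ∀ᵐ x ∂volume.restrict Ω, ∀ k, opP Ω A f x k =
      ∑ j, (Df j x * A x k j + f x * weakPartial Ω j (fun y => A y k j) x) := by
  have h : ∀ k j, ∀ᵐ x ∂volume.restrict Ω, weakPartial Ω j (fun y => f y * A y k j) x =
      Df j x * A x k j + f x * weakPartial Ω j (fun y => A y k j) x := fun k j =>
    (hF.hasWeakPartial_mul hΩ (hA k j) j).weakPartial_ae_eq hΩ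
  have h' := ae_all_iff.2 fun k => ae_all_iff.2 (h k)
  filter_upwards [h'] with x hx k
  refine Eq.trans ?_ (Finset.sum_congr rfl fun j _ => hx k j)
  rfl

lemma rot_apply (Ω : Set E3) (v : E3 → Fin 3 → ℝ) (x : E3) (k : Fin 3) :
    rot Ω v x k = weakPartial Ω (k + 1) (fun y => v y (k + 2)) x -
      weakPartial Ω (k + 2) (fun y => v y (k + 1)) x := by
  fin_cases k <;> rfl

/-- `Q g = ∇g × b + g rot b`. -/
lemma opQ_ae_eq {Ω : Set E3} (hΩ : IsOpen Ω) {b : E3 → Fin 3 → ℝ}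
    (hb : ∀ i, MemW Ω ⊤ 1 (fun x => b x i)) {F : ℕ → E3 → ℝ} {g : E3 → ℝ}
    {Dg : Fin 3 → E3 → ℝ} (hF : StrongApprox Ω F g Dg) (k : Fin 3) :
    (fun x => opQ Ω b g x k) =ᵐ[volume.restrict Ω] fun x =>
      (Dg (k + 1) x * b x (k + 2) + g x * weakPartial Ω (k + 1) (fun y => b y (k + 2)) x) -
      (Dg (k + 2) x * b x (k + 1) + g x * weakPartial Ω (k + 2) (fun y => b y (k + 1)) x) := by
  have h : ∀ i j, ∀ᵐ x ∂volume.restrict Ω, weakPartial Ω j (fun y => g y * b y i) x =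
      Dg j x * b x i + g x * weakPartial Ω j (fun y => b y i) x := fun i j =>
    (hF.hasWeakPartial_mul hΩ (hb i) j).weakPartial_ae_eq hΩ
  filter_upwards [h (k + 2) (k + 1), h (k + 1) (k + 2)] with x h1 h2
  rw [← h1, ← h2]
  exact rot_apply Ω _ x k

lemma pderiv_comm {φ : E3 → ℝ} (hφ : ContDiff ℝ (⊤ : ℕ∞) φ) (i j : Fin 3) :
    pderiv i (pderiv j φ) = pderiv j (pderiv i φ) := by
  have hφ2 : ContDiff ℝ 2 φ := contDiff_infty.1 hφ 2
  have hd : Differentiable ℝ (fderiv ℝ φ) :=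
    (hφ2.fderiv_right (m := 1) (by norm_num)).differentiable one_ne_zero
  have e : ∀ (i j : Fin 3) x, pderiv i (pderiv j φ) x =
      fderiv ℝ (fderiv ℝ φ) x (EuclideanSpace.single i 1) (EuclideanSpace.single j 1) := by
    intro i j x
    have h := ((hd x).hasFDerivAt.clm_apply (hasFDerivAt_const (EuclideanSpace.single j (1:ℝ)) x))
    have h2 : fderiv ℝ (pderiv j φ) x = _ := h.fderiv
    rw [pderiv, h2]
    simp
  ext x
  rw [e, e]
  have hs : IsSymmSndFDerivAt ℝ φ x :=
    hφ2.contDiffAt.isSymmSndFDerivAt (by simp)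
  exact hs _ _

/-- Second weak derivatives commute. -/
lemma MemW.weakPartial_comm {Ω : Set E3} (hΩ : IsOpen Ω) {p : ℝ≥0∞} {g : E3 → ℝ}
    (hg : MemW Ω p 2 g) (i j : Fin 3) :
    weakPartial Ω i (weakPartial Ω j g) =ᵐ[volume.restrict Ω]
      weakPartial Ω j (weakPartial Ω i g) := by
  have hi := hg.hasWeakPartial i
  have hj := hg.hasWeakPartial j
  have hji := (hg.memW_weakPartial hΩ j).hasWeakPartial i
  have hij := (hg.memW_weakPartial hΩ i).hasWeakPartial j
  refine HasWeakPartial.weakPartial_ae_eq hΩ ⟨hji.1, hij.2.1, fun φ hφ hc hs => ?_⟩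
  have hsm : ∀ k, ContDiff ℝ (⊤ : ℕ∞) (pderiv k φ) := fun k =>
    (hφ.fderiv_right (m := ((⊤ : ℕ∞) : WithTop ℕ∞)) (by simp)).clm_apply contDiff_const
  rw [← hij.2.2 φ hφ hc hs]
  have h1 := hj.2.2 _ (hsm i) (hasCompactSupport_pderiv hc i)
    ((tsupport_pderiv_subset φ i).trans hs)
  have h2 := hi.2.2 _ (hsm j) (hasCompactSupport_pderiv hc j)
    ((tsupport_pderiv_subset φ j).trans hs)
  rw [pderiv_comm hφ j i] at h1
  exact neg_injective (h1.symm.trans h2)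

/-! ### Absorption of lower order terms -/

lemma weight_one (d : E3 → ℝ) (lam s : ℝ) (x : E3) : weight d lam s (s * lam) 1 x =
    s * lam * Real.exp (lam * d x) * Real.exp (2 * s * Real.exp (lam * d x)) := by
  rw [weight, Real.exp_add, one_mul]
  ring

lemma weight_neg_one (d : E3 → ℝ) (lam s : ℝ) (x : E3) : weight d lam s (1 / (s * lam)) (-1) x =
    1 / (s * lam * Real.exp (lam * d x)) * Real.exp (2 * s * Real.exp (lam * d x)) := by
  rw [weight, Real.exp_add, show -1 * lam * d x = -(lam * d x) by ring, Real.exp_neg,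
    ← one_div_mul_one_div]
  ring

lemma exists_pos_forall_le_of_continuousOn {K : Set E3} (hK : IsCompact K) {u : E3 → ℝ}
    (hu : ContinuousOn u K) (h0 : ∀ x ∈ K, 0 < u x) : ∃ c, 0 < c ∧ ∀ x ∈ K, c ≤ u x := by
  rcases K.eq_empty_or_nonempty with rfl | hne
  · exact ⟨1, one_pos, by simp⟩
  · obtain ⟨x, hx, hmin⟩ := hK.exists_isMinOn hne hu
    exact ⟨u x, h0 x hx, fun y hy => hmin hy⟩

lemma lintegral_le_of_absorb {O : Set E3} {a u r : E3 → ℝ} {B : ℝ≥0∞} {C : ℝ}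
    (ha : IntegrableOn a O) (hC : 0 ≤ C)
    (h1 : ∫⁻ x in O, ENNReal.ofReal (a x) ≤ (∫⁻ x in O, ENNReal.ofReal (u x)) + B)
    (h2 : ∀ᵐ x ∂volume.restrict O, u x ≤ C * r x + a x / 2) :
    ∫⁻ x in O, ENNReal.ofReal (a x) ≤
      ENNReal.ofReal (2 * C) * (∫⁻ x in O, ENNReal.ofReal (r x)) + 2 * B := by
  set T := ∫⁻ x in O, ENNReal.ofReal (a x) with hT
  have hfin : T ≠ ⊤ := ha.lintegral_lt_top.ne
  have hhalf : ∀ x, ENNReal.ofReal (a x / 2) = ENNReal.ofReal (a x) / 2 := fun x => by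
    rw [ENNReal.ofReal_div_of_pos two_pos, ENNReal.ofReal_ofNat]
  have h3 : ∫⁻ x in O, ENNReal.ofReal (u x) ≤
      ENNReal.ofReal C * (∫⁻ x in O, ENNReal.ofReal (r x)) + T / 2 := by
    calc ∫⁻ x in O, ENNReal.ofReal (u x)
        ≤ ∫⁻ x in O, (ENNReal.ofReal C * ENNReal.ofReal (r x) + ENNReal.ofReal (a x) / 2) := by
          refine lintegral_mono_ae ?_
          filter_upwards [h2] with x hx
          rw [← hhalf, ← ENNReal.ofReal_mul hC]
          exact (ENNReal.ofReal_le_ofReal hx).trans ENNReal.ofReal_add_le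
      _ = _ := by
          rw [lintegral_add_right' _ (ha.1.aemeasurable.ennreal_ofReal.div_const _),
            lintegral_const_mul' _ _ ENNReal.ofReal_ne_top, hT]
          simp only [div_eq_mul_inv]
          rw [lintegral_mul_const' _ _ (by simp)]
  have h4 : T / 2 + T / 2 ≤
      (ENNReal.ofReal C * (∫⁻ x in O, ENNReal.ofReal (r x)) + B) + T / 2 := by
    rw [ENNReal.add_halves]
    refine h1.trans ((add_le_add h3 le_rfl).trans (le_of_eq ?_))
    ring
  have hT2 : T / 2 ≠ ⊤ := ENNReal.div_ne_top hfin (by simp)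
  have h5 := (ENNReal.add_le_add_iff_right hT2).1 h4
  calc T = T / 2 + T / 2 := (ENNReal.add_halves T).symm
    _ ≤ _ := add_le_add h5 h5
    _ = _ := by
      rw [ENNReal.ofReal_mul two_pos.le, ENNReal.ofReal_ofNat]
      ring

/-- Where `det A ≠ 0`, the gradient is controlled by `P f` and `f`. -/
lemma exists_ae_sq_grad_le_opP {Ω O : Set E3} (hΩ : IsOpen Ω) (hO : IsOpen O)
    (hOb : Bornology.IsBounded O) (hOΩ : O ⊆ Ω) {A : E3 → Matrix (Fin 3) (Fin 3) ℝ}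
    (hA : ∀ i j, MemW Ω ⊤ 1 (fun x => A x i j)) (hAc : ContinuousOn A (closure O))
    (hdet : ∀ x ∈ closure O, (A x).det ≠ 0) :
    ∃ C : ℝ, 0 ≤ C ∧ ∀ (F : ℕ → E3 → ℝ) (f : E3 → ℝ) (Df : Fin 3 → E3 → ℝ),
      StrongApprox Ω F f Df → ∀ᵐ x ∂volume.restrict O,
        ∑ i, Df i x ^ 2 ≤ C * (sqNorm (opP Ω A f x) + f x ^ 2) := by
  have hinv : ContinuousOn (fun x => (A x)⁻¹) (closure O) := by
    simp only [Matrix.inv_def, Ring.inverse_eq_inv']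
    have h1 : ContinuousOn (fun x => (A x).det) (closure O) :=
      (continuous_id.matrix_det).comp_continuousOn hAc
    have h2 : ContinuousOn (fun x => (A x).adjugate) (closure O) :=
      (continuous_id.matrix_adjugate).comp_continuousOn hAc
    exact (h1.inv₀ hdet).smul h2
  have hent : ∀ p : Fin 3 × Fin 3, ContinuousOn (fun x => (A x)⁻¹ p.1 p.2) (closure O) := fun p =>
    ((continuous_apply_apply p.1 p.2).comp_continuousOn hinv)
  choose N₀ hN₀ using fun p => hOb.isCompact_closure.exists_bound_of_continuousOn (hent p)
  set N := ∑ p, |N₀ p| with hN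
  have hNb : ∀ x ∈ closure O, ∀ i k, |(A x)⁻¹ i k| ≤ N := fun x hx i k =>
    ((hN₀ (i, k) x hx).trans (le_abs_self _)).trans
      (Finset.single_le_sum (f := fun p => |N₀ p|) (fun p _ => abs_nonneg _)
        (Finset.mem_univ (i, k)))
  obtain ⟨N', hN'0, hN'⟩ := exists_forall_ae_abs_le
    (a := fun (p : Fin 3 × Fin 3) => weakPartial Ω p.2 (fun y => A y p.1 p.2))
    (fun p => ((hA p.1 p.2).memW_weakPartial hΩ p.2).memLp)
  refine ⟨18 * N ^ 2 * (1 + 27 * N' ^ 2), by positivity, fun F f Df hF => ?_⟩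
  have hle : volume.restrict O ≤ volume.restrict Ω := Measure.restrict_mono_set _ hOΩ
  filter_upwards [ae_mono hle (opP_ae_eq hΩ hA hF), ae_mono hle hN',
    ae_restrict_mem hO.measurableSet] with x hP hx hxO
  have hxcl := subset_closure hxO
  set v : Fin 3 → ℝ := fun i => Df i x with hv
  set α : Fin 3 → ℝ := fun k => ∑ j, weakPartial Ω j (fun y => A y k j) x with hα
  have hαb : ∀ k, |α k| ≤ 3 * N' := fun k =>
    (Finset.abs_sum_le_sum_abs _ _).trans
      ((Finset.sum_le_sum fun j _ => hx (k, j)).trans (by simp))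
  have hAv : ∀ k, (A x).mulVec v k = opP Ω A f x k - f x * α k := by
    intro k
    rw [hP k, hα, Finset.sum_add_distrib, Finset.mul_sum]
    simp only [Matrix.mulVec, dotProduct, hv, add_sub_cancel_right, mul_comm]
  have hk : ∀ k, (A x).mulVec v k ^ 2 ≤ 2 * opP Ω A f x k ^ 2 + 18 * N' ^ 2 * f x ^ 2 := by
    intro k
    rw [hAv]
    have h1 : α k ^ 2 ≤ (3 * N') ^ 2 := sq_le_sq' (neg_le_of_abs_le (hαb k)) (le_of_abs_le (hαb k))
    have h2 : f x ^ 2 * α k ^ 2 ≤ f x ^ 2 * (3 * N') ^ 2 := by gcongr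
    nlinarith [sq_nonneg (opP Ω A f x k + f x * α k)]
  have hvi : ∀ i, v i ^ 2 ≤ 3 * N ^ 2 * ∑ k, (A x).mulVec v k ^ 2 := by
    intro i
    have e : v i = ∑ k, (A x)⁻¹ i k * (A x).mulVec v k := by
      have h1 : (A x)⁻¹.mulVec ((A x).mulVec v) = v := by
        rw [Matrix.mulVec_mulVec, Matrix.nonsing_inv_mul _ (isUnit_iff_ne_zero.2 (hdet x hxcl)),
          Matrix.one_mulVec]
      conv_lhs => rw [← h1]
      rfl
    rw [e]
    refine (Finset.sum_mul_sq_le_sq_mul_sq _ _ _).trans ?_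
    gcongr
    calc ∑ k, (A x)⁻¹ i k ^ 2 ≤ ∑ _k : Fin 3, N ^ 2 :=
          Finset.sum_le_sum fun k _ => sq_le_sq' (neg_le_of_abs_le (hNb x hxcl i k))
            (le_of_abs_le (hNb x hxcl i k))
      _ = 3 * N ^ 2 := by simp
  calc ∑ i, Df i x ^ 2 ≤ ∑ _i : Fin 3, 3 * N ^ 2 * ∑ k, (A x).mulVec v k ^ 2 :=
        Finset.sum_le_sum fun i _ => hvi i
    _ = 9 * N ^ 2 * ∑ k, (A x).mulVec v k ^ 2 := by simp; ring
    _ ≤ 9 * N ^ 2 * ∑ k, (2 * opP Ω A f x k ^ 2 + 18 * N' ^ 2 * f x ^ 2) := by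
        gcongr with k _
        exact hk k
    _ = 18 * N ^ 2 * (sqNorm (opP Ω A f x) + 27 * N' ^ 2 * f x ^ 2) := by
        rw [Finset.sum_add_distrib, ← Finset.mul_sum, sqNorm]
        simp
        ring
    _ ≤ 18 * N ^ 2 * ((1 + 27 * N' ^ 2) * (sqNorm (opP Ω A f x) + f x ^ 2)) := by
        gcongr
        have : 0 ≤ sqNorm (opP Ω A f x) := Finset.sum_nonneg fun _ _ => sq_nonneg _
        nlinarith [sq_nonneg (f x), mul_nonneg (sq_nonneg N') this]
    _ = _ := by ring

/-- The left-hand side of both Carleman estimates is finite, which permits absorption. -/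
lemma integrableOn_energy {Ω O : Set E3} (hO : IsOpen O) (hOb : Bornology.IsBounded O)
    (hOΩ : O ⊆ Ω) {d : E3 → ℝ} (hd : Continuous d) (lam s : ℝ) {F : ℕ → E3 → ℝ} {f : E3 → ℝ}
    (hF : StrongApprox Ω F f (fun i => weakPartial Ω i f)) :
    IntegrableOn (fun x => (sqNorm (weakGrad Ω f x)
      + s ^ 2 * lam ^ 2 * Real.exp (lam * d x) ^ 2 * f x ^ 2)
        * Real.exp (2 * s * Real.exp (lam * d x))) O := by
  have hF' := hF.mono hOΩ
  have hOm := hO.measurableSet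
  have hbdd : ∀ (u v : E3 → ℝ), Continuous u → Integrable v (volume.restrict O) →
      Integrable (fun x => u x * v x) (volume.restrict O) := by
    intro u v hu hv
    obtain ⟨C, hC⟩ := exists_ae_abs_le_of_continuousOn hOm hOb hu.continuousOn
    exact hv.bdd_mul hu.aestronglyMeasurable hC
  have h1 : Integrable (fun x => sqNorm (weakGrad Ω f x)) (volume.restrict O) :=
    integrable_finsetSum _ fun i _ => (hF'.memLp_grad i).integrable_sq
  have h2 := hbdd (fun x => Real.exp (2 * s * Real.exp (lam * d x))) _ (by fun_prop) h1
  have h3 := hbdd (fun x => Real.exp (2 * s * Real.exp (lam * d x)) *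
    (s ^ 2 * lam ^ 2 * Real.exp (lam * d x) ^ 2)) _ (by fun_prop) hF'.memLp.integrable_sq
  refine (h2.add h3).congr (Eventually.of_forall fun x => ?_)
  simp only [Pi.add_apply]
  ring

/-! ### The Carleman estimate for `P` -/

/-- The weighted estimate along `∇d` with the weight `sλφ e^{2sφ}` bounds `f`, and the invertibility
of `A` bounds the gradient of `f`. -/
theorem exists_carleman_estimate_opP {Ω O : Set E3} (hΩ : IsOpen Ω) (hO : IsOpen O)
    (hOb : Bornology.IsBounded O) (hOΩ : O ⊆ Ω) {d : E3 → ℝ} (hd : ContDiff ℝ 2 d)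
    (hd0 : ∀ x ∈ closure O, 0 ≤ d x) (hdgrad : ∀ x ∈ closure O, grad d x ≠ 0)
    {A : E3 → Matrix (Fin 3) (Fin 3) ℝ} (hA : ∀ i j, MemW Ω ⊤ 1 (fun x => A x i j))
    (hAc : ContinuousOn A (closure O)) (hdet : ∀ x ∈ closure O, (A x).det ≠ 0) :
    ∃ C lam₀ : ℝ, 0 < C ∧ 1 ≤ lam₀ ∧ ∀ lam s : ℝ, lam₀ ≤ lam → 1 ≤ s →
      ∀ f : E3 → ℝ, MemW Ω 2 1 f → ∀ f' : E3 → ℝ, IsTraceOn Ω (frontier O) f f' →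
        ∫⁻ x in O, ENNReal.ofReal ((sqNorm (weakGrad Ω f x)
            + s ^ 2 * lam ^ 2 * Real.exp (lam * d x) ^ 2 * f x ^ 2)
              * Real.exp (2 * s * Real.exp (lam * d x))) ≤
          ENNReal.ofReal C * (∫⁻ x in O, ENNReal.ofReal
            (sqNorm (opP Ω A f x) * Real.exp (2 * s * Real.exp (lam * d x))))
          + ENNReal.ofReal C * (∫⁻ x in frontier O, ENNReal.ofReal
            (s * lam * Real.exp (lam * d x) * f' x ^ 2
              * Real.exp (2 * s * Real.exp (lam * d x))) ∂μHE[2]) := by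
  have hOm := hO.measurableSet
  have hpd : ∀ i, ContDiff ℝ 1 (pderiv i d) := fun i =>
    (hd.fderiv_right (m := 1) (by norm_num)).clm_apply contDiff_const
  have hcont : Continuous fun x => ∑ i, pderiv i d x * pderiv i d x :=
    continuous_finsetSum _ fun i _ => (hpd i).continuous.mul (hpd i).continuous
  have hpos : ∀ x ∈ closure O, 0 < ∑ i, pderiv i d x * pderiv i d x := by
    intro x hx
    obtain ⟨i, hi⟩ := Function.ne_iff.1 (hdgrad x hx)
    exact Finset.sum_pos' (fun i _ => mul_self_nonneg _)
      ⟨i, Finset.mem_univ i, mul_self_pos.2 hi⟩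
  obtain ⟨c, hc, hcY⟩ := exists_pos_forall_le_of_continuousOn hOb.isCompact_closure
    hcont.continuousOn hpos
  obtain ⟨M, hM⟩ := exists_ae_abs_le_of_continuousOn hOm hOb hcont.continuousOn
  obtain ⟨C, lam₁, hC, hlam₁, hkey⟩ := exists_weighted_estimate hO hOb hd hd0
    (Y := fun x i => pderiv i d x) (fun i => sliceLipschitz_of_contDiff hOm hOb (hpd i) i) hc hcY
  obtain ⟨CA, hCA, hell⟩ := exists_ae_sq_grad_le_opP hΩ hO hOb hOΩ hA hAc hdet
  set C₂ := (1 + C * |M|) * CA with hC₂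
  have hC₂0 : 0 ≤ C₂ := by positivity
  -- `2 * C₂ ≤ lam ≤ s * lam * φ` makes `C₂ * f ^ 2` at most half of the left-hand side
  refine ⟨2 * C₂ + 2 * C, lam₁ + 2 * C₂, by positivity, by linarith, ?_⟩
  intro lam s hlam hs f hf f' hf'
  have hlam1 : 1 ≤ lam := by linarith
  obtain ⟨F, hF, hFτ⟩ := hf'.exists_strongApprox hΩ hf
  have hFO := hF.mono hOΩ
  have hk := hkey lam s (s * lam) 1 (by linarith) hs (by positivity) (by norm_num) F f _ f' hFO hFτ
  set E : E3 → ℝ := fun x => Real.exp (2 * s * Real.exp (lam * d x)) with hE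
  set a : E3 → ℝ := fun x => (sqNorm (weakGrad Ω f x)
    + s ^ 2 * lam ^ 2 * Real.exp (lam * d x) ^ 2 * f x ^ 2) * E x with ha
  set B := ∫⁻ x in frontier O, ENNReal.ofReal (s * lam * Real.exp (lam * d x) * f' x ^ 2 * E x)
    ∂μHE[2] with hB
  have e1 : ∀ x, weight d lam s (s * lam) 1 x * (s * lam * Real.exp (lam * d x)) * f x ^ 2 =
      s ^ 2 * lam ^ 2 * Real.exp (lam * d x) ^ 2 * f x ^ 2 * E x := fun x => by
    rw [weight_one]; ring
  have e2 : ∀ x, weight d lam s (s * lam) 1 x / (s * lam * Real.exp (lam * d x)) *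
      (∑ i, weakPartial Ω i f x * pderiv i d x) ^ 2 =
        E x * (∑ i, weakPartial Ω i f x * pderiv i d x) ^ 2 := fun x => by
    rw [weight_one, mul_div_cancel_left₀ _ (by positivity)]
  have e3 : ∀ x, weight d lam s (s * lam) 1 x * f' x ^ 2 =
      s * lam * Real.exp (lam * d x) * f' x ^ 2 * E x := fun x => by
    rw [weight_one]; ring
  simp only [e1, e2, e3] at hk
  have hmg : AEMeasurable (fun x => sqNorm (weakGrad Ω f x) * E x) (volume.restrict O) := by
    have hEm : AEMeasurable E (volume.restrict O) := by
      have : Continuous E := by have := hd.continuous; fun_prop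
      exact this.aemeasurable
    refine AEMeasurable.mul ?_ hEm
    exact Finset.aemeasurable_fun_sum _ fun i _ => ((hFO.memLp_grad i).1.aemeasurable.pow_const 2)
  have h1 : ∫⁻ x in O, ENNReal.ofReal (a x) ≤ (∫⁻ x in O, ENNReal.ofReal
      (sqNorm (weakGrad Ω f x) * E x + C * (E x * (∑ i, weakPartial Ω i f x * pderiv i d x) ^ 2)))
      + ENNReal.ofReal C * B := by
    calc ∫⁻ x in O, ENNReal.ofReal (a x)
        ≤ ∫⁻ x in O, (ENNReal.ofReal (sqNorm (weakGrad Ω f x) * E x) + ENNReal.ofReal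
            (s ^ 2 * lam ^ 2 * Real.exp (lam * d x) ^ 2 * f x ^ 2 * E x)) := by
          refine lintegral_mono fun x => ?_
          simp only [ha]
          rw [add_mul]
          exact ENNReal.ofReal_add_le
      _ = (∫⁻ x in O, ENNReal.ofReal (sqNorm (weakGrad Ω f x) * E x)) + ∫⁻ x in O, ENNReal.ofReal
            (s ^ 2 * lam ^ 2 * Real.exp (lam * d x) ^ 2 * f x ^ 2 * E x) :=
          lintegral_add_left' hmg.ennreal_ofReal _
      _ ≤ (∫⁻ x in O, ENNReal.ofReal (sqNorm (weakGrad Ω f x) * E x)) + (ENNReal.ofReal C *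
            (∫⁻ x in O, ENNReal.ofReal (E x * (∑ i, weakPartial Ω i f x * pderiv i d x) ^ 2))
              + ENNReal.ofReal C * B) := by gcongr
      _ = ((∫⁻ x in O, ENNReal.ofReal (sqNorm (weakGrad Ω f x) * E x)) +
            (∫⁻ x in O, ENNReal.ofReal C * ENNReal.ofReal
              (E x * (∑ i, weakPartial Ω i f x * pderiv i d x) ^ 2))) + ENNReal.ofReal C * B := by
          rw [lintegral_const_mul' _ _ ENNReal.ofReal_ne_top, add_assoc]
      _ ≤ _ := by
          gcongr
          refine (le_lintegral_add _ _).trans (lintegral_mono fun x => ?_)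
          rw [← ENNReal.ofReal_mul hC.le, ← ENNReal.ofReal_add]
          · exact mul_nonneg (Finset.sum_nonneg fun _ _ => sq_nonneg _) (Real.exp_pos _).le
          · exact mul_nonneg hC.le (mul_nonneg (Real.exp_pos _).le (sq_nonneg _))
  have h2 := lintegral_le_of_absorb (r := fun x => sqNorm (opP Ω A f x) * E x)
    (integrableOn_energy hO hOb hOΩ hd.continuous lam s hF) hC₂0 h1 ?_
  · refine h2.trans ?_
    rw [← mul_assoc (2 : ℝ≥0∞)]
    have : (2 : ℝ≥0∞) * ENNReal.ofReal C = ENNReal.ofReal (2 * C) := by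
      rw [ENNReal.ofReal_mul two_pos.le, ENNReal.ofReal_ofNat]
    rw [this]
    gcongr <;> linarith
  · filter_upwards [hell F f _ hF, hM, ae_restrict_mem hOm] with x hx hxM hxO
    have hW := le_parameter hlam1 hs (hd0 x (subset_closure hxO))
    have hE0 : 0 < E x := Real.exp_pos _
    have hg : sqNorm (weakGrad Ω f x) = ∑ i, weakPartial Ω i f x ^ 2 := rfl
    have hcs : (∑ i, weakPartial Ω i f x * pderiv i d x) ^ 2 ≤
        sqNorm (weakGrad Ω f x) * |M| := by
      refine (Finset.sum_mul_sq_le_sq_mul_sq _ _ _).trans ?_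
      rw [hg]
      gcongr
      simp only [pow_two]
      exact (le_abs_self _).trans (hxM.trans (le_abs_self _))
    have hlow : C₂ * f x ^ 2 ≤ (s ^ 2 * lam ^ 2 * Real.exp (lam * d x) ^ 2 * f x ^ 2) / 2 := by
      have hW2 : 2 * C₂ ≤ (s * lam * Real.exp (lam * d x)) ^ 2 := by nlinarith
      have := mul_le_mul_of_nonneg_right hW2 (sq_nonneg (f x))
      nlinarith
    have hg0 : 0 ≤ sqNorm (weakGrad Ω f x) := Finset.sum_nonneg fun _ _ => sq_nonneg _
    calc sqNorm (weakGrad Ω f x) * E x + C * (E x * (∑ i, weakPartial Ω i f x * pderiv i d x) ^ 2)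
        ≤ sqNorm (weakGrad Ω f x) * E x + C * (E x * (sqNorm (weakGrad Ω f x) * |M|)) := by gcongr
      _ = (1 + C * |M|) * sqNorm (weakGrad Ω f x) * E x := by ring
      _ ≤ (1 + C * |M|) * (CA * (sqNorm (opP Ω A f x) + f x ^ 2)) * E x := by
          gcongr
          exact hx
      _ = C₂ * (sqNorm (opP Ω A f x) * E x) + C₂ * f x ^ 2 * E x := by rw [hC₂]; ring
      _ ≤ C₂ * (sqNorm (opP Ω A f x) * E x) +
          (s ^ 2 * lam ^ 2 * Real.exp (lam * d x) ^ 2 * f x ^ 2) / 2 * E x := by gcongr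
      _ ≤ _ := by
          have := mul_nonneg hg0 hE0.le
          linarith

/-! ### The Carleman estimate for `Q` -/

/-- The scalar product of `u` with `b × (v × b) = |b|² v - (b · v) b` is that of `u × b` with
`v × b`. -/
lemma sum_mul_doubleCross (u v b : Fin 3 → ℝ) :
    ∑ i, u i * ∑ j, (b j * b j * v i - b j * v j * b i) =
      ∑ k, (u (k + 1) * b (k + 2) - u (k + 2) * b (k + 1)) *
        (v (k + 1) * b (k + 2) - v (k + 2) * b (k + 1)) := by
  simp only [Fin.sum_univ_three, Fin.isValue, Fin.reduceAdd, zero_add]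
  ring

lemma sum_sq_cross_pos {v b : Fin 3 → ℝ} (h : crossProduct v b ≠ 0) :
    0 < ∑ k : Fin 3, (v (k + 1) * b (k + 2) - v (k + 2) * b (k + 1)) *
        (v (k + 1) * b (k + 2) - v (k + 2) * b (k + 1)) := by
  obtain ⟨k, hk⟩ := Function.ne_iff.1 h
  refine Finset.sum_pos' (fun i _ => mul_self_nonneg _) ⟨k, Finset.mem_univ k, mul_self_pos.2 ?_⟩
  rw [cross_apply] at hk
  fin_cases k <;> exact hk

/-- `∇g × b` is controlled by `Q g` and `g`, and `∇∂ₖg × b` by `∂ₖ Q g`, `∇g` and `g`: the product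
rule for `Q g = ∇g × b + g rot b`, applied once and twice. -/
lemma exists_ae_sq_cross_le_opQ {Ω : Set E3} (hΩ : IsOpen Ω) {b : E3 → Fin 3 → ℝ}
    (hb : ∀ i, MemW Ω ⊤ 2 (fun x => b x i)) :
    ∃ C : ℝ, 0 ≤ C ∧ ∀ g : E3 → ℝ, MemW Ω 2 2 g →
      ∀ (F : ℕ → E3 → ℝ) (F' : Fin 3 → ℕ → E3 → ℝ),
      StrongApprox Ω F g (fun i => weakPartial Ω i g) →
      (∀ k, StrongApprox Ω (F' k) (weakPartial Ω k g)
        (fun i => weakPartial Ω i (weakPartial Ω k g))) →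
      ∀ᵐ x ∂volume.restrict Ω,
        ∑ m, (weakPartial Ω (m + 1) g x * b x (m + 2)
          - weakPartial Ω (m + 2) g x * b x (m + 1)) ^ 2 ≤
            C * (sqNorm (opQ Ω b g x) + g x ^ 2) ∧
        ∀ k, ∑ m, (weakPartial Ω (m + 1) (weakPartial Ω k g) x * b x (m + 2)
          - weakPartial Ω (m + 2) (weakPartial Ω k g) x * b x (m + 1)) ^ 2 ≤
            C * (∑ m, weakPartial Ω k (fun y => opQ Ω b g y m) x ^ 2
              + (sqNorm (weakGrad Ω g x) + g x ^ 2)) := by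
  have hb1 : ∀ i, MemW Ω ⊤ 1 (fun x => b x i) := fun i => (hb i).of_two
  have hb2 : ∀ i j, MemW Ω ⊤ 1 (weakPartial Ω j (fun x => b x i)) := fun i j =>
    (hb i).memW_weakPartial hΩ j
  obtain ⟨N₁, hN₁0, hN₁⟩ := exists_forall_ae_abs_le
    (a := fun (p : Fin 3 × Fin 3) => weakPartial Ω p.2 (fun y => b y p.1))
    (fun p => (hb2 p.1 p.2).memLp)
  obtain ⟨N₂, hN₂0, hN₂⟩ := exists_forall_ae_abs_le
    (a := fun (p : Fin 3 × Fin 3 × Fin 3) =>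
      weakPartial Ω p.2.2 (weakPartial Ω p.2.1 (fun y => b y p.1)))
    (fun p => ((hb2 p.1 p.2.1).memW_weakPartial hΩ p.2.2).memLp)
  set N := N₁ + N₂ with hN
  refine ⟨2 + 216 * N ^ 2, by positivity, fun g hg F F' hF hF' => ?_⟩
  have hQ := fun m => opQ_ae_eq hΩ hb1 hF m
  -- the weak derivatives of the components of `Q g`
  have hDQ : ∀ k m, weakPartial Ω k (fun y => opQ Ω b g y m) =ᵐ[volume.restrict Ω] fun x =>
      ((weakPartial Ω k (weakPartial Ω (m + 1) g) x * b x (m + 2) +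
        weakPartial Ω (m + 1) g x * weakPartial Ω k (fun y => b y (m + 2)) x) +
       (weakPartial Ω k g x * weakPartial Ω (m + 1) (fun y => b y (m + 2)) x +
        g x * weakPartial Ω k (weakPartial Ω (m + 1) (fun y => b y (m + 2))) x)) -
      ((weakPartial Ω k (weakPartial Ω (m + 2) g) x * b x (m + 1) +
        weakPartial Ω (m + 2) g x * weakPartial Ω k (fun y => b y (m + 1)) x) +
       (weakPartial Ω k g x * weakPartial Ω (m + 2) (fun y => b y (m + 1)) x +
        g x * weakPartial Ω k (weakPartial Ω (m + 2) (fun y => b y (m + 1))) x)) := by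
    intro k m
    refine HasWeakPartial.weakPartial_ae_eq hΩ
      (HasWeakPartial.congr hΩ ?_ (hQ m).symm (EventuallyEq.refl _ _))
    exact (((hF' (m + 1)).hasWeakPartial_mul hΩ (hb1 (m + 2)) k).add
      (hF.hasWeakPartial_mul hΩ (hb2 (m + 2) (m + 1)) k)).sub
      (((hF' (m + 2)).hasWeakPartial_mul hΩ (hb1 (m + 1)) k).add
      (hF.hasWeakPartial_mul hΩ (hb2 (m + 1) (m + 2)) k))
  have hQ' := ae_all_iff.2 hQ
  have hDQ' := ae_all_iff.2 fun k => ae_all_iff.2 fun m => hDQ k m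
  have hcomm := ae_all_iff.2 fun i => ae_all_iff.2 fun j => hg.weakPartial_comm hΩ i j
  filter_upwards [hN₁, hN₂, hQ', hDQ', hcomm] with x h1 h2 h3 h4 h5
  have hβ : ∀ i j, |weakPartial Ω j (fun y => b y i) x| ≤ N := fun i j =>
    (h1 (i, j)).trans (by linarith)
  have hβ2 : ∀ i j k, |weakPartial Ω k (weakPartial Ω j (fun y => b y i)) x| ≤ N := fun i j k =>
    (h2 (i, j, k)).trans (by linarith)
  have hN0 : 0 ≤ N := by positivity
  set S := sqNorm (weakGrad Ω g x) + g x ^ 2 with hS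
  have hgS : 0 ≤ sqNorm (weakGrad Ω g x) := Finset.sum_nonneg fun _ _ => sq_nonneg _
  have hS0 : 0 ≤ S := by positivity
  set σ := Real.sqrt S with hσ
  have hσ2 : σ ^ 2 = S := Real.sq_sqrt hS0
  have hσ0 : 0 ≤ σ := Real.sqrt_nonneg _
  have hg' : |g x| ≤ σ := Real.abs_le_sqrt (by linarith)
  have hgi : ∀ i, |weakPartial Ω i g x| ≤ σ := fun i => by
    refine Real.abs_le_sqrt ?_
    have : weakPartial Ω i g x ^ 2 ≤ sqNorm (weakGrad Ω g x) :=
      Finset.single_le_sum (f := fun i => weakPartial Ω i g x ^ 2) (fun i _ => sq_nonneg _)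
        (Finset.mem_univ i)
    have := sq_nonneg (g x)
    linarith
  have hmul : ∀ {p q A B : ℝ}, |p| ≤ A → |q| ≤ B → |p * q| ≤ A * B := fun {p q A B} hp hq => by
    rw [abs_mul]
    exact mul_le_mul hp hq (abs_nonneg _) ((abs_nonneg _).trans hp)
  refine ⟨?_, fun k => ?_⟩
  · have hm : ∀ m : Fin 3, (weakPartial Ω (m + 1) g x * b x (m + 2)
          - weakPartial Ω (m + 2) g x * b x (m + 1)) ^ 2 ≤
            2 * opQ Ω b g x m ^ 2 + 8 * N ^ 2 * g x ^ 2 := by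
      intro m
      set E := g x * weakPartial Ω (m + 1) (fun y => b y (m + 2)) x
        - g x * weakPartial Ω (m + 2) (fun y => b y (m + 1)) x with hE
      have hEb : |E| ≤ 2 * (|g x| * N) := by
        refine (abs_sub _ _).trans ?_
        linarith [hmul (le_refl |g x|) (hβ (m + 2) (m + 1)),
          hmul (le_refl |g x|) (hβ (m + 1) (m + 2))]
      have hE2 : E ^ 2 ≤ 4 * N ^ 2 * g x ^ 2 := by
        have := sq_le_sq' (neg_le_of_abs_le hEb) (le_of_abs_le hEb)
        rw [mul_pow, mul_pow, sq_abs] at this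
        linarith
      have e : weakPartial Ω (m + 1) g x * b x (m + 2)
          - weakPartial Ω (m + 2) g x * b x (m + 1) = opQ Ω b g x m - E := by
        rw [h3 m, hE]; ring
      rw [e]
      nlinarith [sq_nonneg (opQ Ω b g x m + E)]
    calc _ ≤ ∑ m, (2 * opQ Ω b g x m ^ 2 + 8 * N ^ 2 * g x ^ 2) :=
          Finset.sum_le_sum fun m _ => hm m
      _ = 2 * sqNorm (opQ Ω b g x) + 24 * N ^ 2 * g x ^ 2 := by
          rw [Finset.sum_add_distrib, ← Finset.mul_sum, sqNorm]
          simp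
          ring
      _ ≤ _ := by
          have p1 : 0 ≤ sqNorm (opQ Ω b g x) := Finset.sum_nonneg fun _ _ => sq_nonneg _
          nlinarith [mul_nonneg (sq_nonneg N) p1, mul_nonneg (sq_nonneg N) (sq_nonneg (g x)),
            sq_nonneg (g x)]
  · have hm : ∀ m : Fin 3, (weakPartial Ω (m + 1) (weakPartial Ω k g) x * b x (m + 2)
          - weakPartial Ω (m + 2) (weakPartial Ω k g) x * b x (m + 1)) ^ 2 ≤
            2 * weakPartial Ω k (fun y => opQ Ω b g y m) x ^ 2 + 72 * N ^ 2 * S := by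
      intro m
      set E := (weakPartial Ω (m + 1) g x * weakPartial Ω k (fun y => b y (m + 2)) x +
         (weakPartial Ω k g x * weakPartial Ω (m + 1) (fun y => b y (m + 2)) x +
          g x * weakPartial Ω k (weakPartial Ω (m + 1) (fun y => b y (m + 2))) x)) -
        (weakPartial Ω (m + 2) g x * weakPartial Ω k (fun y => b y (m + 1)) x +
         (weakPartial Ω k g x * weakPartial Ω (m + 2) (fun y => b y (m + 1)) x +
          g x * weakPartial Ω k (weakPartial Ω (m + 2) (fun y => b y (m + 1))) x)) with hE
      have hEb : |E| ≤ 6 * (σ * N) := by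
        refine (abs_sub _ _).trans ?_
        have a1 := abs_add_three
          (weakPartial Ω (m + 1) g x * weakPartial Ω k (fun y => b y (m + 2)) x)
          (weakPartial Ω k g x * weakPartial Ω (m + 1) (fun y => b y (m + 2)) x)
          (g x * weakPartial Ω k (weakPartial Ω (m + 1) (fun y => b y (m + 2))) x)
        have a2 := abs_add_three
          (weakPartial Ω (m + 2) g x * weakPartial Ω k (fun y => b y (m + 1)) x)
          (weakPartial Ω k g x * weakPartial Ω (m + 2) (fun y => b y (m + 1)) x)
          (g x * weakPartial Ω k (weakPartial Ω (m + 2) (fun y => b y (m + 1))) x)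
        rw [add_assoc] at a1 a2
        linarith [hmul (hgi (m + 1)) (hβ (m + 2) k), hmul (hgi k) (hβ (m + 2) (m + 1)),
          hmul hg' (hβ2 (m + 2) (m + 1) k), hmul (hgi (m + 2)) (hβ (m + 1) k),
          hmul (hgi k) (hβ (m + 1) (m + 2)), hmul hg' (hβ2 (m + 1) (m + 2) k)]
      have hE2 : E ^ 2 ≤ 36 * N ^ 2 * S := by
        have := sq_le_sq' (neg_le_of_abs_le hEb) (le_of_abs_le hEb)
        rw [mul_pow, mul_pow, hσ2] at this
        linarith
      have e : weakPartial Ω (m + 1) (weakPartial Ω k g) x * b x (m + 2)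
          - weakPartial Ω (m + 2) (weakPartial Ω k g) x * b x (m + 1) =
          weakPartial Ω k (fun y => opQ Ω b g y m) x - E := by
        rw [h4 k m, hE, h5 (m + 1) k, h5 (m + 2) k]; ring
      rw [e]
      nlinarith [sq_nonneg (weakPartial Ω k (fun y => opQ Ω b g y m) x + E)]
    calc _ ≤ ∑ m, (2 * weakPartial Ω k (fun y => opQ Ω b g y m) x ^ 2 + 72 * N ^ 2 * S) :=
          Finset.sum_le_sum fun m _ => hm m
      _ = 2 * ∑ m, weakPartial Ω k (fun y => opQ Ω b g y m) x ^ 2 + 216 * N ^ 2 * S := by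
          rw [Finset.sum_add_distrib, ← Finset.mul_sum]
          simp
          ring
      _ ≤ _ := by
          have p1 : 0 ≤ ∑ m, weakPartial Ω k (fun y => opQ Ω b g y m) x ^ 2 :=
            Finset.sum_nonneg fun _ _ => sq_nonneg _
          nlinarith [mul_nonneg (sq_nonneg N) p1, mul_nonneg (sq_nonneg N) hS0]

lemma sum_lintegral_le_lintegral_sum {α ι : Type*} [MeasurableSpace α] {μ : Measure α}
    (T : Finset ι) (u : ι → α → ℝ≥0∞) : ∑ k ∈ T, ∫⁻ x, u k x ∂μ ≤ ∫⁻ x, ∑ k ∈ T, u k x ∂μ := by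
  classical
  induction T using Finset.induction_on with
  | empty => simp
  | insert k T hk ih =>
    simp only [Finset.sum_insert hk]
    exact (add_le_add le_rfl ih).trans (le_lintegral_add _ _)

/-- The vector field `b × (∇d × b)` is orthogonal to `b`, so that the derivative along it is
controlled by `Q`, and transversal to the level sets of `d`. The weighted estimate along this field
is applied to `g` with the weight `sλφ e^{2sφ}` and to each `∂ₖg` with the weight
`(sλφ)⁻¹ e^{2sφ}`. -/
theorem exists_carleman_estimate_opQ {Ω O : Set E3} (hΩ : IsOpen Ω) (hO : IsOpen O)
    (hOb : Bornology.IsBounded O) (hOΩ : O ⊆ Ω) {d : E3 → ℝ} (hd : ContDiff ℝ 2 d)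
    (hd0 : ∀ x ∈ closure O, 0 ≤ d x) {b : E3 → Fin 3 → ℝ}
    (hb : ∀ i, MemW Ω ⊤ 2 (fun x => b x i)) (hbΩ : ContinuousOn b (closure Ω))
    (hcross : ∀ x ∈ closure O, crossProduct (grad d x) (b x) ≠ 0) :
    ∃ C lam₀ : ℝ, 0 < C ∧ 1 ≤ lam₀ ∧ ∀ lam s : ℝ, lam₀ ≤ lam → 1 ≤ s →
      ∀ g : E3 → ℝ, MemW Ω 2 2 g → ∀ g' : E3 → ℝ, IsTraceOn Ω (frontier O) g g' →
      ∀ Dg' : E3 → Fin 3 → ℝ,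
        (∀ i, IsTraceOn Ω (frontier O) (weakPartial Ω i g) (fun x => Dg' x i)) →
        ∫⁻ x in O, ENNReal.ofReal ((sqNorm (weakGrad Ω g x)
            + s ^ 2 * lam ^ 2 * Real.exp (lam * d x) ^ 2 * g x ^ 2)
              * Real.exp (2 * s * Real.exp (lam * d x))) ≤
          ENNReal.ofReal C * (∫⁻ x in O, ENNReal.ofReal
            ((1 / (s ^ 2 * lam ^ 2 * Real.exp (lam * d x) ^ 2) *
                (∑ k, sqNorm (weakGrad Ω (fun y => opQ Ω b g y k) x))
              + sqNorm (opQ Ω b g x)) * Real.exp (2 * s * Real.exp (lam * d x))))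
          + ENNReal.ofReal C * (∫⁻ x in frontier O, ENNReal.ofReal
            ((1 / (s * lam * Real.exp (lam * d x)) * sqNorm (Dg' x)
              + s * lam * Real.exp (lam * d x) * g' x ^ 2)
                * Real.exp (2 * s * Real.exp (lam * d x))) ∂μHE[2]) := by
  have hOm := hO.measurableSet
  have hbc : ∀ i, ContinuousOn (fun x => b x i) (closure Ω) := fun i =>
    (continuous_apply i).comp_continuousOn hbΩ
  have hpd : ∀ i, ContDiff ℝ 1 (pderiv i d) := fun i =>
    (hd.fderiv_right (m := 1) (by norm_num)).clm_apply contDiff_const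
  have hle : volume.restrict O ≤ volume.restrict Ω := Measure.restrict_mono_set _ hOΩ
  have hbL : ∀ i j, SliceLipschitz O i (fun x => b x j) := by
    intro i j
    have hbj := (hb j).of_two
    have hm := (hbj.memW_weakPartial hΩ i).memLp
    obtain ⟨M, _, hM⟩ := MemLp.ae_abs_le hm
    exact ⟨(hbc j).mono (closure_mono hOΩ), weakPartial Ω i (fun x => b x j),
      ((hbj.hasWeakPartial i).sliceDeriv hΩ hbj.memLp hm ((hbc j).mono subset_closure)).mono hOΩ,
      hm.1.mono_measure hle, M, ae_mono hle hM⟩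
  have hdL : ∀ i j, SliceLipschitz O i (pderiv j d) := fun i j =>
    sliceLipschitz_of_contDiff hOm hOb (hpd j) i
  set Y : E3 → Fin 3 → ℝ := fun x i =>
    ∑ j, (b x j * b x j * pderiv i d x - b x j * pderiv j d x * b x i) with hY
  have hYL : ∀ i, SliceLipschitz O i (fun x => Y x i) := by
    intro i
    have ht : ∀ j, SliceLipschitz O i
        (fun x => b x j * b x j * pderiv i d x - b x j * pderiv j d x * b x i) := fun j =>
      (((hbL i j).mul hOm hOb (hbL i j)).mul hOm hOb (hdL i i)).sub
        (((hbL i j).mul hOm hOb (hdL i j)).mul hOm hOb (hbL i i))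
    simp only [hY, Fin.sum_univ_three]
    exact ((ht 0).add (ht 1)).add (ht 2)
  set κ : E3 → ℝ := fun x => ∑ i, pderiv i d x * Y x i with hκ
  have hκeq : ∀ x, κ x = ∑ k : Fin 3,
      (grad d x (k + 1) * b x (k + 2) - grad d x (k + 2) * b x (k + 1)) *
        (grad d x (k + 1) * b x (k + 2) - grad d x (k + 2) * b x (k + 1)) := fun x =>
    sum_mul_doubleCross (grad d x) (grad d x) (b x)
  have hκc : ContinuousOn κ (closure O) :=
    continuousOn_finsetSum _ fun i _ => (hpd i).continuous.continuousOn.mul (hYL i).1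
  have hκpos : ∀ x ∈ closure O, 0 < κ x := fun x hx => by
    rw [hκeq]; exact sum_sq_cross_pos (hcross x hx)
  obtain ⟨c, hc, hcY⟩ := exists_pos_forall_le_of_continuousOn hOb.isCompact_closure hκc hκpos
  obtain ⟨M, hM⟩ := exists_ae_abs_le_of_continuousOn hOm hOb hκc
  obtain ⟨C, lam₁, hC, hlam₁, hkey⟩ := exists_weighted_estimate hO hOb hd hd0 hYL hc hcY
  obtain ⟨C₃, hC₃, hell⟩ := exists_ae_sq_cross_le_opQ hΩ hb
  set C₂ := C * |M| * C₃ with hC₂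
  have hC₂0 : 0 ≤ C₂ := by positivity
  -- `1 + 8 * C₂ ≤ lam ≤ s * lam * φ` makes the lower order terms at most half of the left-hand side
  refine ⟨2 * C₂ + 2 * C, lam₁ + 8 * C₂, by positivity, by linarith, ?_⟩
  intro lam s hlam hs g hg g' hg' Dg' hDg'
  have hlam1 : 1 ≤ lam := by linarith
  obtain ⟨F, hF, hFτ⟩ := hg'.exists_strongApprox hΩ hg.of_two
  choose F' hF' hFτ' using fun k => (hDg' k).exists_strongApprox hΩ (hg.memW_weakPartial hΩ k)
  have hFO := hF.mono hOΩ
  set E : E3 → ℝ := fun x => Real.exp (2 * s * Real.exp (lam * d x)) with hE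
  set I : E3 → ℝ := fun x => 1 / (s ^ 2 * lam ^ 2 * Real.exp (lam * d x) ^ 2) with hI
  set V : E3 → ℝ := fun x => ∑ i, weakPartial Ω i g x * Y x i with hV
  set V' : Fin 3 → E3 → ℝ := fun k x =>
    ∑ i, weakPartial Ω i (weakPartial Ω k g) x * Y x i with hV'
  -- the weighted estimate for `g`
  have hk0 : ∫⁻ x in O, ENNReal.ofReal
        (s ^ 2 * lam ^ 2 * Real.exp (lam * d x) ^ 2 * g x ^ 2 * E x) ≤
      ENNReal.ofReal C * (∫⁻ x in O, ENNReal.ofReal (E x * V x ^ 2)) + ENNReal.ofReal C *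
        ∫⁻ x in frontier O, ENNReal.ofReal (s * lam * Real.exp (lam * d x) * g' x ^ 2 * E x)
          ∂μHE[2] := by
    have hk := hkey lam s (s * lam) 1 (by linarith) hs (by positivity) (by norm_num) F g _ g'
      hFO hFτ
    have e1 : ∀ x, weight d lam s (s * lam) 1 x * (s * lam * Real.exp (lam * d x)) * g x ^ 2 =
        s ^ 2 * lam ^ 2 * Real.exp (lam * d x) ^ 2 * g x ^ 2 * E x := fun x => by
      rw [weight_one]; ring
    have e2 : ∀ x, weight d lam s (s * lam) 1 x / (s * lam * Real.exp (lam * d x)) *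
        (∑ i, weakPartial Ω i g x * Y x i) ^ 2 = E x * V x ^ 2 := fun x => by
      rw [weight_one, mul_div_cancel_left₀ _ (by positivity)]
    have e3 : ∀ x, weight d lam s (s * lam) 1 x * g' x ^ 2 =
        s * lam * Real.exp (lam * d x) * g' x ^ 2 * E x := fun x => by
      rw [weight_one]; ring
    simp only [e1, e2, e3] at hk
    exact hk
  -- the weighted estimate for the derivatives of `g`
  have hk1 : ∀ k, ∫⁻ x in O, ENNReal.ofReal (weakPartial Ω k g x ^ 2 * E x) ≤
      ENNReal.ofReal C * (∫⁻ x in O, ENNReal.ofReal (I x * E x * V' k x ^ 2))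
      + ENNReal.ofReal C * ∫⁻ x in frontier O, ENNReal.ofReal
        (1 / (s * lam * Real.exp (lam * d x)) * Dg' x k ^ 2 * E x) ∂μHE[2] := by
    intro k
    have hk := hkey lam s (1 / (s * lam)) (-1) (by linarith) hs (by positivity) le_rfl (F' k)
      (weakPartial Ω k g) _ (fun x => Dg' x k) ((hF' k).mono hOΩ) (hFτ' k)
    have e1 : ∀ x, weight d lam s (1 / (s * lam)) (-1) x * (s * lam * Real.exp (lam * d x)) *
        weakPartial Ω k g x ^ 2 = weakPartial Ω k g x ^ 2 * E x := fun x => by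
      have h0 : s * lam * Real.exp (lam * d x) ≠ 0 := by positivity
      rw [weight_neg_one, mul_right_comm (1 / _), one_div_mul_cancel h0, one_mul, mul_comm]
    have e2 : ∀ x, weight d lam s (1 / (s * lam)) (-1) x / (s * lam * Real.exp (lam * d x)) *
        (∑ i, weakPartial Ω i (weakPartial Ω k g) x * Y x i) ^ 2 = I x * E x * V' k x ^ 2 :=
      fun x => by
        have hIx : I x = (1 / (s * lam * Real.exp (lam * d x))) ^ 2 := by
          simp only [hI]; rw [one_div_pow, mul_pow, mul_pow]
        rw [weight_neg_one, hIx]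
        simp only [hV', hE]
        ring
    have e3 : ∀ x, weight d lam s (1 / (s * lam)) (-1) x * Dg' x k ^ 2 =
        1 / (s * lam * Real.exp (lam * d x)) * Dg' x k ^ 2 * E x := fun x => by
      rw [weight_neg_one]; ring
    simp only [e1, e2, e3] at hk
    exact hk
  set a : E3 → ℝ := fun x => (sqNorm (weakGrad Ω g x)
    + s ^ 2 * lam ^ 2 * Real.exp (lam * d x) ^ 2 * g x ^ 2) * E x with ha
  set B := ∫⁻ x in frontier O, ENNReal.ofReal ((1 / (s * lam * Real.exp (lam * d x)) *
    sqNorm (Dg' x) + s * lam * Real.exp (lam * d x) * g' x ^ 2) * E x) ∂μHE[2] with hB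
  set B₀ := ∫⁻ x in frontier O, ENNReal.ofReal (s * lam * Real.exp (lam * d x) * g' x ^ 2 * E x)
    ∂μHE[2] with hB₀
  set B' : Fin 3 → ℝ≥0∞ := fun k => ∫⁻ x in frontier O, ENNReal.ofReal
    (1 / (s * lam * Real.exp (lam * d x)) * Dg' x k ^ 2 * E x) ∂μHE[2] with hB'
  have hE0 : ∀ x, 0 < E x := fun x => Real.exp_pos _
  have hI0 : ∀ x, 0 ≤ I x := fun x => by simp only [hI]; positivity
  have hBsum : ∑ k, B' k + B₀ ≤ B := by
    refine (add_le_add (sum_lintegral_le_lintegral_sum _ _) le_rfl).trans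
      ((le_lintegral_add _ _).trans (lintegral_mono fun x => le_of_eq ?_))
    have hx := hE0 x
    rw [← ENNReal.ofReal_sum_of_nonneg fun k _ => by positivity,
      ← ENNReal.ofReal_add (Finset.sum_nonneg fun k _ => by positivity) (by positivity),
      ← Finset.sum_mul, ← Finset.mul_sum, ← add_mul, sqNorm]
  have hEm : AEMeasurable E (volume.restrict O) := by
    have : Continuous E := by have := hd.continuous; fun_prop
    exact this.aemeasurable
  have hmg : ∀ k, AEMeasurable (fun x => ENNReal.ofReal (weakPartial Ω k g x ^ 2 * E x))
      (volume.restrict O) := fun k =>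
    (((hFO.memLp_grad k).1.aemeasurable.pow_const 2).mul hEm).ennreal_ofReal
  have h1 : ∫⁻ x in O, ENNReal.ofReal (a x) ≤ (∫⁻ x in O, ENNReal.ofReal
      (C * (∑ k, I x * E x * V' k x ^ 2 + E x * V x ^ 2))) + ENNReal.ofReal C * B := by
    calc ∫⁻ x in O, ENNReal.ofReal (a x)
        ≤ ∫⁻ x in O, (∑ k, ENNReal.ofReal (weakPartial Ω k g x ^ 2 * E x) + ENNReal.ofReal
            (s ^ 2 * lam ^ 2 * Real.exp (lam * d x) ^ 2 * g x ^ 2 * E x)) := by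
          refine lintegral_mono fun x => ?_
          have hx := hE0 x
          rw [← ENNReal.ofReal_sum_of_nonneg fun k _ => by positivity, ← Finset.sum_mul]
          simp only [ha]
          rw [add_mul]
          exact ENNReal.ofReal_add_le
      _ = ∑ k, (∫⁻ x in O, ENNReal.ofReal (weakPartial Ω k g x ^ 2 * E x)) +
            ∫⁻ x in O, ENNReal.ofReal
              (s ^ 2 * lam ^ 2 * Real.exp (lam * d x) ^ 2 * g x ^ 2 * E x) := by
          rw [lintegral_add_left' (Finset.aemeasurable_fun_sum _ fun k _ => hmg k),
            lintegral_finsetSum' _ fun k _ => hmg k]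
      _ ≤ ∑ k, (ENNReal.ofReal C * (∫⁻ x in O, ENNReal.ofReal (I x * E x * V' k x ^ 2))
            + ENNReal.ofReal C * B' k) +
          (ENNReal.ofReal C * (∫⁻ x in O, ENNReal.ofReal (E x * V x ^ 2))
            + ENNReal.ofReal C * B₀) := by
          gcongr with k _
          exact hk1 k
      _ = ENNReal.ofReal C * (∑ k, (∫⁻ x in O, ENNReal.ofReal (I x * E x * V' k x ^ 2)) +
            ∫⁻ x in O, ENNReal.ofReal (E x * V x ^ 2)) +
          ENNReal.ofReal C * (∑ k, B' k + B₀) := by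
          rw [Finset.sum_add_distrib, ← Finset.mul_sum, ← Finset.mul_sum]
          ring
      _ ≤ ENNReal.ofReal C * (∫⁻ x in O, ENNReal.ofReal
            (∑ k, I x * E x * V' k x ^ 2 + E x * V x ^ 2)) + ENNReal.ofReal C * B := by
          gcongr
          refine (add_le_add (sum_lintegral_le_lintegral_sum _ _) le_rfl).trans
            ((le_lintegral_add _ _).trans (lintegral_mono fun x => le_of_eq ?_))
          have hx := hE0 x
          have hIx := hI0 x
          rw [← ENNReal.ofReal_sum_of_nonneg fun k _ => by positivity,
            ← ENNReal.ofReal_add (Finset.sum_nonneg fun k _ => by positivity) (by positivity)]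
      _ = _ := by
          rw [← lintegral_const_mul' _ _ ENNReal.ofReal_ne_top]
          simp only [← ENNReal.ofReal_mul hC.le]
  have h2 := lintegral_le_of_absorb (r := fun x => (I x *
      (∑ k, sqNorm (weakGrad Ω (fun y => opQ Ω b g y k) x)) + sqNorm (opQ Ω b g x)) * E x)
    (integrableOn_energy hO hOb hOΩ hd.continuous lam s hF) hC₂0 h1 ?_
  · refine h2.trans ?_
    rw [← mul_assoc (2 : ℝ≥0∞)]
    have : (2 : ℝ≥0∞) * ENNReal.ofReal C = ENNReal.ofReal (2 * C) := by
      rw [ENNReal.ofReal_mul two_pos.le, ENNReal.ofReal_ofNat]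
    rw [this]
    gcongr <;> linarith
  · filter_upwards [ae_mono hle (hell g hg F F' hF hF'), hM, ae_restrict_mem hOm]
      with x hx hxM hxO
    obtain ⟨hx0, hx1⟩ := hx
    have hW := le_parameter hlam1 hs (hd0 x (subset_closure hxO))
    have hEx := hE0 x
    have hIx := hI0 x
    have hκM : κ x ≤ |M| := (le_abs_self _).trans (hxM.trans (le_abs_self _))
    -- the derivative along `Y` is controlled by the vector product with `b`
    have hcs : ∀ v : Fin 3 → ℝ, (∑ i, v i * Y x i) ^ 2 ≤
        (∑ m, (v (m + 1) * b x (m + 2) - v (m + 2) * b x (m + 1)) ^ 2) * |M| := by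
      intro v
      have e : ∑ i, v i * Y x i = _ := sum_mul_doubleCross v (grad d x) (b x)
      rw [e]
      refine (Finset.sum_mul_sq_le_sq_mul_sq _ _ _).trans ?_
      gcongr
      simp only [pow_two]
      rw [← hκeq]
      exact hκM
    set G := sqNorm (weakGrad Ω g x) with hG
    have hG0 : 0 ≤ G := Finset.sum_nonneg fun _ _ => sq_nonneg _
    set Q₁ := ∑ k, sqNorm (weakGrad Ω (fun y => opQ Ω b g y k) x) with hQ₁
    have hV0 : V x ^ 2 ≤ C₃ * (sqNorm (opQ Ω b g x) + g x ^ 2) * |M| :=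
      (hcs fun i => weakPartial Ω i g x).trans (by gcongr)
    have hV1 : ∑ k, V' k x ^ 2 ≤ C₃ * (Q₁ + 3 * (G + g x ^ 2)) * |M| := by
      calc ∑ k, V' k x ^ 2 ≤ ∑ k, C₃ * (∑ m, weakPartial Ω k (fun y => opQ Ω b g y m) x ^ 2
              + (G + g x ^ 2)) * |M| := by
            refine Finset.sum_le_sum fun k _ => ?_
            exact (hcs fun i => weakPartial Ω i (weakPartial Ω k g) x).trans
              (mul_le_mul_of_nonneg_right (hx1 k) (abs_nonneg _))
        _ = _ := by
            have hQ : ∑ k, ∑ m, weakPartial Ω k (fun y => opQ Ω b g y m) x ^ 2 = Q₁ :=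
              Finset.sum_comm
            rw [← Finset.sum_mul, ← Finset.mul_sum, Finset.sum_add_distrib, hQ, Finset.sum_const,
              Finset.card_univ, Fintype.card_fin, nsmul_eq_mul, Nat.cast_ofNat]
    set W := s * lam * Real.exp (lam * d x) with hWdef
    have hW2 : s ^ 2 * lam ^ 2 * Real.exp (lam * d x) ^ 2 = W ^ 2 := by rw [hWdef]; ring
    have hW1 : 1 + 8 * C₂ ≤ W := by linarith
    have hWsq : 1 + 8 * C₂ ≤ W ^ 2 := by nlinarith
    have hIC : C₂ * I x ≤ 1 / 8 := by
      simp only [hI]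
      rw [hW2, mul_one_div, div_le_iff₀ (by positivity)]
      linarith
    have hlow : C₂ * (I x * (3 * (G + g x ^ 2)) + g x ^ 2) ≤ (G + W ^ 2 * g x ^ 2) / 2 := by
      have t1 := mul_le_mul_of_nonneg_right hIC hG0
      have t2 := mul_le_mul_of_nonneg_right hIC (sq_nonneg (g x))
      have t3 := mul_le_mul_of_nonneg_right hWsq (sq_nonneg (g x))
      nlinarith [mul_nonneg hC₂0 (sq_nonneg (g x)), sq_nonneg (g x)]
    rw [← hW2] at hlow
    calc C * (∑ k, I x * E x * V' k x ^ 2 + E x * V x ^ 2)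
        = C * (I x * (∑ k, V' k x ^ 2) + V x ^ 2) * E x := by rw [← Finset.mul_sum]; ring
      _ ≤ C * (I x * (C₃ * (Q₁ + 3 * (G + g x ^ 2)) * |M|) +
            C₃ * (sqNorm (opQ Ω b g x) + g x ^ 2) * |M|) * E x := by gcongr
      _ = C₂ * ((I x * Q₁ + sqNorm (opQ Ω b g x)) * E x) +
            C₂ * (I x * (3 * (G + g x ^ 2)) + g x ^ 2) * E x := by rw [hC₂]; ring
      _ ≤ C₂ * ((I x * Q₁ + sqNorm (opQ Ω b g x)) * E x) +
            (G + s ^ 2 * lam ^ 2 * Real.exp (lam * d x) ^ 2 * g x ^ 2) / 2 * E x := by gcongr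
      _ = _ := by ring

end Carleman

theorem theorem3p5
    (Ω : Set Carleman.E3) (hΩ : Carleman.IsSmoothBoundedDomain Ω)
    -- a non-empty relatively open part of the boundary, and the function `d`
    (Γ : Set Carleman.E3) (hΓ : ∃ U : Set Carleman.E3, IsOpen U ∧ Γ = frontier Ω ∩ U)
    (hΓne : Γ.Nonempty)
    (d : Carleman.E3 → ℝ) (hd : ContDiff ℝ 2 d)
    (hdpos : ∀ x ∈ Ω, 0 < d x)
    (hdgrad : ∀ x ∈ closure Ω, Carleman.grad d x ≠ 0)
    (hdzero : ∀ x ∈ frontier Ω \ Γ, d x = 0)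
    -- the coefficients, taken as their representatives continuous up to the boundary
    (A : Carleman.E3 → Matrix (Fin 3) (Fin 3) ℝ)
    (hA : ∀ i j, Carleman.MemW Ω ⊤ 1 (fun x => A x i j))
    (hAc : ContinuousOn A (closure Ω))
    (b : Carleman.E3 → Fin 3 → ℝ)
    (hb : ∀ i, Carleman.MemW Ω ⊤ 2 (fun x => b x i))
    (hbc : ContinuousOn b (closure Ω))
    (O : Set Carleman.E3) (hO : IsOpen O) (hOΩ : O ⊆ Ω)
    (hdet : ∀ x ∈ closure O, (A x).det ≠ 0)
    (hcross : ∀ x ∈ closure O, crossProduct (Carleman.grad d x) (b x) ≠ 0) :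
    ∃ lam₀ s₀ C : ℝ, 1 ≤ lam₀ ∧ 1 ≤ s₀ ∧ 0 < C ∧
      ∀ lam s : ℝ, lam₀ ≤ lam → s₀ ≤ s →
        ∀ φ₀ : Carleman.E3 → ℝ, (∀ x, φ₀ x = Real.exp (lam * d x)) →
        (∀ f : Carleman.E3 → ℝ, Carleman.MemW Ω 2 1 f →
          -- `f'` is the trace of `f` on the boundary of `O`
          ∀ f' : Carleman.E3 → ℝ, Carleman.IsTraceOn Ω (frontier O) f f' →
          ∫⁻ x in O, ENNReal.ofReal
              ((Carleman.sqNorm (Carleman.weakGrad Ω f x)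
                + s ^ 2 * lam ^ 2 * φ₀ x ^ 2 * f x ^ 2) * Real.exp (2 * s * φ₀ x)) ≤
            ENNReal.ofReal C * (∫⁻ x in O, ENNReal.ofReal
              (Carleman.sqNorm (Carleman.opP Ω A f x) * Real.exp (2 * s * φ₀ x)))
            + ENNReal.ofReal C * (∫⁻ x in frontier O, ENNReal.ofReal
              (s * lam * φ₀ x * f' x ^ 2 * Real.exp (2 * s * φ₀ x)) ∂μHE[2])) ∧
        (∀ g : Carleman.E3 → ℝ, Carleman.MemW Ω 2 2 g →
          -- `g'` is the trace of `g`, and `Dg'` that of `∇g`, on the boundary of `O`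
          ∀ g' : Carleman.E3 → ℝ, Carleman.IsTraceOn Ω (frontier O) g g' →
          ∀ Dg' : Carleman.E3 → Fin 3 → ℝ,
            (∀ i, Carleman.IsTraceOn Ω (frontier O) (Carleman.weakPartial Ω i g)
              (fun x => Dg' x i)) →
          ∫⁻ x in O, ENNReal.ofReal
              ((Carleman.sqNorm (Carleman.weakGrad Ω g x)
                + s ^ 2 * lam ^ 2 * φ₀ x ^ 2 * g x ^ 2) * Real.exp (2 * s * φ₀ x)) ≤
            ENNReal.ofReal C * (∫⁻ x in O, ENNReal.ofReal
              ((1 / (s ^ 2 * lam ^ 2 * φ₀ x ^ 2) *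
                  (∑ k, Carleman.sqNorm
                    (Carleman.weakGrad Ω (fun y => Carleman.opQ Ω b g y k) x))
                + Carleman.sqNorm (Carleman.opQ Ω b g x)) * Real.exp (2 * s * φ₀ x)))
            + ENNReal.ofReal C * (∫⁻ x in frontier O, ENNReal.ofReal
              ((1 / (s * lam * φ₀ x) * Carleman.sqNorm (Dg' x)
                + s * lam * φ₀ x * g' x ^ 2) * Real.exp (2 * s * φ₀ x)) ∂μHE[2])) := by
  have hcl : closure O ⊆ closure Ω := closure_mono hOΩ
  have hOb : Bornology.IsBounded O := hΩ.isBounded.subset hOΩ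
  have hd0 : ∀ x ∈ closure O, 0 ≤ d x := fun x hx =>
    closure_minimal (fun y hy => (hdpos y hy).le) (isClosed_le continuous_const hd.continuous)
      (hcl hx)
  obtain ⟨C₁, l₁, hC₁, hl₁, hP⟩ := Carleman.exists_carleman_estimate_opP hΩ.isOpen hO hOb hOΩ hd
    hd0 (fun x hx => hdgrad x (hcl hx)) hA (hAc.mono hcl) hdet
  obtain ⟨C₂, l₂, hC₂, hl₂, hQ⟩ := Carleman.exists_carleman_estimate_opQ hΩ.isOpen hO hOb hOΩ hd
    hd0 hb hbc hcross
  refine ⟨max l₁ l₂, 1, max C₁ C₂, hl₁.trans (le_max_left _ _), le_rfl,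
    hC₁.trans_le (le_max_left _ _), fun lam s hlam hs φ₀ hφ₀ => ?_⟩
  obtain rfl : φ₀ = fun x => Real.exp (lam * d x) := funext hφ₀
  have h1 := ENNReal.ofReal_le_ofReal (le_max_left C₁ C₂)
  have h2 := ENNReal.ofReal_le_ofReal (le_max_right C₁ C₂)
  refine ⟨fun f hf f' hf' => ?_, fun g hg g' hg' Dg' hDg' => ?_⟩
  · exact (hP lam s ((le_max_left _ _).trans hlam) hs f hf f' hf').trans
      (add_le_add (mul_le_mul' h1 le_rfl) (mul_le_mul' h1 le_rfl))
  · exact (hQ lam s ((le_max_right _ _).trans hlam) hs g hg g' hg' Dg' hDg').trans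
      (add_le_add (mul_le_mul' h2 le_rfl) (mul_le_mul' h2 le_rfl))
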